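/- The following is a theorem of $\mathsf{ZF}$ (no choice is assumed). Let $U$ be an ultrafilter over a set $I$ (filters are proper). Structures are first-order structures with nonempty domain, for an arbitrary first-order language. For a family $(M_i)_{i\in I}$ of structures for the same language with $\prod_{i\in I}M_i\neq\emptyset$, let $\prod_{i\in I} M_i/U$ be its ultraproduct by $U$: its elements are the classes $[f]$ of $f\in\prod_{i\in I} M_i$ modulo $f\sim g\iff\{i\in I\mid f(i)=g(i)\}\in U$, with functions and constants interpreted coordinatewise and relations interpreted by "the set of $i\in I$ where the relation holds belongs to $U$". If all $M_i$ are equal to $M$, it is the ultrapower ${}^I M/U$. A $\Sigma_0=\Pi_0$ formula is a quantifier-free formula, a $\Sigma_{n+1}$ formula is $\exists x_1\cdots\exists x_k\,\psi$ with $\psi$ a $\Pi_n$ formula, and a $\Pi_{n+1}$ formula is $\forall x_1\cdots\forall x_k\,\psi$ with $\psi$ a $\Sigma_n$ formula ($k\geq 0$). Two structures for the same language are $\Sigma_n$-elementarily equivalent if they satisfy the same $\Sigma_n$ sentences. Then the following are equivalent: 1. $U$-$\mathsf{AC}_I$: for every family $(A_i)_{i\in I}$ of nonempty sets there is a function $f$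 on $I$ such that $\{i\in I\mid f(i)\in A_i\}\in U$. 2. For every structure $M$, the ultrapower ${}^I M/U$ is $\Sigma_2$-elementarily equivalent to $M$. 3. For every family $(M_i)_{i\in I}$ of pairwise isomorphic structures for the same language, if $\prod_{i\in I}M_i\neq\emptyset$, then $\prod_{i\in I}M_i/U$ is $\Sigma_1$-elementarily equivalent to $M_i$ for every $i\in I$. 4. For every two structures $M$ and $N$ for the same language, if there are elementary embeddings $j:M\to N$ and $j':N\to M$, then ${}^I M/U$ and ${}^I N/U$ are $\Sigma_2$-elementarily equivalent. 5. For every two families $(M_i)_{i\in I}$ and $(N_i)_{i\in I}$ of structures for the same language, if $M_i\cong N_i$ for each $i\in I$ and both $\prod_{i\in I}M_i$ and $\prod_{i\in I}N_i$ are nonempty, then $\prod_{i\in I}M_i/U$ is $\Sigma_1$-elementarily equivalent to $\prod_{i\in I}N_i/U$. 6. For every two families $(M_i)_{i\in I}$ and $(N_i)_{i\in I}$ of structures for the same language, if $M_i\cong N_i$ for each $i\in I$ and both $\prod_{i\in I}M_i$ and $\prod_{i\in I}N_i$ are nonempty, then $\prod_{i\in I}M_i/U$ is isomorphic to $\prod_{i\in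 I}N_i/U$. -/

import Mathlib

/-
"In ZF, ..." is rendered semantically: the theorem is about an arbitrary model `(V, ∈)` of the
first-order theory ZF. By the completeness theorem, what holds in all of them is what ZF proves.
All notions below are evaluated inside `V`: every quantifier over sets ranges over elements
of `V`, "function", "natural number", "formula" and so on are those of `V`, and no choice is used.
-/

universe u

namespace InternalZF

/-! ### Models of ZF -/

/-- The only symbol of the language of set theory is a binary relation symbol. -/
inductive SetRel : ℕ → Type
  | mem : SetRel 2

/-- The first-order language of set theory. -/
def setLanguage : FirstOrder.Language := ⟨fun _ => Empty, SetRel⟩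

instance setStructure (V : Type u) [Membership V V] : setLanguage.Structure V where
  funMap := fun f _ => nomatch f
  RelMap := fun r v => match r, v with
    | SetRel.mem, v => v 0 ∈ v 1

/-- `(V, ∈)` is a model of Zermelo–Fraenkel set theory (without choice). The two schemes range over
the classes and class relations that are first-order definable over `(V, ∈)` with parameters. -/
structure IsModelOfZF (V : Type u) [Membership V V] : Prop where
  extensionality : ∀ x y : V, (∀ z : V, z ∈ x ↔ z ∈ y) → x = y
  foundation : ∀ x : V, (∃ y : V, y ∈ x) → ∃ y : V, y ∈ x ∧ ∀ z : V, z ∈ y → ¬ z ∈ x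
  pairing : ∀ x y : V, ∃ p : V, ∀ z : V, z ∈ p ↔ z = x ∨ z = y
  union : ∀ x : V, ∃ w : V, ∀ z : V, z ∈ w ↔ ∃ y : V, y ∈ x ∧ z ∈ y
  powerset : ∀ x : V, ∃ p : V, ∀ z : V, z ∈ p ↔ ∀ w : V, w ∈ z → w ∈ x
  infinity : ∃ w : V, (∃ e : V, e ∈ w ∧ ∀ z : V, ¬ z ∈ e) ∧
    ∀ n : V, n ∈ w → ∃ m : V, m ∈ w ∧ ∀ z : V, z ∈ m ↔ z ∈ n ∨ z = n
  separation : ∀ P : V → Prop, (Set.univ : Set V).Definable₁ setLanguage {x | P x} →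
    ∀ a : V, ∃ b : V, ∀ x : V, x ∈ b ↔ x ∈ a ∧ P x
  replacement : ∀ R : V → V → Prop,
    (Set.univ : Set V).Definable₂ setLanguage {p : V × V | R p.1 p.2} →
    ∀ a : V, (∀ x : V, x ∈ a → ∀ y z : V, R x y → R x z → y = z) →
      ∃ b : V, ∀ y : V, y ∈ b ↔ ∃ x : V, x ∈ a ∧ R x y

variable {V : Type u} [Membership V V]

/-! ### Basic set-theoretic notions inside `V` -/

/-- `e = ∅`. -/
def IsEmptySet (e : V) : Prop := ∀ z : V, ¬ z ∈ e

/-- `m = n ∪ {n}`. -/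
def IsSucc (m n : V) : Prop := ∀ z : V, z ∈ m ↔ z ∈ n ∨ z = n

/-- `w` contains `∅` and is closed under `n ↦ n ∪ {n}`. -/
def IsInductiveSet (w : V) : Prop :=
  (∀ e : V, IsEmptySet e → e ∈ w) ∧ ∀ n m : V, n ∈ w → IsSucc m n → m ∈ w

/-- `n ∈ ω`: `n` lies in every inductive set. As usual `n = {0, …, n - 1}`. -/
def IsNat (n : V) : Prop := ∀ w : V, IsInductiveSet w → n ∈ w

/-- `x` is the numeral `k` of `V`. -/
def IsNumeral : ℕ → V → Prop
  | 0, x => IsEmptySet x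
  | k + 1, x => ∃ y : V, IsNumeral k y ∧ IsSucc x y

/-- `p = {x, y}`. -/
def IsUPair (p x y : V) : Prop := ∀ z : V, z ∈ p ↔ z = x ∨ z = y

/-- `p = (x, y) = {{x}, {x, y}}`. -/
def IsPair (p x y : V) : Prop := ∀ z : V, z ∈ p ↔ IsUPair z x x ∨ IsUPair z x y

/-- `(x, y) ∈ f`; when `f` is a function this says `f(x) = y`. -/
def App (f x y : V) : Prop := ∃ p : V, p ∈ f ∧ IsPair p x y

/-- `f` is a function with domain `A`. -/
def IsFun (f A : V) : Prop :=
  (∀ p : V, p ∈ f → ∃ x y : V, x ∈ A ∧ IsPair p x y) ∧ ∀ x : V, x ∈ A → ∃! y : V, App f x y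

/-- `f` is a function from `A` to `B`. -/
def IsMap (f A B : V) : Prop := IsFun f A ∧ ∀ x y : V, App f x y → y ∈ B

/-! ### Ultrafilters and the choice principle -/

/-- `{i ∈ I | Q i} ∈ U`. -/
def Large (U I : V) (Q : V → Prop) : Prop :=
  ∃ X : V, X ∈ U ∧ ∀ i : V, i ∈ X ↔ i ∈ I ∧ Q i

/-- `U` is an ultrafilter over `I` (filters are proper). -/
structure IsUltrafilter (U I : V) : Prop where
  subset : ∀ X : V, X ∈ U → ∀ i : V, i ∈ X → i ∈ I
  univ_mem : I ∈ U
  empty_notMem : ∀ e : V, IsEmptySet e → ¬ e ∈ U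
  superset : ∀ X Y : V, X ∈ U → (∀ i : V, i ∈ X → i ∈ Y) → (∀ i : V, i ∈ Y → i ∈ I) → Y ∈ U
  inter : ∀ X Y Z : V, X ∈ U → Y ∈ U → (∀ i : V, i ∈ Z ↔ i ∈ X ∧ i ∈ Y) → Z ∈ U
  ultra : ∀ X Y : V, (∀ i : V, i ∈ X → i ∈ I) → (∀ i : V, i ∈ Y ↔ i ∈ I ∧ ¬ i ∈ X) →
    X ∈ U ∨ Y ∈ U

/-- `U`-`AC_I`: for every family `(A_i)_{i ∈ I}` of nonempty sets there is a function `f` on `I`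
with `{i ∈ I | f(i) ∈ A_i} ∈ U`. -/
def UltrafilterAC (U I : V) : Prop :=
  ∀ A : V, IsFun A I → (∀ i a : V, App A i a → ∃ x : V, x ∈ a) →
    ∃ f : V, IsFun f I ∧ Large U I (fun i => ∃ a x : V, App A i a ∧ App f i x ∧ x ∈ a)

/-! ### First-order languages and structures inside `V` -/

/-- The data of a first-order language in `V`: the sets of function symbols and of relation symbols
and the two arity functions. Constants are function symbols of arity `0`. -/
@[ext] structure Lang (V : Type u) where
  fn : V
  fnAr : V
  rel : V
  relAr : V

/-- `L` is a first-order language: the arities are natural numbers of `V`. -/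
def IsLang (L : Lang V) : Prop :=
  IsFun L.fnAr L.fn ∧ (∀ f n : V, App L.fnAr f n → IsNat n) ∧
  IsFun L.relAr L.rel ∧ (∀ R n : V, App L.relAr R n → IsNat n)

/-- The data of a structure in `V`: the domain, the set of all `((f, s), y)` such that the
function symbol `f` sends the tuple `s` to `y`, and the set of all `(R, s)` such that the relation
symbol `R` holds of the tuple `s`. An `n`-tuple is a function on `n = {0, …, n - 1}`. -/
@[ext] structure Str (V : Type u) where
  dom : V
  fn : V
  rel : V

/-- `f^M(s) = y`. -/
def FnVal (M : Str V) (f s y : V) : Prop := ∃ q : V, IsPair q f s ∧ App M.fn q y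

/-- `R^M(s)`. -/
def RelHolds (M : Str V) (R s : V) : Prop := App M.rel R s

/-- `M` is a structure (with nonempty domain) for the language `L`. -/
structure IsStr (L : Lang V) (M : Str V) : Prop where
  nonempty : ∃ x : V, x ∈ M.dom
  fn_subset : ∀ p : V, p ∈ M.fn → ∃ f n s q y : V, App L.fnAr f n ∧ IsMap s n M.dom ∧
    y ∈ M.dom ∧ IsPair q f s ∧ IsPair p q y
  fn_total : ∀ f n s : V, App L.fnAr f n → IsMap s n M.dom → ∃! y : V, FnVal M f s y
  rel_subset : ∀ p : V, p ∈ M.rel → ∃ R n s : V, App L.relAr R n ∧ IsMap s n M.dom ∧ IsPair p R s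

/-- For functions `s`, `s'` on `n` this says `s' = j ∘ s`. -/
def IsImageSeq (j n s s' : V) : Prop :=
  ∀ k x y : V, k ∈ n → App s k x → App s' k y → App j x y

/-- `h` is an isomorphism from `M` onto `N`. -/
structure IsIso (L : Lang V) (M N : Str V) (h : V) : Prop where
  map : IsMap h M.dom N.dom
  bijective : ∀ y : V, y ∈ N.dom → ∃! x : V, App h x y
  fn : ∀ f n s s' x y : V, App L.fnAr f n → IsMap s n M.dom → IsMap s' n N.dom →
    IsImageSeq h n s s' → FnVal M f s x → FnVal N f s' y → App h x y
  rel : ∀ R n s s' : V, App L.relAr R n → IsMap s n M.dom → IsMap s' n N.dom →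
    IsImageSeq h n s s' → (RelHolds M R s ↔ RelHolds N R s')

/-- `M ≅ N`. -/
def Isomorphic (L : Lang V) (M N : Str V) : Prop := ∃ h : V, IsIso L M N h

/-! ### Terms and formulas inside `V`

Terms and formulas are sets of `V`, namely pairs of a numeral (the kind of the term or formula) and
its immediate constituents. They are considered in a context `n ∈ ω`: the free variables are
among `v_0, …, v_{n-1}`, and a quantifier in context `n` binds the variable `v_n`, so its scope
is in context `n + 1`. Sentences are the formulas in context `0`. -/

/-- `c = (k, x)` with the numeral `k`. -/
def IsTagged (k : ℕ) (c x : V) : Prop := ∃ t : V, IsNumeral k t ∧ IsPair c t x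

/-- `c = (k, (x, y))` with the numeral `k`. -/
def IsTagged₂ (k : ℕ) (c x y : V) : Prop := ∃ q : V, IsPair q x y ∧ IsTagged k c q

/-- `t` is the variable `v_k`. -/
def IsVar (t k : V) : Prop := IsTagged 0 t k

/-- `t` is the term `f(ts)`. -/
def IsFnTerm (t f ts : V) : Prop := IsTagged₂ 1 t f ts

/-- `X` contains the variables `v_k` with `k < n` and is closed under the function symbols. -/
def TermClosed (L : Lang V) (n X : V) : Prop :=
  (∀ k t : V, k ∈ n → IsVar t k → t ∈ X) ∧
  ∀ f m ts t : V, App L.fnAr f m → IsMap ts m X → IsFnTerm t f ts → t ∈ X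

/-- `t` is a term in context `n`. -/
def IsTerm (L : Lang V) (n t : V) : Prop := ∀ X : V, TermClosed L n X → t ∈ X

/-- `ts` is an `m`-tuple of terms in context `n`. -/
def IsTermSeq (L : Lang V) (n m ts : V) : Prop :=
  IsFun ts m ∧ ∀ k t : V, App ts k t → IsTerm L n t

/-- `φ` is `t = r`. -/
def IsEq (φ t r : V) : Prop := IsTagged₂ 0 φ t r

/-- `φ` is `R(ts)`. -/
def IsRel (φ R ts : V) : Prop := IsTagged₂ 1 φ R ts

/-- `χ` is `¬ φ`. -/
def IsNot (χ φ : V) : Prop := IsTagged 2 χ φ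

/-- `χ` is `φ ∧ ψ`. -/
def IsAnd (χ φ ψ : V) : Prop := IsTagged₂ 3 χ φ ψ

/-- `χ` is `∃ v_n φ` (in context `n`). -/
def IsEx (χ φ : V) : Prop := IsTagged 4 χ φ

/-- `χ` is `∀ v_n φ` (in context `n`). -/
def IsAll (χ φ : V) : Prop := IsTagged 5 χ φ

/-- `φ` is an atomic formula in context `n`. -/
def IsAtomic (L : Lang V) (n φ : V) : Prop :=
  (∃ t r : V, IsTerm L n t ∧ IsTerm L n r ∧ IsEq φ t r) ∨
  ∃ R m ts : V, App L.relAr R m ∧ IsTermSeq L n m ts ∧ IsRel φ R ts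

/-- The set `Z` of pairs (context, formula) contains the atomic formulas and is closed under
connectives and quantifiers. -/
structure FormulaClosed (L : Lang V) (Z : V) : Prop where
  atomic : ∀ n φ : V, IsNat n → IsAtomic L n φ → App Z n φ
  not : ∀ n φ χ : V, IsNat n → App Z n φ → IsNot χ φ → App Z n χ
  and : ∀ n φ ψ χ : V, IsNat n → App Z n φ → App Z n ψ → IsAnd χ φ ψ → App Z n χ
  ex : ∀ n m φ χ : V, IsNat n → IsSucc m n → App Z m φ → IsEx χ φ → App Z n χ
  all : ∀ n m φ χ : V, IsNat n → IsSucc m n → App Z m φ → IsAll χ φ → App Z n χ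

/-- `φ` is a formula in context `n`. -/
def IsFormula (L : Lang V) (n φ : V) : Prop := ∀ Z : V, FormulaClosed L Z → App Z n φ

/-- `X` contains the atomic formulas in context `n` and is closed under connectives. -/
structure QFClosed (L : Lang V) (n X : V) : Prop where
  atomic : ∀ φ : V, IsAtomic L n φ → φ ∈ X
  not : ∀ φ χ : V, φ ∈ X → IsNot χ φ → χ ∈ X
  and : ∀ φ ψ χ : V, φ ∈ X → ψ ∈ X → IsAnd χ φ ψ → χ ∈ X

/-- `φ` is a quantifier-free formula in context `n`. -/
def IsQF (L : Lang V) (n φ : V) : Prop := ∀ X : V, QFClosed L n X → φ ∈ X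

/-- `φ` (in context `n`) arises from a formula in the class `Q` of pairs (context, formula) by
prefixing a block of finitely many, possibly no, quantifiers. The quantifier is given by `quant`,
which will be `IsEx` or `IsAll`. -/
def QuantBlock (quant : V → V → Prop) (Q : V → V → Prop) (n φ : V) : Prop :=
  ∀ Z : V, (∀ k ψ : V, IsNat k → Q k ψ → App Z k ψ) →
    (∀ k m ψ χ : V, IsNat k → IsSucc m k → App Z m ψ → quant χ ψ → App Z k χ) → App Z n φ

/-- `φ` is a `Σ_k` formula (for `true`), respectively a `Π_k` formula (for `false`), in
context `n`: `Σ_0 = Π_0` are the quantifier-free formulas, the `Σ_{k+1}` formulas are the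
`∃ x̄ ψ` with `ψ` in `Π_k`, and the `Π_{k+1}` formulas are the `∀ x̄ ψ` with `ψ` in `Σ_k`. -/
def InHierarchy (L : Lang V) : ℕ → Bool → V → V → Prop
  | 0, _ => IsQF L
  | k + 1, true => QuantBlock IsEx (InHierarchy L k false)
  | k + 1, false => QuantBlock IsAll (InHierarchy L k true)

/-- `φ` is a `Σ_k` formula in context `n`. -/
def IsSigma (L : Lang V) (k : ℕ) (n φ : V) : Prop := InHierarchy L k true n φ

/-! ### Satisfaction inside `V` -/

/-- `e` evaluates the terms in context `n` in the structure `M` under the assignment `s : n → M`. -/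
structure IsTermEval (L : Lang V) (M : Str V) (n s e : V) : Prop where
  total : ∀ t : V, IsTerm L n t → ∃! d : V, App e t d
  var : ∀ k t d : V, k ∈ n → IsVar t k → App s k d → App e t d
  fn : ∀ f m ts t ds d : V, App L.fnAr f m → IsTermSeq L n m ts → IsFnTerm t f ts →
    IsMap ds m M.dom → IsImageSeq e m ts ds → FnVal M f ds d → App e t d

/-- `t^M[s] = d`. -/
def TermVal (L : Lang V) (M : Str V) (n s t d : V) : Prop :=
  ∃ e : V, IsTermEval L M n s e ∧ App e t d

/-- `s' = s ∪ {(n, d)}`, the extension of the assignment `s` on `n` by the value `d` for `v_n`. -/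
def IsExtend (s' s n d : V) : Prop := ∀ p : V, p ∈ s' ↔ p ∈ s ∨ IsPair p n d

/-- `T` is a satisfaction relation for the structure `M`: a set containing `(φ, s)` according to
Tarski's clauses, for all formulas `φ` in a context `n` and all assignments `s : n → M`. -/
structure IsSatRelation (L : Lang V) (M : Str V) (T : V) : Prop where
  eq : ∀ n s φ t r : V, IsNat n → IsMap s n M.dom → IsTerm L n t → IsTerm L n r → IsEq φ t r →
    (App T φ s ↔ ∃ d : V, TermVal L M n s t d ∧ TermVal L M n s r d)
  rel : ∀ n s φ R m ts : V, IsNat n → IsMap s n M.dom → App L.relAr R m → IsTermSeq L n m ts →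
    IsRel φ R ts →
    (App T φ s ↔ ∃ ds : V, IsMap ds m M.dom ∧
      (∀ k t d : V, k ∈ m → App ts k t → App ds k d → TermVal L M n s t d) ∧ RelHolds M R ds)
  not : ∀ n s φ χ : V, IsNat n → IsMap s n M.dom → IsFormula L n φ → IsNot χ φ →
    (App T χ s ↔ ¬ App T φ s)
  and : ∀ n s φ ψ χ : V, IsNat n → IsMap s n M.dom → IsFormula L n φ → IsFormula L n ψ →
    IsAnd χ φ ψ → (App T χ s ↔ App T φ s ∧ App T ψ s)
  ex : ∀ n s m φ χ : V, IsNat n → IsMap s n M.dom → IsSucc m n → IsFormula L m φ → IsEx χ φ →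
    (App T χ s ↔ ∃ d s' : V, d ∈ M.dom ∧ IsExtend s' s n d ∧ App T φ s')
  all : ∀ n s m φ χ : V, IsNat n → IsMap s n M.dom → IsSucc m n → IsFormula L m φ → IsAll χ φ →
    (App T χ s ↔ ∀ d s' : V, d ∈ M.dom → IsExtend s' s n d → App T φ s')

/-- `M ⊨ φ[s]`. -/
def Sat (L : Lang V) (M : Str V) (φ s : V) : Prop := ∃ T : V, IsSatRelation L M T ∧ App T φ s

/-- `M ⊨ σ` for a sentence `σ`: it is satisfied under the empty assignment. -/
def Models (L : Lang V) (M : Str V) (σ : V) : Prop := ∃ s : V, IsEmptySet s ∧ Sat L M σ s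

/-- `M` and `N` are `Σ_k`-elementarily equivalent: they satisfy the same `Σ_k` sentences. -/
def SigmaEquiv (L : Lang V) (k : ℕ) (M N : Str V) : Prop :=
  ∀ z σ : V, IsEmptySet z → IsSigma L k z σ → (Models L M σ ↔ Models L N σ)

/-- `j` is an elementary embedding from `M` to `N`. -/
def IsElementaryEmbedding (L : Lang V) (M N : Str V) (j : V) : Prop :=
  IsMap j M.dom N.dom ∧
  ∀ n φ s s' : V, IsNat n → IsFormula L n φ → IsMap s n M.dom → IsMap s' n N.dom →
    IsImageSeq j n s s' → (Sat L M φ s ↔ Sat L N φ s')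

/-! ### Ultraproducts inside `V` -/

/-- The data of a family of structures indexed by `I`, in `V`: three functions on `I`. -/
@[ext] structure Fam (V : Type u) where
  dom : V
  fn : V
  rel : V

/-- `M` is the member of the family with index `i`. -/
def Fam.At (F : Fam V) (i : V) (M : Str V) : Prop :=
  App F.dom i M.dom ∧ App F.fn i M.fn ∧ App F.rel i M.rel

/-- `F` is a family `(M_i)_{i ∈ I}` of structures for the language `L`. -/
structure IsFam (L : Lang V) (I : V) (F : Fam V) : Prop where
  dom : IsFun F.dom I
  fn : IsFun F.fn I
  rel : IsFun F.rel I
  isStr : ∀ (i : V) (M : Str V), F.At i M → IsStr L M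

/-- `g ∈ ∏_{i ∈ I} M_i`. -/
def InProd (I : V) (F : Fam V) (g : V) : Prop :=
  IsFun g I ∧ ∀ i x D : V, App g i x → App F.dom i D → x ∈ D

/-- `c = [g]`, the class of `g ∈ ∏_{i ∈ I} M_i` modulo `U`. -/
def IsClassOf (I U : V) (F : Fam V) (c g : V) : Prop :=
  ∀ h : V, h ∈ c ↔ InProd I F h ∧ Large U I (fun i => ∃ x : V, App g i x ∧ App h i x)

/-- `cs = ([g_k])_{k < n}` for the `n`-tuple `gs = (g_k)_{k < n}` of elements of the product. -/
def IsClassSeq (I U : V) (F : Fam V) (n cs gs : V) : Prop :=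
  IsFun gs n ∧ IsFun cs n ∧ (∀ k g : V, App gs k g → InProd I F g) ∧
  ∀ k g c : V, App gs k g → App cs k c → IsClassOf I U F c g

/-- `t = (g_k(i))_{k < n}` for the `n`-tuple `gs = (g_k)_{k < n}` of functions. -/
def IsEvalAt (n gs i t : V) : Prop :=
  IsFun t n ∧ ∀ k g x : V, App gs k g → App t k x → App g i x

/-- `P` is the ultraproduct `∏_{i ∈ I} M_i / U`. Its domain consists of the classes `[g]`, it has
`f([g_0], …, [g_{n-1}]) = [i ↦ f^{M_i}(g_0(i), …, g_{n-1}(i))]`, and `R([g_0], …, [g_{n-1}])` holds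
if and only if `{i ∈ I | R^{M_i}(g_0(i), …, g_{n-1}(i))} ∈ U`. (So there is only one such `P`.) -/
structure IsUltraproduct (L : Lang V) (I U : V) (F : Fam V) (P : Str V) : Prop where
  isStr : IsStr L P
  dom : ∀ c : V, c ∈ P.dom ↔ ∃ g : V, InProd I F g ∧ IsClassOf I U F c g
  fn : ∀ f n gs cs y c : V, App L.fnAr f n → IsClassSeq I U F n cs gs → InProd I F y →
    (∀ i : V, i ∈ I → ∃ (M : Str V) (t d : V),
      F.At i M ∧ IsEvalAt n gs i t ∧ App y i d ∧ FnVal M f t d) →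
    IsClassOf I U F c y → FnVal P f cs c
  rel : ∀ R n gs cs : V, App L.relAr R n → IsClassSeq I U F n cs gs →
    (RelHolds P R cs ↔ Large U I (fun i => ∃ (M : Str V) (t : V),
      F.At i M ∧ IsEvalAt n gs i t ∧ RelHolds M R t))

/-- `P` is the ultrapower `^I M / U`, the ultraproduct of the constant family. -/
def IsUltrapower (L : Lang V) (I U : V) (M P : Str V) : Prop :=
  ∃ F : Fam V, IsFam L I F ∧ (∀ i : V, i ∈ I → F.At i M) ∧ IsUltraproduct L I U F P

/-! ### The five variants of Łoś's theorem

The ultraproduct in question exists and is unique as soon as the product is nonempty;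
"the ultraproduct has a property" is expressed as "there is an ultraproduct with the property". -/

/-- Every ultrapower by `U` is `Σ₂`-elementarily equivalent to the original structure. -/
def UltrapowerSigmaTwo (U I : V) : Prop :=
  ∀ (L : Lang V) (M : Str V), IsLang L → IsStr L M →
    ∃ P : Str V, IsUltrapower L I U M P ∧ SigmaEquiv L 2 P M

/-- The ultraproduct of pairwise isomorphic structures with nonempty product is `Σ₁`-elementarily
equivalent to each of them. -/
def UltraproductSigmaOneFactor (U I : V) : Prop :=
  ∀ (L : Lang V) (F : Fam V), IsLang L → IsFam L I F →
    (∀ (i j : V) (M N : Str V), F.At i M → F.At j N → Isomorphic L M N) →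
    (∃ g : V, InProd I F g) →
    ∃ P : Str V, IsUltraproduct L I U F P ∧
      ∀ (i : V) (M : Str V), i ∈ I → F.At i M → SigmaEquiv L 1 P M

/-- Structures elementarily embeddable into each other have `Σ₂`-elementarily equivalent
ultrapowers. -/
def MutualEmbeddingSigmaTwo (U I : V) : Prop :=
  ∀ (L : Lang V) (M N : Str V), IsLang L → IsStr L M → IsStr L N →
    (∃ j : V, IsElementaryEmbedding L M N j) → (∃ j : V, IsElementaryEmbedding L N M j) →
    ∃ P Q : Str V, IsUltrapower L I U M P ∧ IsUltrapower L I U N Q ∧ SigmaEquiv L 2 P Q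

/-- Families of factorwise isomorphic structures with nonempty products have `Σ₁`-elementarily
equivalent ultraproducts. -/
def IsomorphicFactorsSigmaOne (U I : V) : Prop :=
  ∀ (L : Lang V) (F G : Fam V), IsLang L → IsFam L I F → IsFam L I G →
    (∀ (i : V) (M N : Str V), i ∈ I → F.At i M → G.At i N → Isomorphic L M N) →
    (∃ g : V, InProd I F g) → (∃ g : V, InProd I G g) →
    ∃ P Q : Str V, IsUltraproduct L I U F P ∧ IsUltraproduct L I U G Q ∧ SigmaEquiv L 1 P Q

/-- Families of factorwise isomorphic structures with nonempty products have isomorphic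
ultraproducts. -/
def IsomorphicFactorsIsomorphic (U I : V) : Prop :=
  ∀ (L : Lang V) (F G : Fam V), IsLang L → IsFam L I F → IsFam L I G →
    (∀ (i : V) (M N : Str V), i ∈ I → F.At i M → G.At i N → Isomorphic L M N) →
    (∃ g : V, InProd I F g) → (∃ g : V, InProd I G g) →
    ∃ P Q : Str V, IsUltraproduct L I U F P ∧ IsUltraproduct L I U G Q ∧ Isomorphic L P Q

end InternalZF

/-! Under the choice principle 1 the usual proof of Łoś's theorem survives: choice is needed only to
pick witnesses for a quantifier in the factors, and witnesses on a set in `U` suffice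
(`UltrafilterAC.exists_witness`, `UltrafilterAC.los`). This gives 2 and 3. For 6, the principle
picks an isomorphism for `U`-many indices, and these isomorphisms are applied pointwise.
Isomorphisms and elementary embeddings preserve truth, so 6 gives 5 and 2 gives 4.

The converses code a family of nonempty sets `A_i` into structures that are alike, but not uniformly
in `i`.

For 3 and 5, let `Z` be the union of the `A_i` and let `X_i` consist of the sequences in `Z^ω` with
first entry in `A_i` and of one extra point `*`, without further structure. Each `a ∈ A_i` yields an
explicit bijection from `Z^ω ∪ {*}` onto `X_i` in the manner of Hilbert's hotel
(`exists_bijection_pointedSeq`), while the constant family `*` makes the product nonempty. The `Σ₁`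
sentence "there are two elements" then holds in the ultraproduct of the `X_i`. If `[g] ≠ [k]`, then
for `U`-many `i` one of `g(i)`, `k(i)` is not `*`, and its first entry lies in `A_i`.

For 4, consider equivalence relations with infinitely many classes, all infinite, in the form
"equivalent and distinct". A back-and-forth argument (`Similar.sat_iff`) makes every injection
between them that preserves and reflects equivalence elementary. The full structure has the blocks
`(n, i)` for `n ∈ ω`, `i ∈ I`, each a copy of `(Z × ω) ∪ {*}`; in the restricted one, block `(0, i)`
is cut down to `(A_i × ω) ∪ {*}`. The inclusion and the shift `n ↦ n + 1` embed each into the other.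
The `Σ₂` sentence "some element is related to nothing" fails in the ultrapower of the full
structure, since a partner can be defined uniformly. So it fails in the other ultrapower, and a
partner of the class of `i ↦ *` in block `(0, i)` chooses from the `A_i`.

All of this takes place in a model `V` of ZF whose `ω` may be nonstandard. Hence every induction,
separation or replacement concerns classes definable over `V` with parameters; definability is
derived by instance search (`Dfn`, `DFun`), and syntax and truth are obtained by recursion inside
`V` (`exists_recursion`). -/

namespace InternalZF

/-! ### Definability with parameters -/

section Definability

set_option synthInstance.maxHeartbeats 400000
set_option synthInstance.maxSize 5000

variable {V : Type u} [Membership V V]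

/-- Drop the first entry of a sequence. -/
def tail (v : ℕ → V) : ℕ → V := fun n => v (n + 1)

/-- `P` is first-order definable over `(V, ∈)` with parameters. -/
class Dfn (P : (ℕ → V) → Prop) : Prop where
  out : (Set.univ : Set V).Definable setLanguage {v | P v}

/-- The graph of `a` is first-order definable over `(V, ∈)` with parameters. -/
class DFun (a : (ℕ → V) → V) : Prop where
  out : Dfn fun v => v 0 = a (tail v)

/-- `f` drops finitely many entries. -/
class DTail (f : (ℕ → V) → ℕ → V) : Prop where
  out : ∃ k, ∀ v n, f v n = v (n + k)

instance DTail.id : DTail fun v : ℕ → V => v := ⟨0, fun _ _ => rfl⟩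

instance DTail.tail (f : (ℕ → V) → ℕ → V) [h : DTail f] : DTail fun v => tail (f v) := by
  obtain ⟨k, hk⟩ := h.out
  exact ⟨k + 1, fun v n => by simp only [InternalZF.tail, hk]; congr 1; omega⟩

instance DTail.tail_self : DTail (InternalZF.tail : (ℕ → V) → ℕ → V) := ⟨1, fun _ _ => rfl⟩

theorem Dfn.congr {P Q : (ℕ → V) → Prop} (h : Dfn P) (e : ∀ v, Q v ↔ P v) : Dfn Q := by
  have : Q = P := funext fun v => propext (e v)
  exact this ▸ h

/-- Renaming of variables; mostly used to insert dummy variables under further binders. -/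
theorem Dfn.reindex {P : (ℕ → V) → Prop} (h : Dfn P) (f : ℕ → ℕ) :
    Dfn fun v => P fun n => v (f n) :=
  ⟨h.out.preimage_comp f⟩

instance Dfn.and (P Q : (ℕ → V) → Prop) [hP : Dfn P] [hQ : Dfn Q] : Dfn fun v => P v ∧ Q v :=
  ⟨hP.out.inter hQ.out⟩

instance Dfn.or (P Q : (ℕ → V) → Prop) [hP : Dfn P] [hQ : Dfn Q] : Dfn fun v => P v ∨ Q v :=
  ⟨hP.out.union hQ.out⟩

instance Dfn.not (P : (ℕ → V) → Prop) [hP : Dfn P] : Dfn fun v => ¬ P v :=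
  ⟨hP.out.compl⟩

instance Dfn.imp (P Q : (ℕ → V) → Prop) [hP : Dfn P] [hQ : Dfn Q] : Dfn fun v => P v → Q v :=
  (inferInstance : Dfn fun v => ¬ P v ∨ Q v).congr fun _ => imp_iff_not_or

instance Dfn.iff (P Q : (ℕ → V) → Prop) [hP : Dfn P] [hQ : Dfn Q] : Dfn fun v => P v ↔ Q v :=
  (inferInstance : Dfn fun v => (P v → Q v) ∧ (Q v → P v)).congr fun _ => iff_iff_implies_and_implies

/-- A proposition without variables is true or false in the metatheory, and so defines everything or
nothing. -/
instance Dfn.const (p : Prop) : Dfn fun _ : ℕ → V => p := by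
  by_cases h : p
  · exact ⟨by simp [h]⟩
  · exact ⟨by simp [h]⟩

/-- Variables are de Bruijn indices: under a quantifier the bound variable is entry `0` and the old
entries move up by one, so they are read off from the tail. -/
instance Dfn.exists (P : (ℕ → V) → V → Prop) [h : Dfn fun v => P (InternalZF.tail v) (v 0)] :
    Dfn fun v => ∃ x, P v x := by
  -- Index `0` becomes a separate variable, which is then projected away.
  let e : ℕ → ℕ ⊕ Unit := fun n => Nat.casesOn n (Sum.inr ()) Sum.inl
  have h1 := (h.out.preimage_comp e).exists_of_finite
  refine ⟨?_⟩
  convert h1 using 1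
  ext v
  constructor
  · rintro ⟨x, hx⟩
    exact ⟨fun _ => x, hx⟩
  · rintro ⟨x, hx⟩
    exact ⟨x (), hx⟩

instance Dfn.forall (P : (ℕ → V) → V → Prop) [h : Dfn fun v => P (InternalZF.tail v) (v 0)] :
    Dfn fun v => ∀ x, P v x :=
  (inferInstance : Dfn fun v => ¬ ∃ x, ¬ P v x).congr fun _ => by simp

theorem Dfn.eq_var (i j : ℕ) : Dfn fun v : ℕ → V => v i = v j := by
  refine ⟨⟨(FirstOrder.Language.Term.var i).equal (FirstOrder.Language.Term.var j), ?_⟩⟩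
  ext v; simp

theorem Dfn.mem_var (i j : ℕ) : Dfn fun v : ℕ → V => v i ∈ v j := by
  let r : (setLanguage.withConstants (Set.univ : Set V)).Relations 2 := Sum.inl SetRel.mem
  refine ⟨⟨r.formula₂ (FirstOrder.Language.Term.var i) (FirstOrder.Language.Term.var j), ?_⟩⟩
  ext v
  rw [Set.mem_ofPred_eq, Set.mem_ofPred_eq, FirstOrder.Language.Formula.realize_rel₂]
  exact Iff.rfl

theorem Dfn.eq_const (i : ℕ) (c : V) : Dfn fun v : ℕ → V => v i = c := by
  refine ⟨⟨(FirstOrder.Language.Term.var i).equal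
    (setLanguage.con (⟨c, trivial⟩ : (Set.univ : Set V))).term, ?_⟩⟩
  ext v; simp

instance DFun.const (c : V) : DFun fun _ : ℕ → V => c := ⟨Dfn.eq_const 0 c⟩

instance DFun.var (f : (ℕ → V) → ℕ → V) (n : ℕ) [h : DTail f] : DFun fun v => f v n := by
  obtain ⟨k, hk⟩ := h.out
  exact ⟨(Dfn.eq_var 0 (n + k + 1)).congr fun v => by rw [hk]; rfl⟩

/-- Substitution is expressed by `∃ x, x = a v ∧ Q x v`, so definability of the graph of `a` is all
that is needed. -/
theorem Dfn.subst {Q : V → (ℕ → V) → Prop} (h : Dfn fun v => Q (v 0) (InternalZF.tail v))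
    {a : (ℕ → V) → V} (ha : DFun a) : Dfn fun v => Q (a v) v := by
  have := ha.out
  refine (inferInstance : Dfn fun v => ∃ x, x = a v ∧ Q x v).congr fun v => ?_
  simp

theorem DFun.reindex {a : (ℕ → V) → V} (h : DFun a) (f : ℕ → ℕ) :
    DFun fun v => a fun n => v (f n) := by
  refine ⟨(h.out.reindex fun | 0 => 0 | n + 1 => f n + 1).congr fun v => ?_⟩
  rfl

theorem DFun.tail {a : (ℕ → V) → V} (h : DFun a) : DFun fun v => a (InternalZF.tail v) :=
  h.reindex fun n => n + 1

theorem Dfn.comp1 {P : V → Prop} (h : Dfn fun v : ℕ → V => P (v 0))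
    {a : (ℕ → V) → V} (ha : DFun a) : Dfn fun v => P (a v) :=
  Dfn.subst (Q := fun x _ => P x) h ha

theorem Dfn.comp2 {P : V → V → Prop} (h : Dfn fun v : ℕ → V => P (v 0) (v 1))
    {a b : (ℕ → V) → V} (ha : DFun a) (hb : DFun b) : Dfn fun v => P (a v) (b v) :=
  Dfn.subst (Q := fun x v => P (a v) x)
    (Dfn.subst (Q := fun x v => P x (v 0)) h ha.tail) hb

/-- Makes an argument available under any number of binders. The definability proofs below first put
this into the context for each argument, then unfold the notion and leave the rest to instance
search. -/
theorem DFun.shift {a : (ℕ → V) → V} (h : DFun a) (f : (ℕ → V) → ℕ → V) [hf : DTail f] :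
    DFun fun v => a (f v) := by
  obtain ⟨k, hk⟩ := hf.out
  have : f = fun v n => v (n + k) := funext fun v => funext fun n => hk v n
  subst this
  exact h.reindex fun n => n + k

theorem DFun.comp1 {F : V → V} (h : DFun fun v : ℕ → V => F (v 0))
    {a : (ℕ → V) → V} (ha : DFun a) : DFun fun v => F (a v) :=
  ⟨Dfn.comp2 (P := fun x y => x = F y) h.out (.var (fun v => v) 0) ha.tail⟩

theorem DFun.comp2 {F : V → V → V} (h : DFun fun v : ℕ → V => F (v 0) (v 1))
    {a b : (ℕ → V) → V} (ha : DFun a) (hb : DFun b) : DFun fun v => F (a v) (b v) :=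
  ⟨Dfn.subst (Q := fun x v => v 0 = F (a (InternalZF.tail v)) x)
    (Dfn.subst (Q := fun x v => v 1 = F x (v 0))
      ((h.out.reindex fun n => match n with | 0 => 2 | n + 1 => n)) ha.tail.tail) hb.tail⟩

instance Dfn.eq (a b : (ℕ → V) → V) [ha : DFun a] [hb : DFun b] : Dfn fun v => a v = b v :=
  Dfn.comp2 (Dfn.eq_var 0 1) ha hb

instance Dfn.mem (a b : (ℕ → V) → V) [ha : DFun a] [hb : DFun b] : Dfn fun v => a v ∈ b v :=
  Dfn.comp2 (P := fun x y => x ∈ y) (Dfn.mem_var 0 1) ha hb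

instance Dfn.existsUnique (P : (ℕ → V) → V → Prop)
    [h : Dfn fun v => P (InternalZF.tail v) (v 0)] : Dfn fun v => ∃! x, P v x := by
  have h2 : Dfn fun v => P (InternalZF.tail (InternalZF.tail v)) (v 0) :=
    h.reindex fun | 0 => 0 | n + 1 => n + 2
  exact (inferInstance : Dfn fun v => ∃ x, P v x ∧ ∀ y, P v y → y = x).congr fun _ => Iff.rfl

/-- `M` is a structure whose three components depend definably on the variables. -/
class DStr (M : (ℕ → V) → Str V) : Prop where
  dom : DFun fun v => (M v).dom
  fn : DFun fun v => (M v).fn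
  rel : DFun fun v => (M v).rel

instance DFun.dom (M : (ℕ → V) → Str V) [h : DStr M] : DFun fun v => (M v).dom := h.dom
instance DFun.fn (M : (ℕ → V) → Str V) [h : DStr M] : DFun fun v => (M v).fn := h.fn
instance DFun.rel (M : (ℕ → V) → Str V) [h : DStr M] : DFun fun v => (M v).rel := h.rel
instance DStr.const (M : Str V) : DStr fun _ : ℕ → V => M :=
  ⟨inferInstance, inferInstance, inferInstance⟩
instance DStr.tuple (a b c : (ℕ → V) → V) [ha : DFun a] [hb : DFun b] [hc : DFun c] :
    DStr fun v => ⟨a v, b v, c v⟩ := ⟨ha, hb, hc⟩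

theorem DStr.shift {M : (ℕ → V) → Str V} (h : DStr M) (f : (ℕ → V) → ℕ → V) [DTail f] :
    DStr fun v => M (f v) :=
  ⟨h.dom.shift f, h.fn.shift f, h.rel.shift f⟩

/-- A quantifier over structures amounts to three quantifiers over `V`, the innermost one being
entry `0`. -/
instance Dfn.existsStr (P : (ℕ → V) → Str V → Prop)
    [h : Dfn fun v => P (InternalZF.tail (InternalZF.tail (InternalZF.tail v))) ⟨InternalZF.tail (InternalZF.tail v) 0, InternalZF.tail v 0, v 0⟩] :
    Dfn fun v => ∃ M : Str V, P v M := by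
  refine (inferInstance : Dfn fun v => ∃ x y z, P v ⟨x, y, z⟩).congr fun v => ?_
  exact ⟨fun ⟨M, h⟩ => ⟨M.dom, M.fn, M.rel, h⟩, fun ⟨_, _, _, h⟩ => ⟨_, h⟩⟩

/-! Definability of the notions of the statement. -/

variable (a b c d e g k : (ℕ → V) → V) [ha : DFun a] [hb : DFun b] [hc : DFun c] [hd : DFun d]
  [he : DFun e] [hg : DFun g] [hk : DFun k] (M N : (ℕ → V) → Str V) [hM : DStr M] [hN : DStr N]
  (L : Lang V)

instance Dfn.isEmptySet : Dfn fun v => IsEmptySet (a v) := by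
  have := ha.shift
  unfold IsEmptySet; infer_instance

instance Dfn.isSucc : Dfn fun v => IsSucc (a v) (b v) := by
  have := ha.shift; have := hb.shift
  unfold IsSucc; infer_instance

instance Dfn.isInductiveSet : Dfn fun v => IsInductiveSet (a v) := by
  have := ha.shift
  unfold IsInductiveSet; infer_instance

instance Dfn.isNat : Dfn fun v => IsNat (a v) := by
  have := ha.shift
  unfold IsNat; infer_instance

instance Dfn.isNumeral (n : ℕ) : Dfn fun v => IsNumeral n (a v) := by
  revert a
  induction n with
  | zero => intro a ha; unfold IsNumeral; infer_instance
  | succ n ih => intro a ha; have := ha.shift; unfold IsNumeral; infer_instance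

instance Dfn.isUPair : Dfn fun v => IsUPair (a v) (b v) (c v) := by
  have := ha.shift; have := hb.shift; have := hc.shift
  unfold IsUPair; infer_instance

instance Dfn.isPair : Dfn fun v => IsPair (a v) (b v) (c v) := by
  have := ha.shift; have := hb.shift; have := hc.shift
  unfold IsPair; infer_instance

instance Dfn.app : Dfn fun v => App (a v) (b v) (c v) := by
  have := ha.shift; have := hb.shift; have := hc.shift
  unfold App; infer_instance

instance Dfn.isFun : Dfn fun v => IsFun (a v) (b v) := by
  have := ha.shift; have := hb.shift
  unfold IsFun; infer_instance

instance Dfn.isMap : Dfn fun v => IsMap (a v) (b v) (c v) := by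
  have := ha.shift; have := hb.shift; have := hc.shift
  unfold IsMap; infer_instance

instance Dfn.large (P : (ℕ → V) → V → Prop)
    [h : Dfn fun v => P (InternalZF.tail v) (v 0)] : Dfn fun v => Large (a v) (b v) (P v) := by
  have h2 : Dfn fun v => P (InternalZF.tail (InternalZF.tail v)) (v 0) :=
    h.reindex fun | 0 => 0 | n + 1 => n + 2
  have := ha.shift; have := hb.shift
  unfold Large; infer_instance

instance Dfn.fnVal : Dfn fun v => FnVal (M v) (a v) (b v) (c v) := by
  have := ha.shift; have := hb.shift; have := hc.shift; have := hM.shift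
  unfold FnVal; infer_instance

instance Dfn.relHolds : Dfn fun v => RelHolds (M v) (a v) (b v) := by
  have := ha.shift; have := hb.shift; have := hM.shift
  unfold RelHolds; infer_instance

instance Dfn.isImageSeq : Dfn fun v => IsImageSeq (a v) (b v) (c v) (d v) := by
  have := ha.shift; have := hb.shift; have := hc.shift; have := hd.shift
  unfold IsImageSeq; infer_instance

instance Dfn.isTagged (n : ℕ) : Dfn fun v => IsTagged n (a v) (b v) := by
  have := ha.shift; have := hb.shift
  unfold IsTagged; infer_instance

instance Dfn.isTagged₂ (n : ℕ) : Dfn fun v => IsTagged₂ n (a v) (b v) (c v) := by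
  have := ha.shift; have := hb.shift; have := hc.shift
  unfold IsTagged₂; infer_instance

instance Dfn.isVar : Dfn fun v => IsVar (a v) (b v) := by unfold IsVar; infer_instance
instance Dfn.isFnTerm : Dfn fun v => IsFnTerm (a v) (b v) (c v) := by
  unfold IsFnTerm; infer_instance
instance Dfn.isEq : Dfn fun v => IsEq (a v) (b v) (c v) := by unfold IsEq; infer_instance
instance Dfn.isRel : Dfn fun v => IsRel (a v) (b v) (c v) := by unfold IsRel; infer_instance
instance Dfn.isNot : Dfn fun v => IsNot (a v) (b v) := by unfold IsNot; infer_instance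
instance Dfn.isAnd : Dfn fun v => IsAnd (a v) (b v) (c v) := by unfold IsAnd; infer_instance
instance Dfn.isEx : Dfn fun v => IsEx (a v) (b v) := by unfold IsEx; infer_instance
instance Dfn.isAll : Dfn fun v => IsAll (a v) (b v) := by unfold IsAll; infer_instance

instance Dfn.termClosed : Dfn fun v => TermClosed L (a v) (b v) := by
  have := ha.shift; have := hb.shift
  unfold TermClosed; infer_instance

instance Dfn.isTerm : Dfn fun v => IsTerm L (a v) (b v) := by
  have := ha.shift; have := hb.shift
  unfold IsTerm; infer_instance

instance Dfn.isTermSeq : Dfn fun v => IsTermSeq L (a v) (b v) (c v) := by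
  have := ha.shift; have := hb.shift; have := hc.shift
  unfold IsTermSeq; infer_instance

instance Dfn.isAtomic : Dfn fun v => IsAtomic L (a v) (b v) := by
  have := ha.shift; have := hb.shift
  unfold IsAtomic; infer_instance

/-- The definability instances handle conjunctions and quantifiers; the structures are spelled out
in this form for them. -/
theorem formulaClosed_iff (Z : V) : FormulaClosed L Z ↔
    (∀ n φ : V, IsNat n → IsAtomic L n φ → App Z n φ) ∧
    (∀ n φ χ : V, IsNat n → App Z n φ → IsNot χ φ → App Z n χ) ∧
    (∀ n φ ψ χ : V, IsNat n → App Z n φ → App Z n ψ → IsAnd χ φ ψ → App Z n χ) ∧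
    (∀ n m φ χ : V, IsNat n → IsSucc m n → App Z m φ → IsEx χ φ → App Z n χ) ∧
    (∀ n m φ χ : V, IsNat n → IsSucc m n → App Z m φ → IsAll χ φ → App Z n χ) :=
  ⟨fun ⟨a, b, c, d, e⟩ => ⟨a, b, c, d, e⟩, fun ⟨a, b, c, d, e⟩ => ⟨a, b, c, d, e⟩⟩

instance Dfn.formulaClosed : Dfn fun v => FormulaClosed L (a v) := by
  have := ha.shift
  simp only [formulaClosed_iff]; infer_instance

instance Dfn.isFormula : Dfn fun v => IsFormula L (a v) (b v) := by
  have := ha.shift; have := hb.shift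
  unfold IsFormula; infer_instance

theorem isTermEval_iff (M : Str V) (n s e : V) : IsTermEval L M n s e ↔
    (∀ t : V, IsTerm L n t → ∃! d : V, App e t d) ∧
    (∀ k t d : V, k ∈ n → IsVar t k → App s k d → App e t d) ∧
    (∀ f m ts t ds d : V, App L.fnAr f m → IsTermSeq L n m ts → IsFnTerm t f ts →
      IsMap ds m M.dom → IsImageSeq e m ts ds → FnVal M f ds d → App e t d) :=
  ⟨fun ⟨a, b, c⟩ => ⟨a, b, c⟩, fun ⟨a, b, c⟩ => ⟨a, b, c⟩⟩

instance Dfn.isTermEval : Dfn fun v => IsTermEval L (M v) (a v) (b v) (c v) := by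
  have := ha.shift; have := hb.shift; have := hc.shift; have := hM.shift
  simp only [isTermEval_iff]; infer_instance

instance Dfn.termVal : Dfn fun v => TermVal L (M v) (a v) (b v) (c v) (d v) := by
  have := ha.shift; have := hb.shift; have := hc.shift; have := hd.shift; have := hM.shift
  unfold TermVal; infer_instance

instance Dfn.isExtend : Dfn fun v => IsExtend (a v) (b v) (c v) (d v) := by
  have := ha.shift; have := hb.shift; have := hc.shift; have := hd.shift
  unfold IsExtend; infer_instance

theorem isSatRelation_iff (M : Str V) (T : V) : IsSatRelation L M T ↔
    (∀ n s φ t r : V, IsNat n → IsMap s n M.dom → IsTerm L n t → IsTerm L n r → IsEq φ t r →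
      (App T φ s ↔ ∃ d : V, TermVal L M n s t d ∧ TermVal L M n s r d)) ∧
    (∀ n s φ R m ts : V, IsNat n → IsMap s n M.dom → App L.relAr R m → IsTermSeq L n m ts →
      IsRel φ R ts →
      (App T φ s ↔ ∃ ds : V, IsMap ds m M.dom ∧
        (∀ k t d : V, k ∈ m → App ts k t → App ds k d → TermVal L M n s t d) ∧
          RelHolds M R ds)) ∧
    (∀ n s φ χ : V, IsNat n → IsMap s n M.dom → IsFormula L n φ → IsNot χ φ →
      (App T χ s ↔ ¬ App T φ s)) ∧
    (∀ n s φ ψ χ : V, IsNat n → IsMap s n M.dom → IsFormula L n φ → IsFormula L n ψ →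
      IsAnd χ φ ψ → (App T χ s ↔ App T φ s ∧ App T ψ s)) ∧
    (∀ n s m φ χ : V, IsNat n → IsMap s n M.dom → IsSucc m n → IsFormula L m φ → IsEx χ φ →
      (App T χ s ↔ ∃ d s' : V, d ∈ M.dom ∧ IsExtend s' s n d ∧ App T φ s')) ∧
    (∀ n s m φ χ : V, IsNat n → IsMap s n M.dom → IsSucc m n → IsFormula L m φ → IsAll χ φ →
      (App T χ s ↔ ∀ d s' : V, d ∈ M.dom → IsExtend s' s n d → App T φ s')) :=
  ⟨fun ⟨a, b, c, d, e, f⟩ => ⟨a, b, c, d, e, f⟩, fun ⟨a, b, c, d, e, f⟩ => ⟨a, b, c, d, e, f⟩⟩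

instance Dfn.isSatRelation : Dfn fun v => IsSatRelation L (M v) (a v) := by
  have := ha.shift; have := hM.shift
  simp only [isSatRelation_iff]; infer_instance

instance Dfn.sat : Dfn fun v => Sat L (M v) (a v) (b v) := by
  have := ha.shift; have := hb.shift; have := hM.shift
  unfold Sat; infer_instance

theorem isIso_iff (M N : Str V) (h : V) : IsIso L M N h ↔
    IsMap h M.dom N.dom ∧ (∀ y : V, y ∈ N.dom → ∃! x : V, App h x y) ∧
    (∀ f n s s' x y : V, App L.fnAr f n → IsMap s n M.dom → IsMap s' n N.dom →
      IsImageSeq h n s s' → FnVal M f s x → FnVal N f s' y → App h x y) ∧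
    (∀ R n s s' : V, App L.relAr R n → IsMap s n M.dom → IsMap s' n N.dom →
      IsImageSeq h n s s' → (RelHolds M R s ↔ RelHolds N R s')) :=
  ⟨fun ⟨a, b, c, d⟩ => ⟨a, b, c, d⟩, fun ⟨a, b, c, d⟩ => ⟨a, b, c, d⟩⟩

instance Dfn.isIso : Dfn fun v => IsIso L (M v) (N v) (a v) := by
  have := ha.shift; have := hM.shift; have := hN.shift
  simp only [isIso_iff]; infer_instance

instance Dfn.famAt (F : Fam V) : Dfn fun v => F.At (a v) (M v) := by
  unfold Fam.At; infer_instance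

instance Dfn.inProd (F : Fam V) : Dfn fun v => InProd (a v) F (b v) := by
  have := ha.shift; have := hb.shift
  unfold InProd; infer_instance

instance Dfn.isEvalAt : Dfn fun v => IsEvalAt (a v) (b v) (c v) (d v) := by
  have := ha.shift; have := hb.shift; have := hc.shift; have := hd.shift
  unfold IsEvalAt; infer_instance

end Definability
end InternalZF

/-! ### Set theory in a model of ZF: definite descriptions, functions, natural numbers, recursion.
-/

namespace InternalZF

/-! ### Set-theoretic operations of a model of ZF -/

/-- `(V, ∈)` is a model of ZF. -/
class ZFModel (V : Type u) [Membership V V] : Prop where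
  isModel : IsModelOfZF V

section Operations

set_option linter.unusedSectionVars false

variable {V : Type u} [Membership V V] [hV : ZFModel V]

instance ZFModel.nonempty : Nonempty V := ⟨hV.isModel.infinity.choose⟩

theorem ext_mem {x y : V} (h : ∀ z : V, z ∈ x ↔ z ∈ y) : x = y := hV.isModel.extensionality x y h

open Classical in
/-- The unique element with the property `P`, a fixed default value if there is none. -/
noncomputable def the (P : V → Prop) : V :=
  if h : ∃! y, P y then h.choose else Classical.arbitrary V

theorem the_spec {P : V → Prop} (h : ∃! y, P y) : P (the P) := by
  unfold the; rw [dif_pos h]; exact h.choose_spec.1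

theorem the_eq {P : V → Prop} {x : V} (h : P x) (hu : ∀ y, P y → y = x) : the P = x :=
  hu _ (the_spec ⟨x, h, hu⟩)

/-- The graph splits into two definable cases: either there is a unique solution and `v 0` is one,
or there is none and `v 0` is the default value, which is a parameter. -/
instance DFun.the (P : (ℕ → V) → V → Prop) [h : Dfn fun v => P (InternalZF.tail v) (v 0)] :
    DFun fun v => InternalZF.the (P v) := by
  have h2 : Dfn fun v => P (InternalZF.tail (InternalZF.tail v)) (v 0) :=
    h.reindex fun | 0 => 0 | n + 1 => n + 2
  refine ⟨(inferInstance : Dfn fun v => ((∃! y, P (InternalZF.tail v) y) ∧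
    P (InternalZF.tail v) (v 0)) ∨ ¬ (∃! y, P (InternalZF.tail v) y) ∧
    v 0 = Classical.arbitrary V).congr fun v => ?_⟩
  by_cases hu : ∃! y, P (InternalZF.tail v) y
  · simp only [hu, true_and, not_true, false_and, or_false]
    exact ⟨fun e => e ▸ the_spec hu, fun e => hu.unique e (the_spec hu)⟩
  · simp [hu, InternalZF.the]

instance DFun.ite (P : (ℕ → V) → Prop) (a b : (ℕ → V) → V) [∀ v, Decidable (P v)] [hP : Dfn P]
    [ha : DFun a] [hb : DFun b] : DFun fun v => if P v then a v else b v := by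
  have := ha.out
  have := hb.out
  have hP' : Dfn fun v => P (InternalZF.tail v) := hP.reindex fun n => n + 1
  refine ⟨(inferInstance : Dfn fun v => (P (InternalZF.tail v) ∧ v 0 = a (InternalZF.tail v)) ∨
    (¬ P (InternalZF.tail v) ∧ v 0 = b (InternalZF.tail v))).congr fun v => ?_⟩
  split <;> simp_all

/-- The empty set. -/
noncomputable def emp : V := the IsEmptySet

theorem exists_sep (P : V → Prop) [h : Dfn fun v : ℕ → V => P (v 0)] (a : V) :
    ∃ b : V, ∀ x : V, x ∈ b ↔ x ∈ a ∧ P x :=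
  hV.isModel.separation P (h.out.preimage_comp fun _ => (0 : Fin 1)) a

theorem existsUnique_of_mem_iff {P : V → Prop} (h : ∃ b : V, ∀ x, x ∈ b ↔ P x) :
    ∃! b : V, ∀ x, x ∈ b ↔ P x :=
  h.elim fun b hb => ⟨b, hb, fun _ hc => ext_mem fun z => (hc z).trans (hb z).symm⟩

@[simp] theorem notMem_emp (x : V) : ¬ x ∈ (emp : V) := by
  have h : ∃! e : V, ∀ z : V, z ∈ e ↔ False := existsUnique_of_mem_iff <|
    hV.isModel.infinity.elim fun _ ⟨⟨e, _, he⟩, _⟩ => ⟨e, fun z => iff_false_intro (he z)⟩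
  have h' : ∃! e : V, IsEmptySet e := by simpa [IsEmptySet] using h
  exact the_spec h' x

theorem isEmptySet_iff {e : V} : IsEmptySet e ↔ e = emp :=
  ⟨fun h => ext_mem fun z => by simp [h z], fun h => h ▸ notMem_emp⟩

/-- `{x, y}`. -/
noncomputable def upair (x y : V) : V := the fun p => IsUPair p x y

@[simp] theorem mem_upair {x y z : V} : z ∈ upair x y ↔ z = x ∨ z = y :=
  the_spec (existsUnique_of_mem_iff (hV.isModel.pairing x y)) z

theorem isUPair_iff {p x y : V} : IsUPair p x y ↔ p = upair x y :=
  ⟨fun h => ext_mem fun z => by rw [h z, mem_upair], fun h z => h ▸ mem_upair⟩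

/-- `(x, y)`. -/
noncomputable def pair (x y : V) : V := upair (upair x x) (upair x y)

theorem isPair_iff {p x y : V} : IsPair p x y ↔ p = pair x y := by
  unfold IsPair
  simp only [isUPair_iff]
  exact ⟨fun h => ext_mem fun z => by rw [h z, pair, mem_upair], fun h z => by rw [h, pair, mem_upair]⟩

theorem upair_inj {x y z w : V} (h : upair x y = upair z w) : x = z ∧ y = w ∨ x = w ∧ y = z := by
  have h1 : x = z ∨ x = w := by rw [← mem_upair, ← h, mem_upair]; exact .inl rfl
  have h2 : y = z ∨ y = w := by rw [← mem_upair, ← h, mem_upair]; exact .inr rfl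
  have h3 : z = x ∨ z = y := by rw [← mem_upair, h, mem_upair]; exact .inl rfl
  have h4 : w = x ∨ w = y := by rw [← mem_upair, h, mem_upair]; exact .inr rfl
  grind

@[simp] theorem pair_inj {x y z w : V} : pair x y = pair z w ↔ x = z ∧ y = w := by
  refine ⟨fun h => ?_, fun ⟨h, h'⟩ => by rw [h, h']⟩
  rcases upair_inj h with ⟨h1, h2⟩ | ⟨h1, h2⟩
  · rcases upair_inj h1 with ⟨h3, -⟩ | ⟨h3, -⟩ <;> subst h3 <;>
      rcases upair_inj h2 with ⟨h4, h5⟩ | ⟨h4, h5⟩ <;> grind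
  · rcases upair_inj h1 with ⟨h3, h4⟩ | ⟨h3, h4⟩ <;>
      rcases upair_inj h2 with ⟨h5, h6⟩ | ⟨h5, h6⟩ <;> grind

theorem app_iff {f x y : V} : App f x y ↔ pair x y ∈ f := by
  simp [App, isPair_iff]

/-- `⋃ x`. -/
noncomputable def sUnion (x : V) : V := the fun w => ∀ z : V, z ∈ w ↔ ∃ y : V, y ∈ x ∧ z ∈ y

@[simp] theorem mem_sUnion {x z : V} : z ∈ sUnion x ↔ ∃ y : V, y ∈ x ∧ z ∈ y :=
  the_spec (existsUnique_of_mem_iff (hV.isModel.union x)) z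

/-- The power set. -/
noncomputable def pow (x : V) : V := the fun p => ∀ z : V, z ∈ p ↔ ∀ w : V, w ∈ z → w ∈ x

@[simp] theorem mem_pow {x z : V} : z ∈ pow x ↔ ∀ w : V, w ∈ z → w ∈ x :=
  the_spec (existsUnique_of_mem_iff (hV.isModel.powerset x)) z

/-- `{x ∈ a | P x}`. -/
noncomputable def sep (a : V) (P : V → Prop) : V := the fun b => ∀ x : V, x ∈ b ↔ x ∈ a ∧ P x

@[simp] theorem mem_sep {P : V → Prop} [Dfn fun v : ℕ → V => P (v 0)] {a x : V} :
    x ∈ sep a P ↔ x ∈ a ∧ P x :=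
  the_spec (existsUnique_of_mem_iff (exists_sep P a)) x

/-- `{F x | x ∈ a}`. -/
noncomputable def img (a : V) (F : V → V) : V :=
  the fun b => ∀ y : V, y ∈ b ↔ ∃ x : V, x ∈ a ∧ y = F x

theorem mem_img {F : V → V} [h : DFun fun v : ℕ → V => F (v 0)] {a y : V} :
    y ∈ img a F ↔ ∃ x : V, x ∈ a ∧ y = F x := by
  have h2 : Dfn fun v : ℕ → V => v 1 = F (v 0) := h.out.reindex fun | 0 => 1 | _ => 0
  refine the_spec (existsUnique_of_mem_iff (hV.isModel.replacement (fun x y => y = F x)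
    (h2.out.preimage_comp fun n => if n = 0 then (0 : Fin 2) else 1) a ?_)) y
  rintro x - y z rfl rfl
  rfl

/-- `x ∪ y`. -/
noncomputable def union (x y : V) : V := sUnion (upair x y)

@[simp] theorem mem_union {x y z : V} : z ∈ union x y ↔ z ∈ x ∨ z ∈ y := by
  simp [union, or_and_right, exists_or]

/-- `x ∪ {x}`. -/
noncomputable def succ (x : V) : V := union x (upair x x)

@[simp] theorem mem_succ {x z : V} : z ∈ succ x ↔ z ∈ x ∨ z = x := by simp [succ]

theorem isSucc_iff {m n : V} : IsSucc m n ↔ m = succ n :=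
  ⟨fun h => ext_mem fun z => by rw [h z, mem_succ], fun h z => h ▸ mem_succ⟩

section DFun

variable (a b c : (ℕ → V) → V) [ha : DFun a] [hb : DFun b] [hc : DFun c]

instance DFun.upair : DFun fun v => InternalZF.upair (a v) (b v) := by
  have := ha.shift; have := hb.shift
  unfold InternalZF.upair; infer_instance

instance DFun.pair : DFun fun v => InternalZF.pair (a v) (b v) := by
  unfold InternalZF.pair; infer_instance

instance DFun.sUnion : DFun fun v => InternalZF.sUnion (a v) := by
  have := ha.shift
  unfold InternalZF.sUnion; infer_instance

instance DFun.pow : DFun fun v => InternalZF.pow (a v) := by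
  have := ha.shift
  unfold InternalZF.pow; infer_instance

instance DFun.sep (P : (ℕ → V) → V → Prop) [h : Dfn fun v => P (InternalZF.tail v) (v 0)] :
    DFun fun v => InternalZF.sep (a v) (P v) := by
  have := ha.shift
  have h2 : Dfn fun v => P (InternalZF.tail (InternalZF.tail v)) (v 0) :=
    h.reindex fun | 0 => 0 | n + 1 => n + 2
  unfold InternalZF.sep; infer_instance

instance DFun.img (F : (ℕ → V) → V → V) [h : DFun fun v => F (InternalZF.tail v) (v 0)] :
    DFun fun v => InternalZF.img (a v) (F v) := by
  have := ha.shift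
  have h2 : DFun fun v => F (InternalZF.tail (InternalZF.tail (InternalZF.tail v))) (v 0) :=
    h.reindex fun | 0 => 0 | n + 1 => n + 3
  unfold InternalZF.img; infer_instance

instance DFun.union : DFun fun v => InternalZF.union (a v) (b v) := by
  unfold InternalZF.union; infer_instance

instance DFun.succ : DFun fun v => InternalZF.succ (a v) := by
  unfold InternalZF.succ; infer_instance

end DFun

/-- `A × B`. -/
noncomputable def prod (A B : V) : V := sUnion (img A fun x => img B fun y => pair x y)

theorem mem_prod {A B p : V} : p ∈ prod A B ↔ ∃ x y : V, x ∈ A ∧ y ∈ B ∧ p = pair x y := by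
  simp only [prod, mem_sUnion, mem_img]
  constructor
  · rintro ⟨_, ⟨x, hx, rfl⟩, h⟩
    obtain ⟨y, hy, rfl⟩ := mem_img.1 h
    exact ⟨x, y, hx, hy, rfl⟩
  · rintro ⟨x, y, hx, hy, rfl⟩
    exact ⟨_, ⟨x, hx, rfl⟩, mem_img.2 ⟨y, hy, rfl⟩⟩

@[simp] theorem pair_mem_prod {A B x y : V} : pair x y ∈ prod A B ↔ x ∈ A ∧ y ∈ B := by
  simp [mem_prod]

/-- The function `x ↦ F x` on `A`. -/
noncomputable def mkFun (A : V) (F : V → V) : V := img A fun x => pair x (F x)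

/-- The value `f(x)`. -/
noncomputable def ap (f x : V) : V := the fun y => App f x y

section DFun

variable (a b : (ℕ → V) → V) [ha : DFun a] [hb : DFun b]

instance DFun.prod : DFun fun v => InternalZF.prod (a v) (b v) := by
  have := ha.shift; have := hb.shift
  unfold InternalZF.prod; infer_instance

instance DFun.mkFun (F : (ℕ → V) → V → V) [h : DFun fun v => F (InternalZF.tail v) (v 0)] :
    DFun fun v => InternalZF.mkFun (a v) (F v) := by
  unfold InternalZF.mkFun; infer_instance

instance DFun.ap : DFun fun v => InternalZF.ap (a v) (b v) := by
  have := ha.shift; have := hb.shift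
  unfold InternalZF.ap; infer_instance

end DFun

theorem IsFun.app_iff {f A x y : V} (h : IsFun f A) : App f x y ↔ x ∈ A ∧ y = ap f x := by
  have key : ∀ {x}, x ∈ A → App f x (ap f x) := fun hx => the_spec (h.2 _ hx)
  constructor
  · intro hxy
    obtain ⟨p, hp, hpxy⟩ := hxy
    obtain ⟨x', y', hx', h'⟩ := h.1 p hp
    rw [isPair_iff] at h' hpxy
    obtain ⟨rfl, rfl⟩ := pair_inj.1 (hpxy.symm.trans h')
    exact ⟨hx', (h.2 _ hx').unique ⟨p, hp, isPair_iff.2 h'⟩ (key hx')⟩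
  · rintro ⟨hx, rfl⟩
    exact key hx

theorem IsFun.app {f A x : V} (h : IsFun f A) (hx : x ∈ A) : App f x (ap f x) :=
  h.app_iff.2 ⟨hx, rfl⟩

theorem IsFun.ap_eq {f A x y : V} (h : IsFun f A) (hx : App f x y) : ap f x = y :=
  (h.app_iff.1 hx).2.symm

theorem IsFun.mem_iff {f A p : V} (h : IsFun f A) : p ∈ f ↔ ∃ x, x ∈ A ∧ p = pair x (ap f x) := by
  constructor
  · intro hp
    obtain ⟨x, y, hx, h'⟩ := h.1 p hp
    rw [isPair_iff] at h'
    exact ⟨x, hx, by rw [h.ap_eq (InternalZF.app_iff.2 (h' ▸ hp)), h']⟩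
  · rintro ⟨x, hx, rfl⟩
    exact InternalZF.app_iff.1 (h.app hx)

theorem IsFun.ext {f g A : V} (hf : IsFun f A) (hg : IsFun g A) (h : ∀ x, x ∈ A → ap f x = ap g x) :
    f = g := by
  refine ext_mem fun p => ?_
  rw [hf.mem_iff, hg.mem_iff]
  exact exists_congr fun x => and_congr_right fun hx => by rw [h x hx]

theorem IsFun.dom_eq {f A B : V} (hA : IsFun f A) (hB : IsFun f B) : A = B :=
  ext_mem fun _ => ⟨fun hx => (hB.app_iff.1 (hA.app hx)).1, fun hx => (hA.app_iff.1 (hB.app hx)).1⟩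

theorem isMap_iff {f A B : V} : IsMap f A B ↔ IsFun f A ∧ ∀ x, x ∈ A → ap f x ∈ B :=
  and_congr_right fun h => ⟨fun h' x hx => h' _ _ (h.app hx), fun h' x y hxy => by
    obtain ⟨hx, rfl⟩ := h.app_iff.1 hxy
    exact h' x hx⟩

theorem IsMap.ap_mem {f A B x : V} (h : IsMap f A B) (hx : x ∈ A) : ap f x ∈ B :=
  (isMap_iff.1 h).2 x hx

section MkFun

variable {F G : V → V} {A B : V}

theorem app_mkFun [hF : DFun fun v : ℕ → V => F (v 0)] {x y : V} :
    App (mkFun A F) x y ↔ x ∈ A ∧ y = F x := by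
  rw [app_iff, mkFun, mem_img]
  simp only [pair_inj]
  exact ⟨fun ⟨z, hz, h1, h2⟩ => by subst h1; exact ⟨hz, h2⟩, fun ⟨h1, h2⟩ => ⟨x, h1, rfl, h2⟩⟩

theorem isFun_mkFun [hF : DFun fun v : ℕ → V => F (v 0)] : IsFun (mkFun A F) A := by
  constructor
  · intro p hp
    obtain ⟨x, hx, rfl⟩ := mem_img.1 hp
    exact ⟨x, _, hx, isPair_iff.2 rfl⟩
  · intro x hx
    simp [app_mkFun, hx]

theorem ap_mkFun [hF : DFun fun v : ℕ → V => F (v 0)] {x : V} (hx : x ∈ A) :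
    ap (mkFun A F) x = F x :=
  isFun_mkFun.ap_eq (app_mkFun.2 ⟨hx, rfl⟩)

theorem isMap_mkFun [hF : DFun fun v : ℕ → V => F (v 0)] (h : ∀ x, x ∈ A → F x ∈ B) :
    IsMap (mkFun A F) A B :=
  isMap_iff.2 ⟨isFun_mkFun, fun x hx => by rw [ap_mkFun hx]; exact h x hx⟩

theorem mkFun_congr [hF : DFun fun v : ℕ → V => F (v 0)] [hG : DFun fun v : ℕ → V => G (v 0)]
    (h : ∀ x, x ∈ A → F x = G x) : mkFun A F = mkFun A G :=
  isFun_mkFun.ext isFun_mkFun fun x hx => by rw [ap_mkFun hx, ap_mkFun hx, h x hx]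

end MkFun

/-- The set of functions from `A` to `B`. -/
noncomputable def maps (A B : V) : V := sep (pow (prod A B)) fun f => IsMap f A B

@[simp] theorem mem_maps {A B f : V} : f ∈ maps A B ↔ IsMap f A B := by
  rw [maps, mem_sep, mem_pow, and_iff_right_iff_imp]
  intro h p hp
  obtain ⟨x, hx, rfl⟩ := h.1.mem_iff.1 hp
  exact pair_mem_prod.2 ⟨hx, h.ap_mem hx⟩

instance DFun.maps (a b : (ℕ → V) → V) [ha : DFun a] [hb : DFun b] :
    DFun fun v => InternalZF.maps (a v) (b v) := by
  have := ha.shift; have := hb.shift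
  unfold InternalZF.maps; infer_instance

/-! ### Natural numbers -/

theorem exists_minimal {x : V} (h : ∃ y, y ∈ x) : ∃ y, y ∈ x ∧ ∀ z, z ∈ y → ¬ z ∈ x :=
  hV.isModel.foundation x h

/-- Foundation for `{x}`. Later it also shows that a set such as `maps omega Z` is none of its own
members and can serve as an additional point. -/
theorem mem_irrefl (x : V) : ¬ x ∈ x := by
  intro h
  obtain ⟨y, hy, hy'⟩ := exists_minimal (x := upair x x) ⟨x, by simp⟩
  obtain rfl : y = x := by simpa using hy
  exact hy' y h hy

theorem mem_asymm {x y : V} (h : x ∈ y) : ¬ y ∈ x := by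
  intro h'
  obtain ⟨z, hz, hz'⟩ := exists_minimal (x := upair x y) ⟨x, by simp⟩
  rcases mem_upair.1 hz with rfl | rfl
  · exact hz' y h' (by simp)
  · exact hz' x h (by simp)

theorem succ_inj {x y : V} (h : succ x = succ y) : x = y := by
  have h1 : x ∈ y ∨ x = y := by rw [← mem_succ, ← h]; simp
  have h2 : y ∈ x ∨ y = x := by rw [← mem_succ, h]; simp
  rcases h1 with h1 | h1
  · rcases h2 with h2 | h2
    · exact (mem_asymm h1 h2).elim
    · exact h2.symm
  · exact h1

theorem isInductiveSet_iff {w : V} :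
    IsInductiveSet w ↔ emp ∈ w ∧ ∀ n, n ∈ w → succ n ∈ w := by
  simp [IsInductiveSet, isEmptySet_iff, isSucc_iff]

theorem exists_isInductiveSet : ∃ w : V, IsInductiveSet w := by
  obtain ⟨w, ⟨e, he, he'⟩, h⟩ := hV.isModel.infinity
  refine ⟨w, isInductiveSet_iff.2 ⟨isEmptySet_iff.1 he' ▸ he, fun n hn => ?_⟩⟩
  obtain ⟨m, hm, hm'⟩ := h n hn
  exact isSucc_iff.1 hm' ▸ hm

/-- The set of natural numbers. -/
noncomputable def omega : V := the fun w => ∀ n : V, n ∈ w ↔ IsNat n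

theorem mem_omega {n : V} : n ∈ (omega : V) ↔ IsNat n := by
  obtain ⟨w, hw⟩ := exists_isInductiveSet (V := V)
  refine the_spec (existsUnique_of_mem_iff ⟨sep w IsNat, fun n => ?_⟩) n
  rw [mem_sep, and_iff_right_iff_imp]
  exact fun h => h w hw

@[simp] theorem emp_mem_omega : (emp : V) ∈ (omega : V) :=
  mem_omega.2 fun _ hw => (isInductiveSet_iff.1 hw).1

theorem succ_mem_omega {n : V} (h : n ∈ (omega : V)) : succ n ∈ (omega : V) :=
  mem_omega.2 fun w hw => (isInductiveSet_iff.1 hw).2 n (mem_omega.1 h w hw)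

/-- Only for definable `P`: the set of naturals satisfying `P` has to exist in `V` in order to be an
inductive set there. -/
theorem nat_induction (P : V → Prop) [Dfn fun v : ℕ → V => P (v 0)] (h0 : P emp)
    (hs : ∀ n, n ∈ (omega : V) → P n → P (succ n)) {n : V} (hn : n ∈ (omega : V)) : P n := by
  refine (mem_sep.1 (mem_omega.1 hn (sep omega P) (isInductiveSet_iff.2 ⟨?_, fun n hn => ?_⟩))).2
  · simp [h0]
  · rw [mem_sep] at hn ⊢
    exact ⟨succ_mem_omega hn.1, hs n hn.1 hn.2⟩

theorem nat_cases {n : V} (hn : n ∈ (omega : V)) : n = emp ∨ ∃ m, m ∈ (omega : V) ∧ n = succ m :=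
  nat_induction (fun n => n = emp ∨ ∃ m, m ∈ (omega : V) ∧ n = succ m) (.inl rfl)
    (fun n hn _ => .inr ⟨n, hn, rfl⟩) hn

theorem mem_omega_of_mem {m n : V} (hn : n ∈ (omega : V)) (h : m ∈ n) : m ∈ (omega : V) :=
  nat_induction (fun n => ∀ m, m ∈ n → m ∈ (omega : V)) (fun m h => by simp at h)
    (fun n hn ih m h => (mem_succ.1 h).elim (ih m) fun e => e ▸ hn) hn m h

theorem nat_mem_trans {k m n : V} (hn : n ∈ (omega : V)) (hk : k ∈ m) (hm : m ∈ n) : k ∈ n :=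
  nat_induction (fun n => ∀ m k, m ∈ n → k ∈ m → k ∈ n) (fun m _ h => by simp at h)
    (fun n _ ih m k h hk => mem_succ.2 (.inl ((mem_succ.1 h).elim (fun h => ih m k h hk)
      fun e => e ▸ hk))) hn m k hm hk

theorem emp_mem_succ {n : V} (hn : n ∈ (omega : V)) : emp ∈ succ n :=
  nat_induction (fun n => emp ∈ succ n) (by simp) (fun n _ ih => by rw [mem_succ]; exact .inl ih) hn

theorem succ_mem_succ {m n : V} (hn : n ∈ (omega : V)) (h : m ∈ n) : succ m ∈ succ n :=
  nat_induction (fun n => ∀ m, m ∈ n → succ m ∈ succ n) (fun m h => by simp at h)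
    (fun n _ ih m h => mem_succ.2 ((mem_succ.1 h).imp (ih m) fun e => e ▸ rfl)) hn m h

theorem nat_trichotomy {m n : V} (hm : m ∈ (omega : V)) (hn : n ∈ (omega : V)) :
    m ∈ n ∨ m = n ∨ n ∈ m := by
  refine nat_induction (fun m => ∀ n, n ∈ (omega : V) → m ∈ n ∨ m = n ∨ n ∈ m) ?_ ?_ hm n hn
  · intro n hn
    rcases nat_cases hn with rfl | ⟨k, hk, rfl⟩
    · exact .inr (.inl rfl)
    · exact .inl (emp_mem_succ hk)
  · intro m hm ih n hn
    rcases nat_cases hn with rfl | ⟨k, hk, rfl⟩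
    · exact .inr (.inr (emp_mem_succ hm))
    · rcases ih k hk with h | rfl | h
      · exact .inl (succ_mem_succ hk h)
      · exact .inr (.inl rfl)
      · exact .inr (.inr (succ_mem_succ hm h))

/-- The numeral `k` of `V`. -/
noncomputable def num : ℕ → V
  | 0 => emp
  | k + 1 => succ (num k)

theorem isNumeral_iff {k : ℕ} {x : V} : IsNumeral k x ↔ x = num k := by
  induction k generalizing x with
  | zero => exact isEmptySet_iff
  | succ k ih => simp [IsNumeral, ih, isSucc_iff, num]

theorem num_mem_omega (k : ℕ) : (num k : V) ∈ (omega : V) := by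
  induction k with
  | zero => exact emp_mem_omega
  | succ k ih => exact succ_mem_omega ih

theorem num_mem_num {j k : ℕ} (h : j < k) : (num j : V) ∈ (num k : V) := by
  induction k with
  | zero => omega
  | succ k ih =>
    rw [num, mem_succ]
    rcases Nat.lt_succ_iff_lt_or_eq.1 h with h | rfl
    · exact .inl (ih h)
    · exact .inr rfl

@[simp] theorem num_inj {j k : ℕ} : (num j : V) = num k ↔ j = k := by
  refine ⟨fun h => ?_, fun h => h ▸ rfl⟩
  rcases lt_trichotomy j k with h' | h' | h'
  · exact (mem_irrefl (num k : V) (by simpa [h] using num_mem_num (V := V) h')).elim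
  · exact h'
  · exact (mem_irrefl (num k : V) (by simpa [h] using num_mem_num (V := V) h')).elim

theorem isTagged_iff {k : ℕ} {c x : V} : IsTagged k c x ↔ c = pair (num k) x := by
  simp [IsTagged, isNumeral_iff, isPair_iff]

theorem isTagged₂_iff {k : ℕ} {c x y : V} : IsTagged₂ k c x y ↔ c = pair (num k) (pair x y) := by
  simp [IsTagged₂, isTagged_iff, isPair_iff]

/-! ### Well-founded recursion -/

section Recursion

variable (B : V) (lt : V → V → Prop) (G : V → V → V)

/-- The restriction of `f` to the predecessors of `x`. -/
noncomputable def restrPred (f x : V) : V := mkFun (sep B fun y => lt y x) (ap f)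

/-- `f` satisfies the recursion equation on the initial segment `A`. -/
def IsApprox (f A : V) : Prop :=
  (∀ x, x ∈ A → x ∈ B ∧ ∀ y, y ∈ B → lt y x → y ∈ A) ∧ IsFun f A ∧
    ∀ x, x ∈ A → ap f x = G x (restrPred B lt f x)

variable {B lt G} [hlt : Dfn fun v : ℕ → V => lt (v 0) (v 1)]
  [hG : DFun fun v : ℕ → V => G (v 0) (v 1)]

theorem ap_restrPred {f x y : V} (hy : y ∈ B) (h : lt y x) : ap (restrPred B lt f x) y = ap f y := by
  have := fun a b [ha : DFun a] [hb : DFun b] => hlt.comp2 (a := a) (b := b) ha hb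
  exact ap_mkFun (mem_sep.2 ⟨hy, h⟩)

theorem restrPred_congr {f g x : V} (h : ∀ y, y ∈ B → lt y x → ap f y = ap g y) :
    restrPred B lt f x = restrPred B lt g x := by
  have := fun a b [ha : DFun a] [hb : DFun b] => hlt.comp2 (a := a) (b := b) ha hb
  exact mkFun_congr fun y hy => h y (mem_sep.1 hy).1 (mem_sep.1 hy).2

-- Partial solutions on initial segments agree wherever both are defined, so they glue to a largest
-- one; were it not defined on all of `B`, a minimal missing point could be added. Well-foundedness
-- is assumed for subsets of `B` that are elements of `V`, which is why each class met in the proof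
-- must be definable.
open Classical in
theorem exists_recursion
    (wf : ∀ Y : V, (∃ y, y ∈ Y) → (∀ y, y ∈ Y → y ∈ B) → ∃ y, y ∈ Y ∧ ∀ z, z ∈ Y → ¬ lt z y) :
    ∃ f, IsFun f B ∧ ∀ x, x ∈ B → ap f x = G x (restrPred B lt f x) := by
  have ilt := fun a b [ha : DFun a] [hb : DFun b] => hlt.comp2 (a := a) (b := b) ha hb
  have iG := fun a b [ha : DFun a] [hb : DFun b] => hG.comp2 (a := a) (b := b) ha hb
  have iapprox : ∀ a b [ha : DFun a] [hb : DFun b],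
      Dfn fun v => IsApprox B lt G (a v) (b v) := by
    intro a b ha hb
    have := ha.shift; have := hb.shift
    unfold IsApprox restrPred; infer_instance
  -- At a minimal disagreement both values are computed by `G` from the same restriction.
  have agree : ∀ {f A g C}, IsApprox B lt G f A → IsApprox B lt G g C →
      ∀ x, x ∈ A → x ∈ C → ap f x = ap g x := by
    intro f A g C hf hg x hxA hxC
    by_contra hne
    obtain ⟨y, hy, hmin⟩ := wf (sep A fun x => x ∈ C ∧ ap f x ≠ ap g x)
      ⟨x, mem_sep.2 ⟨hxA, hxC, hne⟩⟩ fun y hy => (hf.1 y (mem_sep.1 hy).1).1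
    obtain ⟨hyA, hyC, hyne⟩ := mem_sep.1 hy
    apply hyne
    rw [hf.2.2 y hyA, hg.2.2 y hyC, restrPred_congr]
    intro z hz hzy
    by_contra hzne
    exact hmin z (mem_sep.2 ⟨(hf.1 y hyA).2 z hz hzy, (hg.1 y hyC).2 z hz hzy, hzne⟩) hzy
  -- The points reached by some approximation, and the common value of the approximations there.
  let A₀ := sep B fun x => ∃ f A, IsApprox B lt G f A ∧ x ∈ A
  let f₀ := mkFun A₀ fun x => the fun y => ∃ f A, IsApprox B lt G f A ∧ x ∈ A ∧ y = ap f x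
  have mem_A₀ : ∀ {f A x}, IsApprox B lt G f A → x ∈ A → x ∈ A₀ := fun hf hx =>
    mem_sep.2 ⟨(hf.1 _ hx).1, _, _, hf, hx⟩
  have ap_f₀ : ∀ {f A x}, IsApprox B lt G f A → x ∈ A → ap f₀ x = ap f x := by
    intro f A x hf hx
    rw [ap_mkFun (mem_A₀ hf hx)]
    refine the_eq ⟨f, A, hf, hx, rfl⟩ ?_
    rintro y ⟨g, C, hg, hxC, rfl⟩
    exact agree hg hf x hxC hx
  have hf₀ : IsApprox B lt G f₀ A₀ := by
    refine ⟨fun x hx => ?_, isFun_mkFun, fun x hx => ?_⟩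
    · obtain ⟨hxB, f, A, hf, hxA⟩ := mem_sep.1 hx
      exact ⟨hxB, fun y hy hyx => mem_A₀ hf ((hf.1 x hxA).2 y hy hyx)⟩
    · obtain ⟨hxB, f, A, hf, hxA⟩ := mem_sep.1 hx
      rw [ap_f₀ hf hxA, hf.2.2 x hxA, restrPred_congr]
      exact fun y hy hyx => (ap_f₀ hf ((hf.1 x hxA).2 y hy hyx)).symm
  have hAB : A₀ = B := by
    by_contra hne
    have : ∃ x, x ∈ B ∧ ¬ x ∈ A₀ := by
      by_contra h
      push Not at h
      exact hne (ext_mem fun z => ⟨fun hz => (mem_sep.1 hz).1, h z⟩)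
    obtain ⟨x, hxB, hxA⟩ := this
    obtain ⟨y, hy, hmin⟩ := wf (sep B fun x => ¬ x ∈ A₀) ⟨x, mem_sep.2 ⟨hxB, hxA⟩⟩
      fun y hy => (mem_sep.1 hy).1
    obtain ⟨hyB, hyA⟩ := mem_sep.1 hy
    have hpred : ∀ z, z ∈ B → lt z y → z ∈ A₀ := fun z hz hzy => by
      by_contra h
      exact hmin z (mem_sep.2 ⟨hz, h⟩) hzy
    -- All predecessors of the minimal missing point `y` lie in `A₀`, so adding the value that `G`
    -- prescribes at `y` gives an approximation defined at `y`.
    let f₁ := mkFun (union A₀ (upair y y)) fun z => if z = y then G y (restrPred B lt f₀ y) else ap f₀ z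
    have i1 : DFun fun v : ℕ → V =>
        if v 0 = y then G y (restrPred B lt f₀ y) else ap f₀ (v 0) := inferInstance
    have ap_f₁ : ∀ z, z ∈ A₀ → ap f₁ z = ap f₀ z := fun z hz => by
      rw [ap_mkFun (mem_union.2 (.inl hz)), if_neg]
      rintro rfl
      exact hyA hz
    refine hyA (mem_A₀ (f := f₁) (A := union A₀ (upair y y)) ⟨fun z hz => ?_, isFun_mkFun,
      fun z hz => ?_⟩ (by simp))
    · rcases mem_union.1 hz with hz | hz
      · exact ⟨(hf₀.1 z hz).1, fun w hw hwz => mem_union.2 (.inl ((hf₀.1 z hz).2 w hw hwz))⟩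
      · obtain rfl : z = y := by simpa using hz
        exact ⟨hyB, fun w hw hwz => mem_union.2 (.inl (hpred w hw hwz))⟩
    · by_cases hzA : z ∈ A₀
      · rw [ap_f₁ z hzA, hf₀.2.2 z hzA, restrPred_congr]
        exact fun w hw hwz => (ap_f₁ w ((hf₀.1 z hzA).2 w hw hwz)).symm
      · obtain rfl : z = y := by simpa [hzA] using hz
        rw [ap_mkFun hz, if_pos rfl, restrPred_congr]
        exact fun w hw hwz => (ap_f₁ w (hpred w hw hwz)).symm
  rw [hAB] at hf₀
  exact ⟨f₀, hf₀.2.1, hf₀.2.2⟩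

end Recursion

end Operations

end InternalZF

/-! ### Terms inside `V`: a bounding set, induction and evaluation. -/

namespace InternalZF

section TermsAndFormulas

set_option linter.unusedSectionVars false
set_option synthInstance.maxHeartbeats 400000
set_option synthInstance.maxSize 5000

variable {V : Type u} [Membership V V] [hV : ZFModel V]

/-! ### A set closed under pairs and finite sequences -/

/-- Take the union of stages `S_n = a ∪ ω ∪ ⋃_{m < n} (S_m ∪ P(S_m))` for `n ∈ ω`. A pair from `S_n`
lies in `S_{n+2}`, and a finite sequence has all entries in a single stage. The set serves to bound
all terms and formulas, which are defined by quantifying over closed sets and would be vacuous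
notions if there were no closed set. -/
theorem exists_closure (a : V) : ∃ H : V, (∀ x, x ∈ a → x ∈ H) ∧ (∀ x, x ∈ (omega : V) → x ∈ H) ∧
    (∀ x y, x ∈ H → y ∈ H → pair x y ∈ H) ∧
    ∀ m ts, m ∈ (omega : V) → IsMap ts m H → ts ∈ H := by
  have hG : DFun fun v : ℕ → V => union (union a omega)
      (sUnion (img (v 0) fun m => union (ap (v 1) m) (pow (ap (v 1) m)))) := inferInstance
  obtain ⟨f, -, hf⟩ := exists_recursion (B := (omega : V)) (lt := fun x y => x ∈ y)
    (G := fun n g => union (union a omega)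
      (sUnion (img n fun m => union (ap g m) (pow (ap g m))))) (hG := hG)
    fun Y hY _ => exists_minimal hY |>.imp fun y hy => ⟨hy.1, fun z hz hzy => hy.2 z hzy hz⟩
  have hS : ∀ {n}, n ∈ (omega : V) → ∀ x, x ∈ ap f n ↔ (x ∈ a ∨ x ∈ (omega : V)) ∨
      ∃ m, m ∈ n ∧ (x ∈ ap f m ∨ ∀ z, z ∈ x → z ∈ ap f m) := by
    intro n hn x
    rw [hf n hn, mem_union, mem_union, mem_sUnion]
    refine or_congr_right ⟨?_, ?_⟩
    · rintro ⟨y, hy, hxy⟩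
      obtain ⟨m, hm, rfl⟩ := mem_img.1 hy
      rw [ap_restrPred (mem_omega_of_mem hn hm) hm, mem_union, mem_pow] at hxy
      exact ⟨m, hm, hxy⟩
    · rintro ⟨m, hm, hxm⟩
      refine ⟨_, mem_img.2 ⟨m, hm, rfl⟩, ?_⟩
      rwa [ap_restrPred (mem_omega_of_mem hn hm) hm, mem_union, mem_pow]
  have hmono : ∀ {m n x}, n ∈ (omega : V) → m ∈ n → x ∈ ap f m → x ∈ ap f n := fun hn hm hx =>
    (hS hn _).2 (.inr ⟨_, hm, .inl hx⟩)
  have hsub : ∀ {n x}, n ∈ (omega : V) → (∀ z, z ∈ x → z ∈ ap f n) → x ∈ ap f (succ n) :=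
    fun hn hx => (hS (succ_mem_omega hn) _).2 (.inr ⟨_, by simp, .inr hx⟩)
  have hup : ∀ {n x y}, n ∈ (omega : V) → x ∈ ap f n → y ∈ ap f n → upair x y ∈ ap f (succ n) :=
    fun hn hx hy => hsub hn fun z hz => (mem_upair.1 hz).elim (fun e => e ▸ hx) fun e => e ▸ hy
  have hpair : ∀ {n x y}, n ∈ (omega : V) → x ∈ ap f n → y ∈ ap f n →
      pair x y ∈ ap f (succ (succ n)) := fun hn hx hy =>
    hup (succ_mem_omega hn) (hup hn hx hx) (hup hn hx hy)
  have hub : ∀ {m n : V}, m ∈ (omega : V) → n ∈ (omega : V) →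
      ∃ k, k ∈ (omega : V) ∧ m ∈ k ∧ n ∈ k := by
    intro m n hm hn
    rcases nat_trichotomy hm hn with h | rfl | h
    · exact ⟨succ n, succ_mem_omega hn, by simp [h], by simp⟩
    · exact ⟨succ m, succ_mem_omega hm, by simp, by simp⟩
    · exact ⟨succ m, succ_mem_omega hm, by simp, by simp [h]⟩
  let H := sUnion (img omega fun n => ap f n)
  have hH : ∀ {x}, x ∈ H ↔ ∃ n, n ∈ (omega : V) ∧ x ∈ ap f n := by
    intro x
    rw [mem_sUnion]
    refine ⟨fun ⟨y, hy, hxy⟩ => ?_, fun ⟨n, hn, hx⟩ => ⟨_, mem_img.2 ⟨n, hn, rfl⟩, hx⟩⟩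
    obtain ⟨n, hn, rfl⟩ := mem_img.1 hy
    exact ⟨n, hn, hxy⟩
  refine ⟨H, fun x hx => hH.2 ⟨emp, emp_mem_omega, (hS emp_mem_omega x).2 (.inl (.inl hx))⟩,
    fun x hx => hH.2 ⟨emp, emp_mem_omega, (hS emp_mem_omega x).2 (.inl (.inr hx))⟩,
    fun x y hx hy => ?_, fun m ts hm hts => ?_⟩
  · obtain ⟨m, hm, hx⟩ := hH.1 hx
    obtain ⟨n, hn, hy⟩ := hH.1 hy
    obtain ⟨k, hk, hmk, hnk⟩ := hub hm hn
    exact hH.2 ⟨_, succ_mem_omega (succ_mem_omega hk), hpair hk (hmono hk hmk hx) (hmono hk hnk hy)⟩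
  -- The length may be a nonstandard natural number, so the common stage is found by induction
  -- inside `V`.
  · have key : ∀ i, i ∈ (omega : V) → (∀ j, j ∈ i → j ∈ m) →
        ∃ k, k ∈ (omega : V) ∧ ∀ j, j ∈ i → ap ts j ∈ ap f k := by
      intro i hi
      refine nat_induction (fun i => (∀ j, j ∈ i → j ∈ m) →
        ∃ k, k ∈ (omega : V) ∧ ∀ j, j ∈ i → ap ts j ∈ ap f k) ?_ ?_ hi
      · exact fun _ => ⟨emp, emp_mem_omega, fun j hj => by simp at hj⟩
      · intro i hi ih him
        obtain ⟨k, hk, hik⟩ := ih fun j hj => him j (mem_succ.2 (.inl hj))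
        obtain ⟨l, hl, hil⟩ := hH.1 (hts.ap_mem (him i (by simp)))
        obtain ⟨r, hr, hkr, hlr⟩ := hub hk hl
        refine ⟨r, hr, fun j hj => ?_⟩
        rcases mem_succ.1 hj with hj | rfl
        · exact hmono hr hkr (hik j hj)
        · exact hmono hr hlr hil
    obtain ⟨k, hk, hmk⟩ := key m hm fun _ h => h
    -- The pairs `(j, ts(j))` lie in stage `k + 2`, because `ω` is part of every stage; `ts` is a
    -- subset of that stage and therefore an element of the next.
    refine hH.2 ⟨_, succ_mem_omega (succ_mem_omega (succ_mem_omega hk)),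
      hsub (succ_mem_omega (succ_mem_omega hk)) fun p hp => ?_⟩
    obtain ⟨j, hj, rfl⟩ := hts.1.mem_iff.1 hp
    exact hpair hk ((hS hk j).2 (.inl (.inr (mem_omega_of_mem hm hj)))) (hmk j hj)

/-- A set containing all terms and formulas of `L`. -/
noncomputable def hull (L : Lang V) : V := (exists_closure (union L.fn L.rel)).choose

section Hull

variable {L : Lang V}

theorem mem_hull_of_fn {f : V} (h : f ∈ L.fn) : f ∈ hull L :=
  (exists_closure (union L.fn L.rel)).choose_spec.1 f (by simp [h])

theorem mem_hull_of_rel {f : V} (h : f ∈ L.rel) : f ∈ hull L :=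
  (exists_closure (union L.fn L.rel)).choose_spec.1 f (by simp [h])

theorem mem_hull_of_omega {n : V} (h : n ∈ (omega : V)) : n ∈ hull L :=
  (exists_closure (union L.fn L.rel)).choose_spec.2.1 n h

theorem pair_mem_hull {x y : V} (hx : x ∈ hull L) (hy : y ∈ hull L) : pair x y ∈ hull L :=
  (exists_closure (union L.fn L.rel)).choose_spec.2.2.1 x y hx hy

theorem map_mem_hull {m ts : V} (hm : m ∈ (omega : V)) (h : IsMap ts m (hull L)) : ts ∈ hull L :=
  (exists_closure (union L.fn L.rel)).choose_spec.2.2.2 m ts hm h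

theorem num_mem_hull (k : ℕ) : num k ∈ hull L := mem_hull_of_omega (num_mem_omega k)

end Hull

/-! ### Terms -/

/-- The variable `v_k`. -/
noncomputable def var (k : V) : V := pair (num 0) k
/-- The term `f(ts)`. -/
noncomputable def fnTerm (f ts : V) : V := pair (num 1) (pair f ts)
/-- The formula `t = r`. -/
noncomputable def eqF (t r : V) : V := pair (num 0) (pair t r)
/-- The formula `R(ts)`. -/
noncomputable def relF (R ts : V) : V := pair (num 1) (pair R ts)
/-- The formula `¬ φ`. -/
noncomputable def notF (φ : V) : V := pair (num 2) φ
/-- The formula `φ ∧ ψ`. -/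
noncomputable def andF (φ ψ : V) : V := pair (num 3) (pair φ ψ)
/-- The formula `∃ v_n φ`. -/
noncomputable def exF (φ : V) : V := pair (num 4) φ
/-- The formula `∀ v_n φ`. -/
noncomputable def allF (φ : V) : V := pair (num 5) φ

theorem isVar_iff {t k : V} : IsVar t k ↔ t = var k := isTagged_iff
theorem isFnTerm_iff {t f ts : V} : IsFnTerm t f ts ↔ t = fnTerm f ts := isTagged₂_iff
theorem isEq_iff {φ t r : V} : IsEq φ t r ↔ φ = eqF t r := isTagged₂_iff
theorem isRel_iff {φ R ts : V} : IsRel φ R ts ↔ φ = relF R ts := isTagged₂_iff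
theorem isNot_iff {φ χ : V} : IsNot χ φ ↔ χ = notF φ := isTagged_iff
theorem isAnd_iff {φ ψ χ : V} : IsAnd χ φ ψ ↔ χ = andF φ ψ := isTagged₂_iff
theorem isEx_iff {φ χ : V} : IsEx χ φ ↔ χ = exF φ := isTagged_iff
theorem isAll_iff {φ χ : V} : IsAll χ φ ↔ χ = allF φ := isTagged_iff

section DFun

variable (a b : (ℕ → V) → V) [ha : DFun a] [hb : DFun b]

instance DFun.varT : DFun fun v => InternalZF.var (a v) := by unfold InternalZF.var; infer_instance
instance DFun.fnTerm : DFun fun v => InternalZF.fnTerm (a v) (b v) := by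
  unfold InternalZF.fnTerm; infer_instance
instance DFun.eqF : DFun fun v => InternalZF.eqF (a v) (b v) := by
  unfold InternalZF.eqF; infer_instance
instance DFun.relF : DFun fun v => InternalZF.relF (a v) (b v) := by
  unfold InternalZF.relF; infer_instance
instance DFun.notF : DFun fun v => InternalZF.notF (a v) := by
  unfold InternalZF.notF; infer_instance
instance DFun.andF : DFun fun v => InternalZF.andF (a v) (b v) := by
  unfold InternalZF.andF; infer_instance
instance DFun.exF : DFun fun v => InternalZF.exF (a v) := by
  unfold InternalZF.exF; infer_instance
instance DFun.allF : DFun fun v => InternalZF.allF (a v) := by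
  unfold InternalZF.allF; infer_instance

end DFun

variable {L : Lang V}

theorem IsLang.fnAr_mem (hL : IsLang L) {f m : V} (h : App L.fnAr f m) :
    f ∈ L.fn ∧ m ∈ (omega : V) :=
  ⟨(hL.1.app_iff.1 h).1, mem_omega.2 (hL.2.1 f m h)⟩

theorem IsLang.relAr_mem (hL : IsLang L) {R m : V} (h : App L.relAr R m) :
    R ∈ L.rel ∧ m ∈ (omega : V) :=
  ⟨(hL.2.2.1.app_iff.1 h).1, mem_omega.2 (hL.2.2.2 R m h)⟩

theorem termClosed_iff {n X : V} : TermClosed L n X ↔ (∀ k, k ∈ n → var k ∈ X) ∧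
    ∀ f m ts, App L.fnAr f m → IsMap ts m X → fnTerm f ts ∈ X := by
  simp only [TermClosed, isVar_iff, isFnTerm_iff]
  exact ⟨fun ⟨h, h'⟩ => ⟨fun k hk => h k _ hk rfl, fun f m ts hf hts => h' f m ts _ hf hts rfl⟩,
    fun ⟨h, h'⟩ => ⟨fun k _ hk e => e ▸ h k hk, fun f m ts _ hf hts e => e ▸ h' f m ts hf hts⟩⟩

theorem isTerm_var {n k : V} (hk : k ∈ n) : IsTerm L n (var k) :=
  fun _ hX => (termClosed_iff.1 hX).1 k hk

theorem isTermSeq_iff {n m ts : V} :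
    IsTermSeq L n m ts ↔ IsFun ts m ∧ ∀ k, k ∈ m → IsTerm L n (ap ts k) :=
  and_congr_right fun h => ⟨fun h' k hk => h' _ _ (h.app hk), fun h' k t hkt => by
    obtain ⟨hk, rfl⟩ := h.app_iff.1 hkt
    exact h' k hk⟩

theorem isTerm_fn {n f m ts : V} (hf : App L.fnAr f m) (hts : IsTermSeq L n m ts) :
    IsTerm L n (fnTerm f ts) := fun X hX =>
  (termClosed_iff.1 hX).2 f m ts hf ⟨hts.1, fun k t hkt => hts.2 k t hkt X hX⟩

theorem termClosed_hull (hL : IsLang L) {n : V} (hn : n ∈ (omega : V)) :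
    TermClosed L n (hull L) :=
  termClosed_iff.2 ⟨fun _ hk => pair_mem_hull (num_mem_hull 0)
    (mem_hull_of_omega (mem_omega_of_mem hn hk)), fun _ _ _ hf hts =>
    pair_mem_hull (num_mem_hull 1) (pair_mem_hull (mem_hull_of_fn (hL.fnAr_mem hf).1)
      (map_mem_hull (hL.fnAr_mem hf).2 hts))⟩

theorem IsTerm.mem_hull (hL : IsLang L) {n t : V} (hn : n ∈ (omega : V)) (ht : IsTerm L n t) :
    t ∈ hull L := ht _ (termClosed_hull hL hn)

/-- The terms with property `P` form a closed set, obtained by separation from `hull L`. The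
induction step also receives that the arguments are terms. -/
theorem term_induction (hL : IsLang L) {n : V} (hn : n ∈ (omega : V)) (P : V → Prop)
    [Dfn fun v : ℕ → V => P (v 0)] (hvar : ∀ k, k ∈ n → P (var k))
    (hfn : ∀ f m ts, App L.fnAr f m → IsTermSeq L n m ts → (∀ k, k ∈ m → P (ap ts k)) →
      P (fnTerm f ts)) {t : V} (ht : IsTerm L n t) : P t := by
  refine (mem_sep.1 (ht (sep (hull L) fun t => IsTerm L n t ∧ P t) (termClosed_iff.2
    ⟨fun k hk => mem_sep.2 ⟨(isTerm_var hk).mem_hull hL hn, isTerm_var hk, hvar k hk⟩,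
      fun f m ts hf hts => ?_⟩))).2.2
  have hts' : IsTermSeq L n m ts :=
    isTermSeq_iff.2 ⟨hts.1, fun k hk => (mem_sep.1 (hts.ap_mem hk)).2.1⟩
  exact mem_sep.2 ⟨(isTerm_fn hf hts').mem_hull hL hn, isTerm_fn hf hts',
    hfn f m ts hf hts' fun k hk => (mem_sep.1 (hts.ap_mem hk)).2.2⟩

theorem IsTerm.cases (hL : IsLang L) {n t : V} (hn : n ∈ (omega : V)) (ht : IsTerm L n t) :
    (∃ k, k ∈ n ∧ t = var k) ∨
      ∃ f m ts, App L.fnAr f m ∧ IsTermSeq L n m ts ∧ t = fnTerm f ts :=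
  term_induction hL hn (fun t => (∃ k, k ∈ n ∧ t = var k) ∨
      ∃ f m ts, App L.fnAr f m ∧ IsTermSeq L n m ts ∧ t = fnTerm f ts)
    (fun k hk => .inl ⟨k, hk, rfl⟩) (fun f m ts hf hts _ => .inr ⟨f, m, ts, hf, hts, rfl⟩) ht

/-! ### Evaluation of terms -/

/-- `f^M(s)`. -/
noncomputable def fnv (M : Str V) (f s : V) : V := the fun y => FnVal M f s y

/-- `t^M[s]`. -/
noncomputable def tv (L : Lang V) (M : Str V) (n s t : V) : V := the fun d => TermVal L M n s t d

section DFun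

variable (M : (ℕ → V) → Str V) (a b c : (ℕ → V) → V) [hM : DStr M] [ha : DFun a] [hb : DFun b]
  [hc : DFun c]

instance DFun.fnv : DFun fun v => InternalZF.fnv (M v) (a v) (b v) := by
  have := ha.shift; have := hb.shift; have := hM.shift
  unfold InternalZF.fnv; infer_instance

instance DFun.tv : DFun fun v => InternalZF.tv L (M v) (a v) (b v) (c v) := by
  have := ha.shift; have := hb.shift; have := hc.shift; have := hM.shift
  unfold InternalZF.tv; infer_instance

end DFun

variable {M : Str V}

theorem IsStr.fnVal_iff (hM : IsStr L M) {f m s y : V} (hf : App L.fnAr f m)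
    (hs : IsMap s m M.dom) : FnVal M f s y ↔ y = fnv M f s :=
  ⟨fun h => (hM.fn_total f m s hf hs).unique h (the_spec (hM.fn_total f m s hf hs)),
    fun h => h ▸ the_spec (hM.fn_total f m s hf hs)⟩

theorem IsStr.fnv_mem (hM : IsStr L M) {f m s : V} (hf : App L.fnAr f m)
    (hs : IsMap s m M.dom) : fnv M f s ∈ M.dom := by
  obtain ⟨q, -, p, hp, hpq⟩ := (hM.fnVal_iff hf hs).2 rfl
  obtain ⟨_, _, _, _, y, _, _, hy, _, h⟩ := hM.fn_subset p hp
  rw [isPair_iff] at hpq h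
  obtain ⟨-, rfl⟩ := pair_inj.1 (hpq.symm.trans h)
  exact hy

theorem isImageSeq_iff {j n s s' : V} (hs : IsFun s n) (hs' : IsFun s' n) :
    IsImageSeq j n s s' ↔ ∀ k, k ∈ n → App j (ap s k) (ap s' k) :=
  ⟨fun h k hk => h k _ _ hk (hs.app hk) (hs'.app hk), fun h k x y hk hx hy => by
    obtain ⟨-, rfl⟩ := hs.app_iff.1 hx
    obtain ⟨-, rfl⟩ := hs'.app_iff.1 hy
    exact h k hk⟩

section TermEval

variable (hL : IsLang L) (hM : IsStr L M) {n s : V} (hn : n ∈ (omega : V)) (hs : IsMap s n M.dom)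
include hL hM hn hs

/-- Recursion along the relation "is an argument of". The range statement is recorded because
`IsTermEval` does not demand values in the domain, whereas the clause for function symbols needs
argument tuples from it. -/
theorem exists_isTermEval : ∃ e, IsTermEval L M n s e ∧ ∀ t d, App e t d → d ∈ M.dom := by
  obtain ⟨e, he, he'⟩ := exists_recursion (B := sep (hull L) (IsTerm L n))
    (lt := fun r t => ∃ f ts k, t = fnTerm f ts ∧ App ts k r)
    (G := fun t g => the fun d => (∃ k, t = var k ∧ k ∈ n ∧ d = ap s k) ∨
      ∃ f m ts, t = fnTerm f ts ∧ App L.fnAr f m ∧ IsTermSeq L n m ts ∧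
        d = fnv M f (mkFun m fun k => ap g (ap ts k))) (by
      -- If `Y` has no minimal element, then no term lies in `Y`, by induction on terms.
      intro Y ⟨y, hy⟩ hYB
      by_contra hmin
      push Not at hmin
      refine term_induction hL hn (fun t => ¬ t ∈ Y) ?_ ?_ (mem_sep.1 (hYB y hy)).2 hy
      · intro k hk hkY
        obtain ⟨z, _, f, ts, j, h, _⟩ := hmin _ hkY
        simp [var, fnTerm] at h
      · intro f m ts hf hts ih htY
        obtain ⟨z, hz, f', ts', j, h, hj⟩ := hmin _ htY
        obtain ⟨rfl, rfl⟩ : f = f' ∧ ts = ts' := by simpa [fnTerm] using h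
        obtain ⟨hjm, rfl⟩ := hts.1.app_iff.1 hj
        exact ih j hjm hz)
  have hmem : ∀ {t}, IsTerm L n t → t ∈ sep (hull L) (IsTerm L n) := fun ht =>
    mem_sep.2 ⟨ht.mem_hull hL hn, ht⟩
  have hvar : ∀ k, k ∈ n → ap e (var k) = ap s k := by
    intro k hk
    rw [he' _ (hmem (isTerm_var hk))]
    refine the_eq (.inl ⟨k, rfl, hk, rfl⟩) ?_
    rintro d (⟨k', h, -, rfl⟩ | ⟨f, m, ts, h, -⟩)
    · obtain rfl : k = k' := by simpa [var] using h
      rfl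
    · simp [var, fnTerm] at h
  have hfn : ∀ f m ts, App L.fnAr f m → IsTermSeq L n m ts →
      ap e (fnTerm f ts) = fnv M f (mkFun m fun k => ap e (ap ts k)) := by
    intro f m ts hf hts
    rw [he' _ (hmem (isTerm_fn hf hts))]
    -- Every argument is a predecessor of `fnTerm f ts`, so passing to the restriction of `e`
    -- changes nothing here.
    have hr : (mkFun m fun k => ap (restrPred (sep (hull L) (IsTerm L n))
        (fun r t => ∃ f ts k, t = fnTerm f ts ∧ App ts k r) e (fnTerm f ts)) (ap ts k)) =
        mkFun m fun k => ap e (ap ts k) := by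
      have : Dfn fun v : ℕ → V => ∃ f ts k, v 1 = fnTerm f ts ∧ App ts k (v 0) := inferInstance
      have := this.comp2 (P := fun r t => ∃ f ts k, t = fnTerm f ts ∧ App ts k r)
        (.var (fun v => v) 0) (.const (fnTerm f ts))
      refine isFun_mkFun.ext isFun_mkFun fun k hk => ?_
      unfold restrPred
      rw [ap_mkFun hk, ap_mkFun hk, ap_mkFun]
      exact mem_sep.2 ⟨hmem ((isTermSeq_iff.1 hts).2 k hk), f, ts, k, rfl, hts.1.app hk⟩
    refine the_eq (.inr ⟨f, m, ts, rfl, hf, hts, by rw [hr]⟩) ?_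
    rintro d (⟨k', h, -, rfl⟩ | ⟨f', m', ts', h, -, hts', rfl⟩)
    · simp [var, fnTerm] at h
    · obtain ⟨rfl, rfl⟩ : f = f' ∧ ts = ts' := by simpa [fnTerm] using h
      obtain rfl := hts.1.dom_eq hts'.1
      rw [hr]
  have hdom : ∀ t, IsTerm L n t → ap e t ∈ M.dom := fun t ht =>
    term_induction hL hn (fun t => ap e t ∈ M.dom) (fun k hk => by rw [hvar k hk]; exact hs.ap_mem hk)
      (fun f m ts hf hts ih => by rw [hfn f m ts hf hts]; exact hM.fnv_mem hf (isMap_mkFun ih)) ht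
  refine ⟨e, ⟨fun t ht => he.2 t (hmem ht), ?_, ?_⟩, ?_⟩
  · intro k t d hk ht hd
    rw [isVar_iff] at ht
    subst ht
    rw [he.app_iff, hvar k hk, hs.1.ap_eq hd]
    exact ⟨hmem (isTerm_var hk), rfl⟩
  · intro f m ts t ds d hf hts ht hds hi hd
    rw [isFnTerm_iff] at ht
    subst ht
    rw [he.app_iff, hfn f m ts hf hts]
    refine ⟨hmem (isTerm_fn hf hts), ?_⟩
    rw [(hM.fnVal_iff hf hds).1 hd]
    congr 1
    refine hds.1.ext isFun_mkFun fun k hk => ?_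
    rw [ap_mkFun hk, he.ap_eq ((isImageSeq_iff hts.1 hds.1).1 hi k hk)]
  · intro t d htd
    obtain ⟨ht, rfl⟩ := he.app_iff.1 htd
    exact hdom t (mem_sep.1 ht).2

/-- Both evaluations are compared with the one from `exists_isTermEval`: knowing that its values lie
in the domain is what allows the clause for function symbols to be applied to an arbitrary
evaluation. -/
theorem IsTermEval.unique {e e' t d d' : V} (he : IsTermEval L M n s e)
    (he' : IsTermEval L M n s e') (ht : IsTerm L n t) (hd : App e t d) (hd' : App e' t d') :
    d = d' := by
  obtain ⟨e₀, he₀, hdom⟩ := exists_isTermEval hL hM hn hs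
  have key : ∀ {e}, IsTermEval L M n s e → ∀ t, IsTerm L n t → ∀ d, App e t d → App e₀ t d := by
    intro e he t ht
    refine term_induction hL hn (fun t => ∀ d, App e t d → App e₀ t d) ?_ ?_ ht
    · intro k hk d hd
      have := he.var k _ _ hk (isVar_iff.2 rfl) (hs.1.app hk)
      obtain rfl := (he.total _ (isTerm_var hk)).unique hd this
      exact he₀.var k _ _ hk (isVar_iff.2 rfl) (hs.1.app hk)
    · intro f m ts hf hts ih d hd
      have hts' := (isTermSeq_iff.1 hts).2
      have happ : ∀ k, k ∈ m → App e (ap ts k) (ap e (ap ts k)) := fun k hk =>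
        the_spec (he.total _ (hts' k hk))
      have hds : IsMap (mkFun m fun k => ap e (ap ts k)) m M.dom :=
        isMap_mkFun fun k hk => hdom _ _ (ih k hk _ (happ k hk))
      have hi : ∀ {e'}, (∀ k, k ∈ m → App e' (ap ts k) (ap e (ap ts k))) →
          IsImageSeq e' m ts (mkFun m fun k => ap e (ap ts k)) := fun h =>
        (isImageSeq_iff hts.1 hds.1).2 fun k hk => by rw [ap_mkFun hk]; exact h k hk
      have := he.fn f m ts _ _ _ hf hts (isFnTerm_iff.2 rfl) hds (hi happ)
        ((hM.fnVal_iff hf hds).2 rfl)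
      obtain rfl := (he.total _ (isTerm_fn hf hts)).unique hd this
      exact he₀.fn f m ts _ _ _ hf hts (isFnTerm_iff.2 rfl) hds
        (hi fun k hk => ih k hk _ (happ k hk)) ((hM.fnVal_iff hf hds).2 rfl)
  exact (he₀.total t ht).unique (key he t ht d hd) (key he' t ht d' hd')

theorem existsUnique_termVal {t : V} (ht : IsTerm L n t) : ∃! d, TermVal L M n s t d := by
  obtain ⟨e, he, -⟩ := exists_isTermEval hL hM hn hs
  obtain ⟨d, hd, -⟩ := he.total t ht
  exact ⟨d, ⟨e, he, hd⟩, fun d' ⟨e', he', hd'⟩ => he'.unique hL hM hn hs he ht hd' hd⟩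

theorem termVal_iff {t d : V} (ht : IsTerm L n t) : TermVal L M n s t d ↔ d = tv L M n s t :=
  have h := existsUnique_termVal hL hM hn hs ht
  ⟨fun h' => h.unique h' (the_spec h), fun h' => h' ▸ the_spec h⟩

theorem IsTermEval.ap_eq_tv {e t : V} (he : IsTermEval L M n s e) (ht : IsTerm L n t) :
    ap e t = tv L M n s t :=
  (termVal_iff hL hM hn hs ht).1 ⟨e, he, the_spec (he.total t ht)⟩

theorem tv_mem {t : V} (ht : IsTerm L n t) : tv L M n s t ∈ M.dom := by
  obtain ⟨e, he, hdom⟩ := exists_isTermEval hL hM hn hs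
  rw [← he.ap_eq_tv hL hM hn hs ht]
  exact hdom t _ (the_spec (he.total t ht))

theorem tv_var {k : V} (hk : k ∈ n) : tv L M n s (var k) = ap s k := by
  obtain ⟨e, he, -⟩ := exists_isTermEval hL hM hn hs
  exact ((termVal_iff hL hM hn hs (isTerm_var hk)).1
    ⟨e, he, he.var k _ _ hk (isVar_iff.2 rfl) (hs.1.app hk)⟩).symm

theorem isMap_tv {m ts : V} (hts : IsTermSeq L n m ts) :
    IsMap (mkFun m fun k => tv L M n s (ap ts k)) m M.dom :=
  isMap_mkFun fun k hk => tv_mem hL hM hn hs ((isTermSeq_iff.1 hts).2 k hk)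

theorem tv_fn {f m ts : V} (hf : App L.fnAr f m) (hts : IsTermSeq L n m ts) :
    tv L M n s (fnTerm f ts) = fnv M f (mkFun m fun k => tv L M n s (ap ts k)) := by
  obtain ⟨e, he, -⟩ := exists_isTermEval hL hM hn hs
  have hds := isMap_tv hL hM hn hs hts
  refine ((termVal_iff hL hM hn hs (isTerm_fn hf hts)).1 ⟨e, he, he.fn f m ts _ _ _ hf hts
    (isFnTerm_iff.2 rfl) hds ((isImageSeq_iff hts.1 hds.1).2 fun k hk => ?_)
    ((hM.fnVal_iff hf hds).2 rfl)⟩).symm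
  have ht := (isTermSeq_iff.1 hts).2 k hk
  rw [ap_mkFun hk, ← he.ap_eq_tv hL hM hn hs ht]
  exact the_spec (he.total _ ht)

/-- Terms are evaluated compositionally, and this determines the evaluation. -/
theorem tv_eq_of_rec (F : V → V) [DFun fun v : ℕ → V => F (v 0)]
    (hvar : ∀ k, k ∈ n → F (var k) = ap s k)
    (hfn : ∀ f m ts, App L.fnAr f m → IsTermSeq L n m ts →
      (∀ k, k ∈ m → tv L M n s (ap ts k) = F (ap ts k)) →
      F (fnTerm f ts) = fnv M f (mkFun m fun k => F (ap ts k))) {t : V} (ht : IsTerm L n t) :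
    tv L M n s t = F t := by
  refine term_induction hL hn (fun t => tv L M n s t = F t) ?_ ?_ ht
  · intro k hk
    rw [tv_var hL hM hn hs hk, hvar k hk]
  · intro f m ts hf hts ih
    have := fun a [ha : DFun a] => DFun.comp1 (F := F) inferInstance ha
    rw [tv_fn hL hM hn hs hf hts, hfn f m ts hf hts ih, mkFun_congr ih]

end TermEval

end TermsAndFormulas

end InternalZF

/-! ### Formulas, satisfaction and back-and-forth inside `V`. -/

namespace InternalZF

section Satisfaction

set_option linter.unusedSectionVars false
set_option synthInstance.maxHeartbeats 400000
set_option synthInstance.maxSize 5000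

variable {V : Type u} [Membership V V] [hV : ZFModel V] {L : Lang V}

/-! ### Formulas -/

theorem formulaClosed_iff' {Z : V} : FormulaClosed L Z ↔
    (∀ n φ, n ∈ (omega : V) → IsAtomic L n φ → pair n φ ∈ Z) ∧
    (∀ n φ, n ∈ (omega : V) → pair n φ ∈ Z → pair n (notF φ) ∈ Z) ∧
    (∀ n φ ψ, n ∈ (omega : V) → pair n φ ∈ Z → pair n ψ ∈ Z → pair n (andF φ ψ) ∈ Z) ∧
    (∀ n φ, n ∈ (omega : V) → pair (succ n) φ ∈ Z → pair n (exF φ) ∈ Z) ∧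
    (∀ n φ, n ∈ (omega : V) → pair (succ n) φ ∈ Z → pair n (allF φ) ∈ Z) := by
  simp only [formulaClosed_iff, app_iff, isNot_iff, isAnd_iff, isEx_iff, isAll_iff, isSucc_iff,
    mem_omega]
  constructor
  · rintro ⟨h1, h2, h3, h4, h5⟩
    exact ⟨h1, fun n φ hn h => h2 n φ _ hn h rfl, fun n φ ψ hn h h' => h3 n φ ψ _ hn h h' rfl,
      fun n φ hn h => h4 n _ φ _ hn rfl h rfl, fun n φ hn h => h5 n _ φ _ hn rfl h rfl⟩
  · rintro ⟨h1, h2, h3, h4, h5⟩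
    refine ⟨h1, ?_, ?_, ?_, ?_⟩
    · rintro n φ _ hn h rfl; exact h2 n φ hn h
    · rintro n φ ψ _ hn h h' rfl; exact h3 n φ ψ hn h h'
    · rintro n _ φ _ hn rfl h rfl; exact h4 n φ hn h
    · rintro n _ φ _ hn rfl h rfl; exact h5 n φ hn h

theorem isFormula_atomic {n φ : V} (hn : n ∈ (omega : V)) (h : IsAtomic L n φ) :
    IsFormula L n φ := fun _ hZ => app_iff.2 ((formulaClosed_iff'.1 hZ).1 n φ hn h)

theorem isFormula_not {n φ : V} (hn : n ∈ (omega : V)) (h : IsFormula L n φ) :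
    IsFormula L n (notF φ) := fun Z hZ =>
  app_iff.2 ((formulaClosed_iff'.1 hZ).2.1 n φ hn (app_iff.1 (h Z hZ)))

theorem isFormula_and {n φ ψ : V} (hn : n ∈ (omega : V)) (h : IsFormula L n φ)
    (h' : IsFormula L n ψ) : IsFormula L n (andF φ ψ) := fun Z hZ =>
  app_iff.2 ((formulaClosed_iff'.1 hZ).2.2.1 n φ ψ hn (app_iff.1 (h Z hZ)) (app_iff.1 (h' Z hZ)))

theorem isFormula_ex {n φ : V} (hn : n ∈ (omega : V)) (h : IsFormula L (succ n) φ) :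
    IsFormula L n (exF φ) := fun Z hZ =>
  app_iff.2 ((formulaClosed_iff'.1 hZ).2.2.2.1 n φ hn (app_iff.1 (h Z hZ)))

theorem isFormula_all {n φ : V} (hn : n ∈ (omega : V)) (h : IsFormula L (succ n) φ) :
    IsFormula L n (allF φ) := fun Z hZ =>
  app_iff.2 ((formulaClosed_iff'.1 hZ).2.2.2.2 n φ hn (app_iff.1 (h Z hZ)))

theorem isAtomic_iff {n φ : V} : IsAtomic L n φ ↔
    (∃ t r : V, IsTerm L n t ∧ IsTerm L n r ∧ φ = eqF t r) ∨
    ∃ R m ts : V, App L.relAr R m ∧ IsTermSeq L n m ts ∧ φ = relF R ts := by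
  simp only [IsAtomic, isEq_iff, isRel_iff]

theorem formulaClosed_hull (hL : IsLang L) : FormulaClosed L (prod omega (hull L)) := by
  simp only [formulaClosed_iff', pair_mem_prod]
  refine ⟨fun n φ hn h => ⟨hn, ?_⟩, fun n φ hn h => ⟨hn, pair_mem_hull (num_mem_hull 2) h.2⟩,
    fun n φ ψ hn h h' => ⟨hn, pair_mem_hull (num_mem_hull 3) (pair_mem_hull h.2 h'.2)⟩,
    fun n φ hn h => ⟨hn, pair_mem_hull (num_mem_hull 4) h.2⟩,
    fun n φ hn h => ⟨hn, pair_mem_hull (num_mem_hull 5) h.2⟩⟩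
  rcases isAtomic_iff.1 h with ⟨t, r, ht, hr, rfl⟩ | ⟨R, m, ts, hR, hts, rfl⟩
  · exact pair_mem_hull (num_mem_hull 0) (pair_mem_hull (ht.mem_hull hL hn) (hr.mem_hull hL hn))
  · refine pair_mem_hull (num_mem_hull 1) (pair_mem_hull (mem_hull_of_rel (hL.relAr_mem hR).1)
      (map_mem_hull (hL.relAr_mem hR).2 (isMap_iff.2 ⟨hts.1, fun k hk => ?_⟩)))
    exact ((isTermSeq_iff.1 hts).2 k hk).mem_hull hL hn

theorem IsFormula.mem (hL : IsLang L) {n φ : V} (h : IsFormula L n φ) :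
    n ∈ (omega : V) ∧ φ ∈ hull L :=
  pair_mem_prod.1 (app_iff.1 (h _ (formulaClosed_hull hL)))

/-- The context varies, since a quantifier in context `n` has its scope in context `n + 1`; so the
induction is on pairs (context, formula), bounded by `prod omega (hull L)`. -/
theorem formula_induction (hL : IsLang L) (P : V → V → Prop) [hP : Dfn fun v : ℕ → V => P (v 0) (v 1)]
    (hatomic : ∀ n φ, n ∈ (omega : V) → IsAtomic L n φ → P n φ)
    (hnot : ∀ n φ, n ∈ (omega : V) → IsFormula L n φ → P n φ → P n (notF φ))
    (hand : ∀ n φ ψ, n ∈ (omega : V) → IsFormula L n φ → IsFormula L n ψ → P n φ → P n ψ →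
      P n (andF φ ψ))
    (hex : ∀ n φ, n ∈ (omega : V) → IsFormula L (succ n) φ → P (succ n) φ → P n (exF φ))
    (hall : ∀ n φ, n ∈ (omega : V) → IsFormula L (succ n) φ → P (succ n) φ → P n (allF φ))
    {n φ : V} (h : IsFormula L n φ) : P n φ := by
  have := fun a b [ha : DFun a] [hb : DFun b] => hP.comp2 (a := a) (b := b) ha hb
  let Z := sep (prod omega (hull L)) fun p => ∃ n φ, p = pair n φ ∧ IsFormula L n φ ∧ P n φ
  have hZ : ∀ {n φ}, pair n φ ∈ Z ↔ IsFormula L n φ ∧ P n φ := by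
    intro n φ
    rw [mem_sep]
    constructor
    · rintro ⟨-, n', φ', e, h⟩
      obtain ⟨rfl, rfl⟩ := pair_inj.1 e
      exact h
    · exact fun h => ⟨pair_mem_prod.2 (h.1.mem hL), n, φ, rfl, h⟩
  refine (hZ.1 (app_iff.1 (h Z (formulaClosed_iff'.2 ?_)))).2
  simp only [hZ]
  exact ⟨fun n φ hn h => ⟨isFormula_atomic hn h, hatomic n φ hn h⟩,
    fun n φ hn h => ⟨isFormula_not hn h.1, hnot n φ hn h.1 h.2⟩,
    fun n φ ψ hn h h' => ⟨isFormula_and hn h.1 h'.1, hand n φ ψ hn h.1 h'.1 h.2 h'.2⟩,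
    fun n φ hn h => ⟨isFormula_ex hn h.1, hex n φ hn h.1 h.2⟩,
    fun n φ hn h => ⟨isFormula_all hn h.1, hall n φ hn h.1 h.2⟩⟩

/-! ### Extending assignments -/

/-- `s ∪ {(n, d)}`. -/
noncomputable def extend (s n d : V) : V := union s (upair (pair n d) (pair n d))

instance DFun.extend (a b c : (ℕ → V) → V) [ha : DFun a] [hb : DFun b] [hc : DFun c] :
    DFun fun v => InternalZF.extend (a v) (b v) (c v) := by
  unfold InternalZF.extend; infer_instance

theorem isExtend_iff {s' s n d : V} : IsExtend s' s n d ↔ s' = extend s n d := by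
  unfold IsExtend
  simp only [isPair_iff]
  exact ⟨fun h => ext_mem fun z => by rw [h z]; simp [extend], fun h z => by simp [h, extend]⟩

theorem app_extend {s n d k x : V} : App (extend s n d) k x ↔ App s k x ∨ k = n ∧ x = d := by
  simp [app_iff, extend]

theorem isFun_extend {s n d : V} (hs : IsFun s n) : IsFun (extend s n d) (succ n) := by
  constructor
  · intro p hp
    rcases mem_union.1 hp with hp | hp
    · obtain ⟨x, y, hx, h⟩ := hs.1 p hp
      exact ⟨x, y, by simp [hx], h⟩
    · obtain rfl : p = pair n d := by simpa using hp
      exact ⟨n, d, by simp, isPair_iff.2 rfl⟩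
  · intro k hk
    simp only [app_extend, hs.app_iff]
    rcases mem_succ.1 hk with hk | rfl
    · have hne : k ≠ n := by rintro rfl; exact mem_irrefl _ hk
      simp [hk, hne]
    · simp [mem_irrefl]

theorem ap_extend_of_mem {s n d k : V} (hs : IsFun s n) (hk : k ∈ n) :
    ap (extend s n d) k = ap s k :=
  (isFun_extend hs).ap_eq (app_extend.2 (.inl (hs.app hk)))

theorem ap_extend_self {s n d : V} (hs : IsFun s n) : ap (extend s n d) n = d :=
  (isFun_extend hs).ap_eq (app_extend.2 (.inr ⟨rfl, rfl⟩))

theorem isMap_extend {s n d D : V} (hs : IsMap s n D) (hd : d ∈ D) :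
    IsMap (extend s n d) (succ n) D := by
  refine isMap_iff.2 ⟨isFun_extend hs.1, fun k hk => ?_⟩
  rcases mem_succ.1 hk with hk | rfl
  · rw [ap_extend_of_mem hs.1 hk]; exact hs.ap_mem hk
  · rwa [ap_extend_self hs.1]

theorem eq_extend {s s' n d : V} (hs : IsFun s n) (hs' : IsFun s' (succ n))
    (h : ∀ k, k ∈ n → ap s' k = ap s k) (hd : ap s' n = d) : s' = extend s n d := by
  refine hs'.ext (isFun_extend hs) fun k hk => ?_
  rcases mem_succ.1 hk with hk | rfl
  · rw [ap_extend_of_mem hs hk, h k hk]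
  · rw [ap_extend_self hs, hd]

/-! ### The satisfaction relation -/

variable (L) in
/-- Satisfaction of the atomic formulas. -/
def AtomicSat (M : Str V) (n φ s : V) : Prop :=
  (∃ t r, IsTerm L n t ∧ IsTerm L n r ∧ φ = eqF t r ∧
    ∃ d : V, TermVal L M n s t d ∧ TermVal L M n s r d) ∨
  ∃ R m ts, App L.relAr R m ∧ IsTermSeq L n m ts ∧ φ = relF R ts ∧
    ∃ ds : V, IsMap ds m M.dom ∧
      (∀ k t d : V, k ∈ m → App ts k t → App ds k d → TermVal L M n s t d) ∧ RelHolds M R ds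

instance Dfn.atomicSat (M : (ℕ → V) → Str V) (a b c : (ℕ → V) → V) [hM : DStr M] [ha : DFun a]
    [hb : DFun b] [hc : DFun c] : Dfn fun v => AtomicSat L (M v) (a v) (b v) (c v) := by
  have := ha.shift; have := hb.shift; have := hc.shift; have := hM.shift
  unfold AtomicSat; infer_instance

variable {M : Str V}

theorem atomicSat_eq {n t r s : V} (ht : IsTerm L n t) (hr : IsTerm L n r) :
    AtomicSat L M n (eqF t r) s ↔ ∃ d : V, TermVal L M n s t d ∧ TermVal L M n s r d := by
  constructor
  · rintro (⟨t', r', -, -, h, h'⟩ | ⟨R, m, ts, -, -, h, -⟩)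
    · obtain ⟨rfl, rfl⟩ : t = t' ∧ r = r' := by simpa [eqF] using h
      exact h'
    · simp [eqF, relF] at h
  · exact fun h => .inl ⟨t, r, ht, hr, rfl, h⟩

theorem atomicSat_rel {n R m ts s : V} (hR : App L.relAr R m) (hts : IsTermSeq L n m ts) :
    AtomicSat L M n (relF R ts) s ↔ ∃ ds : V, IsMap ds m M.dom ∧
      (∀ k t d : V, k ∈ m → App ts k t → App ds k d → TermVal L M n s t d) ∧ RelHolds M R ds := by
  constructor
  · rintro (⟨t', r', -, -, h, h'⟩ | ⟨R', m', ts', -, hts', h, h'⟩)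
    · simp [eqF, relF] at h
    · obtain ⟨rfl, rfl⟩ : R = R' ∧ ts = ts' := by simpa [relF] using h
      obtain rfl := hts.1.dom_eq hts'.1
      exact h'
  · exact fun h => .inr ⟨R, m, ts, hR, hts, rfl, h⟩

variable (L M) in
/-- The Tarski clauses for a relation `T` between formulas and assignments. -/
structure IsTruth (T : V → V → Prop) : Prop where
  atomic : ∀ n φ s, n ∈ (omega : V) → IsMap s n M.dom → IsAtomic L n φ →
    (T φ s ↔ AtomicSat L M n φ s)
  not : ∀ n φ s, n ∈ (omega : V) → IsMap s n M.dom → IsFormula L n φ → (T (notF φ) s ↔ ¬ T φ s)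
  and : ∀ n φ ψ s, n ∈ (omega : V) → IsMap s n M.dom → IsFormula L n φ → IsFormula L n ψ →
    (T (andF φ ψ) s ↔ T φ s ∧ T ψ s)
  ex : ∀ n φ s, n ∈ (omega : V) → IsMap s n M.dom → IsFormula L (succ n) φ →
    (T (exF φ) s ↔ ∃ d, d ∈ M.dom ∧ T φ (extend s n d))
  all : ∀ n φ s, n ∈ (omega : V) → IsMap s n M.dom → IsFormula L (succ n) φ →
    (T (allF φ) s ↔ ∀ d, d ∈ M.dom → T φ (extend s n d))

theorem isSatRelation_iff_isTruth {T : V} : IsSatRelation L M T ↔ IsTruth L M (App T) := by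
  constructor
  · intro h
    refine ⟨fun n φ s hn hs hφ => ?_, fun n φ s hn hs hφ => ?_, fun n φ ψ s hn hs hφ hψ => ?_,
      fun n φ s hn hs hφ => ?_, fun n φ s hn hs hφ => ?_⟩
    · rcases isAtomic_iff.1 hφ with ⟨t, r, ht, hr, rfl⟩ | ⟨R, m, ts, hR, hts, rfl⟩
      · rw [atomicSat_eq ht hr, h.eq n s _ t r (mem_omega.1 hn) hs ht hr (isEq_iff.2 rfl)]
      · rw [atomicSat_rel hR hts, h.rel n s _ R m ts (mem_omega.1 hn) hs hR hts (isRel_iff.2 rfl)]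
    · exact h.not n s φ _ (mem_omega.1 hn) hs hφ (isNot_iff.2 rfl)
    · exact h.and n s φ ψ _ (mem_omega.1 hn) hs hφ hψ (isAnd_iff.2 rfl)
    · rw [h.ex n s _ φ _ (mem_omega.1 hn) hs (isSucc_iff.2 rfl) hφ (isEx_iff.2 rfl)]
      simp [isExtend_iff]
    · rw [h.all n s _ φ _ (mem_omega.1 hn) hs (isSucc_iff.2 rfl) hφ (isAll_iff.2 rfl)]
      simp only [isExtend_iff]
      exact ⟨fun h d hd => h d _ hd rfl, fun h d _ hd e => e ▸ h d hd⟩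
  · intro h
    refine ⟨fun n s φ t r hn hs ht hr e => ?_, fun n s φ R m ts hn hs hR hts e => ?_,
      fun n s φ χ hn hs hφ e => ?_, fun n s φ ψ χ hn hs hφ hψ e => ?_,
      fun n s m φ χ hn hs hm hφ e => ?_, fun n s m φ χ hn hs hm hφ e => ?_⟩
    · rw [isEq_iff.1 e, h.atomic n _ s (mem_omega.2 hn) hs
        (isAtomic_iff.2 (.inl ⟨t, r, ht, hr, rfl⟩)), atomicSat_eq ht hr]
    · rw [isRel_iff.1 e, h.atomic n _ s (mem_omega.2 hn) hs
        (isAtomic_iff.2 (.inr ⟨R, m, ts, hR, hts, rfl⟩)), atomicSat_rel hR hts]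
    · rw [isNot_iff.1 e, h.not n φ s (mem_omega.2 hn) hs hφ]
    · rw [isAnd_iff.1 e, h.and n φ ψ s (mem_omega.2 hn) hs hφ hψ]
    · rw [isSucc_iff] at hm
      subst hm
      rw [isEx_iff.1 e, h.ex n φ s (mem_omega.2 hn) hs hφ]
      simp [isExtend_iff]
    · rw [isSucc_iff] at hm
      subst hm
      rw [isAll_iff.1 e, h.all n φ s (mem_omega.2 hn) hs hφ]
      simp only [isExtend_iff]
      exact ⟨fun h d _ hd e => e ▸ h d hd, fun h d hd => h d _ hd rfl⟩

/-- Definability of both relations is essential: on the possibly nonstandard formulas of `V` the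
Tarski clauses determine only those truth relations to which induction inside `V` applies. -/
theorem IsTruth.agree (hL : IsLang L) {T T' : V → V → Prop} (hT : IsTruth L M T)
    (hT' : IsTruth L M T') [dT : Dfn fun v : ℕ → V => T (v 0) (v 1)]
    [dT' : Dfn fun v : ℕ → V => T' (v 0) (v 1)] {n φ s : V} (hφ : IsFormula L n φ)
    (hs : IsMap s n M.dom) : T φ s ↔ T' φ s := by
  have := fun a b [ha : DFun a] [hb : DFun b] => dT.comp2 (a := a) (b := b) ha hb
  have := fun a b [ha : DFun a] [hb : DFun b] => dT'.comp2 (a := a) (b := b) ha hb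
  refine formula_induction hL (fun n φ => ∀ s, IsMap s n M.dom → (T φ s ↔ T' φ s))
    ?_ ?_ ?_ ?_ ?_ hφ s hs
  · intro n φ hn hφ s hs
    rw [hT.atomic n φ s hn hs hφ, hT'.atomic n φ s hn hs hφ]
  · intro n φ hn hφ ih s hs
    rw [hT.not n φ s hn hs hφ, hT'.not n φ s hn hs hφ, ih s hs]
  · intro n φ ψ hn hφ hψ ih ih' s hs
    rw [hT.and n φ ψ s hn hs hφ hψ, hT'.and n φ ψ s hn hs hφ hψ, ih s hs, ih' s hs]
  · intro n φ hn hφ ih s hs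
    rw [hT.ex n φ s hn hs hφ, hT'.ex n φ s hn hs hφ]
    exact exists_congr fun d => and_congr_right fun hd => ih _ (isMap_extend hs hd)
  · intro n φ hn hφ ih s hs
    rw [hT.all n φ s hn hs hφ, hT'.all n φ s hn hs hφ]
    exact forall_congr' fun d => imp_congr_right fun hd => ih _ (isMap_extend hs hd)

variable (L) in
/-- `(m, ψ)` is an immediate subformula of `(n, φ)`. -/
def IsSubformula (q p : V) : Prop := ∃ n φ ψ χ, p = pair n φ ∧
  ((φ = notF ψ ∧ q = pair n ψ) ∨ (φ = andF ψ χ ∧ (q = pair n ψ ∨ q = pair n χ)) ∨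
    ((φ = exF ψ ∨ φ = allF ψ) ∧ q = pair (succ n) ψ))

instance Dfn.isSubformula (a b : (ℕ → V) → V) [ha : DFun a] [hb : DFun b] :
    Dfn fun v => IsSubformula (a v) (b v) := by
  have := ha.shift; have := hb.shift
  unfold IsSubformula; infer_instance

/-- Without a minimal element in `Y`, induction on formulas shows that no formula lies in `Y`: each
one would have an immediate subformula in `Y`. -/
theorem subformula_wf (hL : IsLang L) (Y : V) (hY : ∃ y, y ∈ Y)
    (hYB : ∀ y, y ∈ Y → ∃ n φ, y = pair n φ ∧ IsFormula L n φ) :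
    ∃ y, y ∈ Y ∧ ∀ z, z ∈ Y → ¬ IsSubformula z y := by
  by_contra hmin
  push Not at hmin
  obtain ⟨y, hy⟩ := hY
  obtain ⟨n, φ, rfl, hφ⟩ := hYB y hy
  have hpred : ∀ {n φ}, pair n φ ∈ Y → ∃ q ψ χ, q ∈ Y ∧
      ((φ = notF ψ ∧ q = pair n ψ) ∨ (φ = andF ψ χ ∧ (q = pair n ψ ∨ q = pair n χ)) ∨
        ((φ = exF ψ ∨ φ = allF ψ) ∧ q = pair (succ n) ψ)) := by
    intro n φ h
    obtain ⟨q, hq, n', φ', ψ, χ, e, h'⟩ := hmin _ h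
    obtain ⟨rfl, rfl⟩ := pair_inj.1 e
    exact ⟨q, ψ, χ, hq, h'⟩
  refine formula_induction hL (fun n φ => ¬ pair n φ ∈ Y) ?_ ?_ ?_ ?_ ?_ hφ hy
  · intro n φ hn hφ h
    obtain ⟨q, ψ, χ, hq, h⟩ := hpred h
    rcases isAtomic_iff.1 hφ with ⟨t, r, -, -, rfl⟩ | ⟨R, m, ts, -, -, rfl⟩ <;>
      simp [eqF, relF, notF, andF, exF, allF] at h
  · intro n φ hn hφ ih h
    obtain ⟨q, ψ, χ, hq, h⟩ := hpred h
    obtain ⟨rfl, rfl⟩ : φ = ψ ∧ q = pair n ψ := by simpa [notF, andF, exF, allF] using h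
    exact ih hq
  · intro n φ ψ hn hφ hψ ih ih' h
    obtain ⟨q, ψ', χ', hq, h⟩ := hpred h
    obtain ⟨⟨rfl, rfl⟩, h⟩ : (φ = ψ' ∧ ψ = χ') ∧ (q = pair n ψ' ∨ q = pair n χ') := by
      simpa [notF, andF, exF, allF] using h
    rcases h with rfl | rfl
    exacts [ih hq, ih' hq]
  · intro n φ hn hφ ih h
    obtain ⟨q, ψ, χ, hq, h⟩ := hpred h
    obtain ⟨rfl, rfl⟩ : φ = ψ ∧ q = pair (succ n) ψ := by simpa [notF, andF, exF, allF] using h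
    exact ih hq
  · intro n φ hn hφ ih h
    obtain ⟨q, ψ, χ, hq, h⟩ := hpred h
    obtain ⟨rfl, rfl⟩ : φ = ψ ∧ q = pair (succ n) ψ := by simpa [notF, andF, exF, allF] using h
    exact ih hq

variable (L M) in
/-- The recursion step for the truth value of `(n, φ)` at `s`. -/
def TruthStep (g n φ s : V) : Prop :=
  AtomicSat L M n φ s ∨ (∃ ψ, φ = notF ψ ∧ ¬ s ∈ ap g (pair n ψ)) ∨
  (∃ ψ χ, φ = andF ψ χ ∧ s ∈ ap g (pair n ψ) ∧ s ∈ ap g (pair n χ)) ∨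
  (∃ ψ, φ = exF ψ ∧ ∃ d, d ∈ M.dom ∧ extend s n d ∈ ap g (pair (succ n) ψ)) ∨
  ∃ ψ, φ = allF ψ ∧ ∀ d, d ∈ M.dom → extend s n d ∈ ap g (pair (succ n) ψ)

instance Dfn.truthStep (M : (ℕ → V) → Str V) (a b c d : (ℕ → V) → V) [hM : DStr M] [ha : DFun a]
    [hb : DFun b] [hc : DFun c] [hd : DFun d] :
    Dfn fun v => TruthStep L (M v) (a v) (b v) (c v) (d v) := by
  have := ha.shift; have := hb.shift; have := hc.shift; have := hd.shift; have := hM.shift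
  unfold TruthStep; infer_instance

theorem not_atomicSat {n φ s : V} (h : ¬ IsAtomic L n φ) : ¬ AtomicSat L M n φ s := by
  rintro (⟨t, r, ht, hr, e, -⟩ | ⟨R, m, ts, hR, hts, e, -⟩)
  · exact h (isAtomic_iff.2 (.inl ⟨t, r, ht, hr, e⟩))
  · exact h (isAtomic_iff.2 (.inr ⟨R, m, ts, hR, hts, e⟩))

/-- The numeral tags `0` to `5` keep the kinds of formulas apart, so exactly one disjunct of
`TruthStep` is relevant for each kind. -/
theorem truthStep_atomic {g n φ s : V} (h : IsAtomic L n φ) :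
    TruthStep L M g n φ s ↔ AtomicSat L M n φ s := by
  refine ⟨fun h' => ?_, .inl⟩
  rcases h' with h' | h'
  · exact h'
  · rcases isAtomic_iff.1 h with ⟨t, r, -, -, rfl⟩ | ⟨R, m, ts, -, -, rfl⟩ <;>
      simp [eqF, relF, notF, andF, exF, allF] at h'

theorem truthStep_not {g n φ s : V} :
    TruthStep L M g n (notF φ) s ↔ ¬ s ∈ ap g (pair n φ) := by
  have : ¬ AtomicSat L M n (notF φ) s := not_atomicSat (by simp [isAtomic_iff, notF, eqF, relF])
  simp [TruthStep, this]
  simp [notF, andF, exF, allF]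

theorem truthStep_and {g n φ ψ s : V} : TruthStep L M g n (andF φ ψ) s ↔
    s ∈ ap g (pair n φ) ∧ s ∈ ap g (pair n ψ) := by
  have : ¬ AtomicSat L M n (andF φ ψ) s := not_atomicSat (by simp [isAtomic_iff, andF, eqF, relF])
  simp [TruthStep, this]
  simp [notF, andF, exF, allF]

theorem truthStep_ex {g n φ s : V} : TruthStep L M g n (exF φ) s ↔
    ∃ d, d ∈ M.dom ∧ extend s n d ∈ ap g (pair (succ n) φ) := by
  have : ¬ AtomicSat L M n (exF φ) s := not_atomicSat (by simp [isAtomic_iff, exF, eqF, relF])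
  simp [TruthStep, this]
  simp [notF, andF, exF, allF]

theorem truthStep_all {g n φ s : V} : TruthStep L M g n (allF φ) s ↔
    ∀ d, d ∈ M.dom → extend s n d ∈ ap g (pair (succ n) φ) := by
  have : ¬ AtomicSat L M n (allF φ) s := not_atomicSat (by simp [isAtomic_iff, allF, eqF, relF])
  simp [TruthStep, this]
  simp [notF, andF, exF, allF]

theorem mem_pow_of_isMap {n s D : V} (hn : n ∈ (omega : V)) (hs : IsMap s n D) :
    s ∈ pow (prod omega D) := by
  rw [mem_pow]
  intro p hp
  obtain ⟨k, hk, rfl⟩ := hs.1.mem_iff.1 hp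
  exact pair_mem_prod.2 ⟨mem_omega_of_mem hn hk, hs.ap_mem hk⟩

/-- Recursion on pairs (context, formula) along the subformula relation. The value at `(n, φ)` is
the set of assignments `n → M` satisfying `φ`; taking whole sets of assignments as values lets the
quantifier steps consult extended assignments. -/
theorem exists_isTruth (hL : IsLang L) (M : Str V) : ∃ T, IsTruth L M (App T) := by
  let B := sep (prod omega (hull L)) fun p => ∃ n φ, p = pair n φ ∧ IsFormula L n φ
  have hB : ∀ {n φ}, IsFormula L n φ → pair n φ ∈ B := fun {n φ} h =>
    mem_sep.2 ⟨pair_mem_prod.2 (h.mem hL), n, φ, rfl, h⟩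
  have hG : DFun fun v : ℕ → V => sep (pow (prod omega M.dom)) fun s => ∃ n φ, v 0 = pair n φ ∧
      IsMap s n M.dom ∧ TruthStep L M (v 1) n φ s := inferInstance
  obtain ⟨f, -, hf⟩ := exists_recursion (B := B) (lt := IsSubformula)
    (G := fun p g => sep (pow (prod omega M.dom)) fun s => ∃ n φ, p = pair n φ ∧ IsMap s n M.dom ∧
      TruthStep L M g n φ s) (hG := hG)
    fun Y hY hYB => subformula_wf hL Y hY fun y hy => (mem_sep.1 (hYB y hy)).2
  have key : ∀ n φ s, IsFormula L n φ → IsMap s n M.dom → (s ∈ ap f (pair n φ) ↔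
      TruthStep L M (restrPred B IsSubformula f (pair n φ)) n φ s) := by
    intro n φ s hφ hs
    rw [hf _ (hB hφ), mem_sep]
    constructor
    · rintro ⟨-, n', φ', e, -, h⟩
      obtain ⟨rfl, rfl⟩ := pair_inj.1 e
      exact h
    · exact fun h => ⟨mem_pow_of_isMap (hφ.mem hL).1 hs, n, φ, rfl, hs, h⟩
  -- The context is no part of a pair `(φ, s)`, but it can be recovered as the domain of `s`.
  let T := sep (prod (hull L) (pow (prod omega M.dom))) fun p =>
    ∃ n φ s, p = pair φ s ∧ IsMap s n M.dom ∧ s ∈ ap f (pair n φ)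
  have hT : ∀ {n φ s}, IsFormula L n φ → IsMap s n M.dom → (App T φ s ↔ s ∈ ap f (pair n φ)) := by
    intro n φ s hφ hs
    rw [app_iff, mem_sep]
    constructor
    · rintro ⟨-, n', φ', s', e, hs', h⟩
      obtain ⟨rfl, rfl⟩ := pair_inj.1 e
      obtain rfl := hs.1.dom_eq hs'.1
      exact h
    · exact fun h => ⟨pair_mem_prod.2 ⟨(hφ.mem hL).2, mem_pow_of_isMap (hφ.mem hL).1 hs⟩,
        n, φ, s, rfl, hs, h⟩
  refine ⟨T, fun n φ s hn hs hφ => ?_, fun n φ s hn hs hφ => ?_, fun n φ ψ s hn hs hφ hψ => ?_,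
    fun n φ s hn hs hφ => ?_, fun n φ s hn hs hφ => ?_⟩
  · have hF := isFormula_atomic hn hφ
    rw [hT hF hs, key n φ s hF hs, truthStep_atomic hφ]
  · have hF := isFormula_not hn hφ
    rw [hT hF hs, key n _ s hF hs, truthStep_not, hT hφ hs, ap_restrPred (hB hφ)]
    exact ⟨n, _, φ, φ, rfl, .inl ⟨rfl, rfl⟩⟩
  · have hF := isFormula_and hn hφ hψ
    rw [hT hF hs, key n _ s hF hs, truthStep_and, hT hφ hs, hT hψ hs, ap_restrPred (hB hφ),
      ap_restrPred (hB hψ)]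
    · exact ⟨n, _, φ, ψ, rfl, .inr (.inl ⟨rfl, .inr rfl⟩)⟩
    · exact ⟨n, _, φ, ψ, rfl, .inr (.inl ⟨rfl, .inl rfl⟩)⟩
  · have hF := isFormula_ex hn hφ
    rw [hT hF hs, key n _ s hF hs, truthStep_ex, ap_restrPred (hB hφ)]
    · exact exists_congr fun d => and_congr_right fun hd => (hT hφ (isMap_extend hs hd)).symm
    · exact ⟨n, _, φ, φ, rfl, .inr (.inr ⟨.inl rfl, rfl⟩)⟩
  · have hF := isFormula_all hn hφ
    rw [hT hF hs, key n _ s hF hs, truthStep_all, ap_restrPred (hB hφ)]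
    · exact forall_congr' fun d => imp_congr_right fun hd => (hT hφ (isMap_extend hs hd)).symm
    · exact ⟨n, _, φ, φ, rfl, .inr (.inr ⟨.inr rfl, rfl⟩)⟩

/-- `Sat` asks for some satisfaction relation. One exists, and any two agree, so it may be replaced
by any definable truth relation. -/
theorem IsTruth.sat_iff (hL : IsLang L) {T : V → V → Prop} (hT : IsTruth L M T)
    [dT : Dfn fun v : ℕ → V => T (v 0) (v 1)] {n φ s : V} (hφ : IsFormula L n φ)
    (hs : IsMap s n M.dom) : Sat L M φ s ↔ T φ s := by
  constructor
  · rintro ⟨T', hT', h⟩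
    exact ((isSatRelation_iff_isTruth.1 hT').agree hL hT hφ hs).1 h
  · intro h
    obtain ⟨T', hT'⟩ := exists_isTruth hL M
    exact ⟨T', isSatRelation_iff_isTruth.2 hT', (hT'.agree hL hT hφ hs).2 h⟩

theorem isTruth_sat (hL : IsLang L) (M : Str V) : IsTruth L M (Sat L M) := by
  obtain ⟨T, hT⟩ := exists_isTruth hL M
  have key : ∀ {n φ s}, IsFormula L n φ → IsMap s n M.dom → (Sat L M φ s ↔ App T φ s) :=
    fun hφ hs => hT.sat_iff hL hφ hs
  refine ⟨fun n φ s hn hs hφ => ?_, fun n φ s hn hs hφ => ?_, fun n φ ψ s hn hs hφ hψ => ?_,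
    fun n φ s hn hs hφ => ?_, fun n φ s hn hs hφ => ?_⟩
  · rw [key (isFormula_atomic hn hφ) hs, hT.atomic n φ s hn hs hφ]
  · rw [key (isFormula_not hn hφ) hs, key hφ hs, hT.not n φ s hn hs hφ]
  · rw [key (isFormula_and hn hφ hψ) hs, key hφ hs, key hψ hs, hT.and n φ ψ s hn hs hφ hψ]
  · rw [key (isFormula_ex hn hφ) hs, hT.ex n φ s hn hs hφ]
    exact exists_congr fun d => and_congr_right fun hd => (key hφ (isMap_extend hs hd)).symm
  · rw [key (isFormula_all hn hφ) hs, hT.all n φ s hn hs hφ]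
    exact forall_congr' fun d => imp_congr_right fun hd => (key hφ (isMap_extend hs hd)).symm

theorem sat_eq (hL : IsLang L) (hM : IsStr L M) {n t r s : V} (hn : n ∈ (omega : V))
    (hs : IsMap s n M.dom) (ht : IsTerm L n t) (hr : IsTerm L n r) :
    Sat L M (eqF t r) s ↔ tv L M n s t = tv L M n s r := by
  rw [(isTruth_sat hL M).atomic n _ s hn hs (isAtomic_iff.2 (.inl ⟨t, r, ht, hr, rfl⟩)),
    atomicSat_eq ht hr]
  simp only [termVal_iff hL hM hn hs ht, termVal_iff hL hM hn hs hr]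
  exact ⟨fun ⟨d, h, h'⟩ => h ▸ h', fun h => ⟨_, rfl, h⟩⟩

theorem sat_rel (hL : IsLang L) (hM : IsStr L M) {n R m ts s : V} (hn : n ∈ (omega : V))
    (hs : IsMap s n M.dom) (hR : App L.relAr R m) (hts : IsTermSeq L n m ts) :
    Sat L M (relF R ts) s ↔ RelHolds M R (mkFun m fun k => tv L M n s (ap ts k)) := by
  have hts' := (isTermSeq_iff.1 hts).2
  rw [(isTruth_sat hL M).atomic n _ s hn hs (isAtomic_iff.2 (.inr ⟨R, m, ts, hR, hts, rfl⟩)),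
    atomicSat_rel hR hts]
  constructor
  · rintro ⟨ds, hds, h, hR⟩
    convert hR
    refine isFun_mkFun.ext hds.1 fun k hk => ?_
    rw [ap_mkFun hk, ← (termVal_iff hL hM hn hs (hts' k hk)).1
      (h k _ _ hk (hts.1.app hk) (hds.1.app hk))]
  · refine fun h => ⟨_, isMap_tv hL hM hn hs hts, fun k t d hk ht hd => ?_, h⟩
    obtain ⟨-, rfl⟩ := hts.1.app_iff.1 ht
    obtain ⟨-, rfl⟩ := app_mkFun.1 hd
    exact (termVal_iff hL hM hn hs (hts' k hk)).2 rfl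

/-! ### Back-and-forth -/

/-- If atomic formulas are invariant under a relation between assignments with the back-and-forth
property, then so are all formulas. -/
theorem sat_iff_of_backAndForth (hL : IsLang L) {M N : Str V} (E : V → V → V → Prop)
    [hE : Dfn fun v : ℕ → V => E (v 0) (v 1) (v 2)]
    (hmap : ∀ n s s', E n s s' → IsMap s n M.dom ∧ IsMap s' n N.dom)
    (hatomic : ∀ n φ s s', n ∈ (omega : V) → IsAtomic L n φ → E n s s' →
      (Sat L M φ s ↔ Sat L N φ s'))
    (forth : ∀ n s s' d, n ∈ (omega : V) → E n s s' → d ∈ M.dom →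
      ∃ d', d' ∈ N.dom ∧ E (succ n) (extend s n d) (extend s' n d'))
    (back : ∀ n s s' d', n ∈ (omega : V) → E n s s' → d' ∈ N.dom →
      ∃ d, d ∈ M.dom ∧ E (succ n) (extend s n d) (extend s' n d'))
    {n φ s s' : V} (hφ : IsFormula L n φ) (h : E n s s') : Sat L M φ s ↔ Sat L N φ s' := by
  have : Dfn fun v : ℕ → V => E (InternalZF.tail (InternalZF.tail v) 0) (InternalZF.tail v 0) (v 0) :=
    hE.reindex fun | 0 => 2 | 1 => 1 | _ => 0
  have hM := isTruth_sat hL M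
  have hN := isTruth_sat hL N
  refine formula_induction hL (fun n φ => ∀ s s', E n s s' → (Sat L M φ s ↔ Sat L N φ s'))
    ?_ ?_ ?_ ?_ ?_ hφ s s' h
  · exact fun n φ hn hφ s s' h => hatomic n φ s s' hn hφ h
  · intro n φ hn hφ ih s s' h
    obtain ⟨hs, hs'⟩ := hmap n s s' h
    rw [hM.not n φ s hn hs hφ, hN.not n φ s' hn hs' hφ, ih s s' h]
  · intro n φ ψ hn hφ hψ ih ih' s s' h
    obtain ⟨hs, hs'⟩ := hmap n s s' h
    rw [hM.and n φ ψ s hn hs hφ hψ, hN.and n φ ψ s' hn hs' hφ hψ, ih s s' h, ih' s s' h]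
  · intro n φ hn hφ ih s s' h
    obtain ⟨hs, hs'⟩ := hmap n s s' h
    rw [hM.ex n φ s hn hs hφ, hN.ex n φ s' hn hs' hφ]
    constructor
    · rintro ⟨d, hd, hd'⟩
      obtain ⟨d', hd'N, he⟩ := forth n s s' d hn h hd
      exact ⟨d', hd'N, (ih _ _ he).1 hd'⟩
    · rintro ⟨d, hd, hd'⟩
      obtain ⟨d', hd'N, he⟩ := back n s s' d hn h hd
      exact ⟨d', hd'N, (ih _ _ he).2 hd'⟩
  · intro n φ hn hφ ih s s' h
    obtain ⟨hs, hs'⟩ := hmap n s s' h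
    rw [hM.all n φ s hn hs hφ, hN.all n φ s' hn hs' hφ]
    constructor
    · intro hall d hd
      obtain ⟨d', hd'N, he⟩ := back n s s' d hn h hd
      exact (ih _ _ he).1 (hall d' hd'N)
    · intro hall d hd
      obtain ⟨d', hd'N, he⟩ := forth n s s' d hn h hd
      exact (ih _ _ he).2 (hall d' hd'N)

/-! ### Sentences -/

theorem models_iff {σ : V} : Models L M σ ↔ Sat L M σ emp := by
  simp [Models, isEmptySet_iff]

theorem isMap_emp {D : V} : IsMap emp emp D :=
  ⟨⟨fun p hp => (notMem_emp p hp).elim, fun p hp => (notMem_emp p hp).elim⟩,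
    fun _ _ h => (notMem_emp _ (app_iff.1 h)).elim⟩

theorem isFormula_of_isQF {n φ : V} (hn : n ∈ (omega : V)) (h : IsQF L n φ) : IsFormula L n φ := by
  intro Z hZ
  have hZ' := formulaClosed_iff'.1 hZ
  -- The section of `Z` at `n` is a set: from `(n, φ) = {{n}, {n, φ}}` it follows that `φ ∈ ⋃⋃Z`.
  have hX : ∀ {φ}, φ ∈ sep (sUnion (sUnion Z)) (fun φ => pair n φ ∈ Z) ↔ pair n φ ∈ Z := by
    intro φ
    rw [mem_sep, and_iff_right_iff_imp]
    exact fun h => mem_sUnion.2 ⟨upair n φ, mem_sUnion.2 ⟨_, h, by simp [pair]⟩, by simp⟩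
  refine app_iff.2 (hX.1 (h _ ⟨fun φ hφ => hX.2 (hZ'.1 n φ hn hφ), fun φ χ hφ e => ?_,
    fun φ ψ χ hφ hψ e => ?_⟩))
  · rw [isNot_iff.1 e]; exact hX.2 (hZ'.2.1 n φ hn (hX.1 hφ))
  · rw [isAnd_iff.1 e]; exact hX.2 (hZ'.2.2.1 n φ ψ hn (hX.1 hφ) (hX.1 hψ))

theorem isFormula_of_inHierarchy {k : ℕ} {b : Bool} {n φ : V} (hn : n ∈ (omega : V))
    (h : InHierarchy L k b n φ) : IsFormula L n φ := by
  induction k generalizing b n φ with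
  | zero => cases b <;> exact isFormula_of_isQF hn h
  | succ k ih =>
    cases b
    · exact fun Z hZ => h Z (fun k ψ hk hψ => ih (mem_omega.2 hk) hψ Z hZ) hZ.all
    · exact fun Z hZ => h Z (fun k ψ hk hψ => ih (mem_omega.2 hk) hψ Z hZ) hZ.ex

/-- Where `SigmaEquiv` is derived from Łoś's theorem, from an isomorphism or from an elementary
embedding, all sentences are preserved; this lemma forgets the complexity. -/
theorem sigmaEquiv_of_sat_iff {k : ℕ} {M N : Str V}
    (h : ∀ σ, IsFormula L emp σ → (Sat L M σ emp ↔ Sat L N σ emp)) : SigmaEquiv L k M N := by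
  intro z σ hz hσ
  rw [isEmptySet_iff] at hz
  subst hz
  rw [models_iff, models_iff]
  exact h σ (isFormula_of_inHierarchy emp_mem_omega hσ)

/-! ### Isomorphisms preserve truth -/

/-- Back-and-forth with the relation `s' = h ∘ s`. Injectivity of `h` handles equations,
surjectivity the back condition. -/
theorem IsIso.sat_iff (hL : IsLang L) {M N : Str V} (hM : IsStr L M) (hN : IsStr L N) {h : V}
    (hh : IsIso L M N h) {n φ s s' : V} (hφ : IsFormula L n φ) (hs : IsMap s n M.dom)
    (hs' : IsMap s' n N.dom) (he : ∀ k, k ∈ n → ap s' k = ap h (ap s k)) :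
    Sat L M φ s ↔ Sat L N φ s' := by
  have himg : ∀ {n s s'}, IsMap s n M.dom → IsMap s' n N.dom →
      (∀ k, k ∈ n → ap s' k = ap h (ap s k)) → IsImageSeq h n s s' := fun hs hs' he =>
    (isImageSeq_iff hs.1 hs'.1).2 fun k hk => by rw [he k hk]; exact hh.map.1.app (hs.ap_mem hk)
  have hterm : ∀ {n s s'}, n ∈ (omega : V) → IsMap s n M.dom → IsMap s' n N.dom →
      (∀ k, k ∈ n → ap s' k = ap h (ap s k)) → ∀ t, IsTerm L n t →
      tv L N n s' t = ap h (tv L M n s t) := by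
    intro n s s' hn hs hs' he t ht
    refine tv_eq_of_rec hL hN hn hs' (fun t => ap h (tv L M n s t)) ?_ ?_ ht
    · exact fun k hk => by rw [tv_var hL hM hn hs hk, he k hk]
    · intro f m ts hf hts ih
      have hm1 := isMap_tv hL hM hn hs hts
      have hm2 : IsMap (mkFun m fun k => ap h (tv L M n s (ap ts k))) m N.dom :=
        isMap_mkFun fun k hk => hh.map.ap_mem (tv_mem hL hM hn hs ((isTermSeq_iff.1 hts).2 k hk))
      rw [tv_fn hL hM hn hs hf hts]
      refine hh.map.1.ap_eq (hh.fn f m _ _ _ _ hf hm1 hm2 (himg hm1 hm2 fun k hk => ?_)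
        ((hM.fnVal_iff hf hm1).2 rfl) ((hN.fnVal_iff hf hm2).2 rfl))
      rw [ap_mkFun hk, ap_mkFun hk]
  have hinj : ∀ {x y}, x ∈ M.dom → y ∈ M.dom → ap h x = ap h y → x = y := fun hx hy e =>
    (hh.bijective _ (hh.map.ap_mem hx)).unique (hh.map.1.app hx) (e ▸ hh.map.1.app hy)
  refine sat_iff_of_backAndForth hL (fun n s s' => IsMap s n M.dom ∧ IsMap s' n N.dom ∧
    ∀ k, k ∈ n → ap s' k = ap h (ap s k)) (fun n s s' h => ⟨h.1, h.2.1⟩) ?_ ?_ ?_ hφ ⟨hs, hs', he⟩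
  · rintro n φ s s' hn hφ ⟨hs, hs', he⟩
    rcases isAtomic_iff.1 hφ with ⟨t, r, ht, hr, rfl⟩ | ⟨R, m, ts, hR, hts, rfl⟩
    · rw [sat_eq hL hM hn hs ht hr, sat_eq hL hN hn hs' ht hr, hterm hn hs hs' he t ht,
        hterm hn hs hs' he r hr]
      exact ⟨fun e => by rw [e], hinj (tv_mem hL hM hn hs ht) (tv_mem hL hM hn hs hr)⟩
    · rw [sat_rel hL hM hn hs hR hts, sat_rel hL hN hn hs' hR hts]
      have hm1 := isMap_tv hL hM hn hs hts
      have hm2 := isMap_tv hL hN hn hs' hts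
      refine hh.rel R m _ _ hR hm1 hm2 (himg hm1 hm2 fun k hk => ?_)
      rw [ap_mkFun hk, ap_mkFun hk, hterm hn hs hs' he _ ((isTermSeq_iff.1 hts).2 k hk)]
  · have key : ∀ {n s s' d}, IsMap s n M.dom → IsMap s' n N.dom →
        (∀ k, k ∈ n → ap s' k = ap h (ap s k)) → d ∈ M.dom →
        IsMap (extend s n d) (succ n) M.dom ∧ IsMap (extend s' n (ap h d)) (succ n) N.dom ∧
        ∀ k, k ∈ succ n → ap (extend s' n (ap h d)) k = ap h (ap (extend s n d) k) := by
      intro n s s' d hs hs' he hd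
      refine ⟨isMap_extend hs hd, isMap_extend hs' (hh.map.ap_mem hd), fun k hk => ?_⟩
      rcases mem_succ.1 hk with hk | rfl
      · rw [ap_extend_of_mem hs.1 hk, ap_extend_of_mem hs'.1 hk, he k hk]
      · rw [ap_extend_self hs.1, ap_extend_self hs'.1]
    rintro n s s' d hn ⟨hs, hs', he⟩ hd
    exact ⟨ap h d, hh.map.ap_mem hd, key hs hs' he hd⟩
  · rintro n s s' d' hn ⟨hs, hs', he⟩ hd'
    obtain ⟨d, hd, -⟩ := hh.bijective d' hd'
    obtain ⟨hdM, rfl⟩ := hh.map.1.app_iff.1 hd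
    refine ⟨d, hdM, isMap_extend hs hdM, isMap_extend hs' hd', fun k hk => ?_⟩
    rcases mem_succ.1 hk with hk | rfl
    · rw [ap_extend_of_mem hs.1 hk, ap_extend_of_mem hs'.1 hk, he k hk]
    · rw [ap_extend_self hs.1, ap_extend_self hs'.1]

theorem Isomorphic.sat_iff (hL : IsLang L) {M N : Str V} (hM : IsStr L M) (hN : IsStr L N)
    (h : Isomorphic L M N) {σ : V} (hσ : IsFormula L emp σ) : Sat L M σ emp ↔ Sat L N σ emp :=
  h.elim fun _ hh => hh.sat_iff hL hM hN hσ isMap_emp isMap_emp fun k hk => (notMem_emp k hk).elim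

end Satisfaction

end InternalZF

/-! ### Ultraproducts and Łoś's theorem. -/

namespace InternalZF

section Ultraproducts

set_option linter.unusedSectionVars false
set_option synthInstance.maxHeartbeats 400000
set_option synthInstance.maxSize 5000

variable {V : Type u} [Membership V V] [hV : ZFModel V] {L : Lang V} {I U : V}

/-! ### Large sets of indices -/

theorem large_iff {Q : V → Prop} [Dfn fun v : ℕ → V => Q (v 0)] :
    Large U I Q ↔ sep I Q ∈ U := by
  constructor
  · rintro ⟨X, hX, hX'⟩
    have : X = sep I Q := ext_mem fun z => by rw [hX' z, mem_sep]
    exact this ▸ hX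
  · exact fun h => ⟨_, h, fun i => mem_sep⟩

section Large

variable {Q R : V → Prop} [dQ : Dfn fun v : ℕ → V => Q (v 0)] [dR : Dfn fun v : ℕ → V => R (v 0)]
  (hU : IsUltrafilter U I)
include hU

theorem Large.mono (h : Large U I Q) (hQR : ∀ i, i ∈ I → Q i → R i) : Large U I R := by
  rw [large_iff] at h ⊢
  refine hU.superset _ _ h (fun i hi => ?_) fun i hi => (mem_sep.1 hi).1
  rw [mem_sep] at hi ⊢
  exact ⟨hi.1, hQR i hi.1 hi.2⟩

theorem Large.and (h : Large U I Q) (h' : Large U I R) : Large U I fun i => Q i ∧ R i := by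
  rw [large_iff] at h h'
  have := fun a [ha : DFun a] => dQ.comp1 (a := a) ha
  have := fun a [ha : DFun a] => dR.comp1 (a := a) ha
  rw [large_iff]
  refine hU.inter _ _ _ h h' fun i => ?_
  simp only [mem_sep]
  tauto

theorem large_of_forall (h : ∀ i, i ∈ I → Q i) : Large U I Q := by
  rw [large_iff]
  have : sep I Q = I := ext_mem fun i => by rw [mem_sep, and_iff_left_iff_imp]; exact h i
  rw [this]
  exact hU.univ_mem

theorem Large.exists (h : Large U I Q) : ∃ i, i ∈ I ∧ Q i := by
  by_contra hne
  push Not at hne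
  rw [large_iff] at h
  exact hU.empty_notMem _ (fun i hi => hne i (mem_sep.1 hi).1 (mem_sep.1 hi).2) h

theorem large_not : Large U I (fun i => ¬ Q i) ↔ ¬ Large U I Q := by
  have := fun a [ha : DFun a] => dQ.comp1 (a := a) ha
  constructor
  · intro h h'
    obtain ⟨i, -, hi, hi'⟩ := (h.and hU h').exists hU
    exact hi hi'
  · intro h
    rw [large_iff] at h ⊢
    refine (hU.ultra _ _ (fun i hi => (mem_sep.1 hi).1) fun i => ?_).resolve_left h
    simp only [mem_sep]
    tauto

theorem large_congr (h : ∀ i, i ∈ I → (Q i ↔ R i)) : Large U I Q ↔ Large U I R :=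
  ⟨fun h' => h'.mono hU fun i hi => (h i hi).1, fun h' => h'.mono hU fun i hi => (h i hi).2⟩

theorem large_and_iff : (Large U I fun i => Q i ∧ R i) ↔ Large U I Q ∧ Large U I R := by
  have := fun a [ha : DFun a] => dQ.comp1 (a := a) ha
  have := fun a [ha : DFun a] => dR.comp1 (a := a) ha
  exact ⟨fun h => ⟨h.mono hU fun _ _ h => h.1, h.mono hU fun _ _ h => h.2⟩,
    fun h => h.1.and hU h.2⟩

end Large

/-- Closure of `U` under intersections of finitely many sets, with finiteness in the sense of `V`:
hence an induction inside `V`. -/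
theorem large_forall_mem (hU : IsUltrafilter U I) {Q : V → V → Prop}
    [dQ : Dfn fun v : ℕ → V => Q (v 0) (v 1)] {n : V} (hn : n ∈ (omega : V))
    (h : ∀ k, k ∈ n → Large U I (Q k)) : Large U I fun i => ∀ k, k ∈ n → Q k i := by
  have := fun a b [ha : DFun a] [hb : DFun b] => dQ.comp2 (a := a) (b := b) ha hb
  refine nat_induction (fun n => (∀ k, k ∈ n → Large U I (Q k)) →
    Large U I fun i => ∀ k, k ∈ n → Q k i) ?_ ?_ hn h
  · exact fun _ => large_of_forall hU fun i _ k hk => (notMem_emp k hk).elim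
  · intro n hn ih h
    refine ((ih fun k hk => h k (mem_succ.2 (.inl hk))).and hU (h n (by simp))).mono hU ?_
    rintro i - ⟨h1, h2⟩ k hk
    rcases mem_succ.1 hk with hk | rfl
    exacts [h1 k hk, h2]

/-! ### Families and products -/

/-- The member of the family with index `i`. -/
noncomputable def Fam.str (F : Fam V) (i : V) : Str V := ⟨ap F.dom i, ap F.fn i, ap F.rel i⟩

instance DStr.famStr (F : Fam V) (a : (ℕ → V) → V) [ha : DFun a] : DStr fun v => F.str (a v) := by
  unfold Fam.str; infer_instance

variable {F : Fam V}

theorem IsFam.at_iff (hF : IsFam L I F) {i : V} {M : Str V} :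
    F.At i M ↔ i ∈ I ∧ M = F.str i := by
  unfold Fam.At Fam.str
  rw [hF.dom.app_iff, hF.fn.app_iff, hF.rel.app_iff, Str.ext_iff]
  tauto

theorem IsFam.isStr_str (hF : IsFam L I F) {i : V} (hi : i ∈ I) : IsStr L (F.str i) :=
  hF.isStr i _ (hF.at_iff.2 ⟨hi, rfl⟩)

theorem IsFam.inProd_iff (hF : IsFam L I F) {g : V} :
    InProd I F g ↔ IsFun g I ∧ ∀ i, i ∈ I → ap g i ∈ (F.str i).dom := by
  refine and_congr_right fun hg => ⟨fun h i hi => h i _ _ (hg.app hi) (hF.dom.app hi), ?_⟩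
  intro h i x D hx hD
  obtain ⟨hi, rfl⟩ := hg.app_iff.1 hx
  obtain ⟨-, rfl⟩ := hF.dom.app_iff.1 hD
  exact h i hi

/-- The product of the domains of a family. -/
noncomputable def prodSet (I : V) (F : Fam V) : V :=
  sep (pow (prod I (sUnion (img I fun i => ap F.dom i)))) fun g => InProd I F g

theorem IsFam.mem_prodSet (hF : IsFam L I F) {g : V} : g ∈ prodSet I F ↔ InProd I F g := by
  rw [prodSet, mem_sep, and_iff_right_iff_imp]
  intro hg
  rw [mem_pow]
  intro p hp
  obtain ⟨i, hi, rfl⟩ := hg.1.mem_iff.1 hp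
  exact pair_mem_prod.2 ⟨hi, mem_sUnion.2 ⟨_, mem_img.2 ⟨i, hi, rfl⟩, (hF.inProd_iff.1 hg).2 i hi⟩⟩

theorem IsFam.mem_prodSet_iff (hF : IsFam L I F) {g : V} :
    g ∈ prodSet I F ↔ IsFun g I ∧ ∀ i, i ∈ I → ap g i ∈ (F.str i).dom :=
  hF.mem_prodSet.trans hF.inProd_iff

/-- `[g]`. -/
noncomputable def cls (I U : V) (F : Fam V) (g : V) : V :=
  sep (prodSet I F) fun h => Large U I fun i => ap g i = ap h i

/-- `([g_k])_{k < n}`. -/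
noncomputable def clsSeq (I U : V) (F : Fam V) (n gs : V) : V := mkFun n fun k => cls I U F (ap gs k)

/-- `(g_k(i))_{k < n}`. -/
noncomputable def ev (n gs i : V) : V := mkFun n fun k => ap (ap gs k) i

section DFun

variable (a b c : (ℕ → V) → V) [ha : DFun a] [hb : DFun b] [hc : DFun c]

instance DFun.cls : DFun fun v => InternalZF.cls I U F (a v) := by
  have := ha.shift
  unfold InternalZF.cls; infer_instance

instance DFun.clsSeq : DFun fun v => InternalZF.clsSeq I U F (a v) (b v) := by
  have := ha.shift; have := hb.shift
  unfold InternalZF.clsSeq; infer_instance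

instance DFun.ev : DFun fun v => InternalZF.ev (a v) (b v) (c v) := by
  have := ha.shift; have := hb.shift; have := hc.shift
  unfold InternalZF.ev; infer_instance

end DFun

theorem large_app_iff (hU : IsUltrafilter U I) {g h : V} (hg : IsFun g I) (hh : IsFun h I) :
    (Large U I fun i => ∃ x, App g i x ∧ App h i x) ↔ Large U I fun i => ap g i = ap h i := by
  refine large_congr hU fun i hi => ?_
  simp [hg.app_iff, hh.app_iff, hi]

theorem IsFam.isClassOf_iff (hU : IsUltrafilter U I) (hF : IsFam L I F) {c g : V}
    (hg : g ∈ prodSet I F) : IsClassOf I U F c g ↔ c = cls I U F g := by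
  have hg' := (hF.mem_prodSet_iff.1 hg).1
  have key : ∀ h, (InProd I F h ∧ Large U I fun i => ∃ x, App g i x ∧ App h i x) ↔
      h ∈ cls I U F g := by
    intro h
    rw [cls, mem_sep, hF.mem_prodSet]
    exact and_congr_right fun hh => large_app_iff hU hg' hh.1
  unfold IsClassOf
  simp only [key]
  exact ⟨fun h => ext_mem h, fun h x => by rw [h]⟩

theorem mem_cls_self (hU : IsUltrafilter U I) {g : V} (hg : g ∈ prodSet I F) :
    g ∈ cls I U F g :=
  mem_sep.2 ⟨hg, large_of_forall hU fun _ _ => rfl⟩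

theorem cls_eq_iff (hU : IsUltrafilter U I) {g h : V} (hh : h ∈ prodSet I F) :
    cls I U F g = cls I U F h ↔ Large U I fun i => ap g i = ap h i := by
  constructor
  · intro e
    have := mem_cls_self hU hh
    rw [← e] at this
    exact (mem_sep.1 this).2
  · intro h'
    refine ext_mem fun k => ?_
    simp only [cls, mem_sep]
    refine and_congr_right fun _ => ⟨fun h'' => ?_, fun h'' => ?_⟩
    · exact (h'.and hU h'').mono hU fun i _ ⟨h1, h2⟩ => h1 ▸ h2
    · exact (h'.and hU h'').mono hU fun i _ ⟨h1, h2⟩ => h1.trans h2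

theorem isMap_clsSeq {n gs : V} {D : V} (h : ∀ k, k ∈ n → cls I U F (ap gs k) ∈ D) :
    IsMap (clsSeq I U F n gs) n D := isMap_mkFun h

theorem isFun_clsSeq {n gs : V} : IsFun (clsSeq I U F n gs) n := isFun_mkFun

theorem ap_clsSeq {n gs k : V} (hk : k ∈ n) : ap (clsSeq I U F n gs) k = cls I U F (ap gs k) :=
  ap_mkFun hk

theorem isFun_ev {n gs i : V} : IsFun (ev n gs i) n := isFun_mkFun

theorem ap_ev {n gs i k : V} (hk : k ∈ n) : ap (ev n gs i) k = ap (ap gs k) i := ap_mkFun hk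

theorem IsFam.isMap_ev (hF : IsFam L I F) {n gs i : V} (hgs : IsMap gs n (prodSet I F))
    (hi : i ∈ I) : IsMap (ev n gs i) n (F.str i).dom :=
  isMap_mkFun fun _ hk => (hF.mem_prodSet_iff.1 (hgs.ap_mem hk)).2 i hi

theorem IsFam.isEvalAt_iff (hF : IsFam L I F) {n gs i t : V} (hgs : IsMap gs n (prodSet I F))
    (hi : i ∈ I) : IsEvalAt n gs i t ↔ t = ev n gs i := by
  constructor
  · rintro ⟨ht, h⟩
    refine ht.ext isFun_ev fun k hk => ?_
    rw [ap_ev hk, (hF.mem_prodSet_iff.1 (hgs.ap_mem hk)).1.ap_eq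
      (h k _ _ (hgs.1.app hk) (ht.app hk))]
  · rintro rfl
    refine ⟨isFun_ev, fun k g x hg hx => ?_⟩
    obtain ⟨hk, rfl⟩ := hgs.1.app_iff.1 hg
    obtain ⟨-, rfl⟩ := isFun_ev.app_iff.1 hx
    rw [ap_ev hk]
    exact (hF.mem_prodSet_iff.1 (hgs.ap_mem hk)).1.app hi

theorem IsFam.isClassSeq_iff (hU : IsUltrafilter U I) (hF : IsFam L I F) {n cs gs : V} :
    IsClassSeq I U F n cs gs ↔ IsMap gs n (prodSet I F) ∧ cs = clsSeq I U F n gs := by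
  constructor
  · rintro ⟨h1, h2, h3, h4⟩
    have hgs : IsMap gs n (prodSet I F) := ⟨h1, fun k g h => hF.mem_prodSet.2 (h3 k g h)⟩
    refine ⟨hgs, h2.ext isFun_clsSeq fun k hk => ?_⟩
    rw [ap_clsSeq hk, ← hF.isClassOf_iff hU (hgs.ap_mem hk)]
    exact h4 k _ _ (h1.app hk) (h2.app hk)
  · rintro ⟨hgs, rfl⟩
    refine ⟨hgs.1, isFun_clsSeq, fun k g h => hF.mem_prodSet.1 (hgs.2 k g h),
      fun k g c hg hc => ?_⟩
    obtain ⟨hk, rfl⟩ := hgs.1.app_iff.1 hg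
    obtain ⟨-, rfl⟩ := isFun_clsSeq.app_iff.1 hc
    rw [hF.isClassOf_iff hU (hgs.ap_mem hk), ap_clsSeq hk]

/-- Behind the well-definedness of functions and relations on classes: finitely many coincidences
modulo `U` hold simultaneously on a set in `U`. -/
theorem clsSeq_eq_iff (hU : IsUltrafilter U I) {n gs gs' : V} (hn : n ∈ (omega : V))
    (hgs' : IsMap gs' n (prodSet I F)) (h : clsSeq I U F n gs = clsSeq I U F n gs') :
    Large U I fun i => ev n gs i = ev n gs' i := by
  have : Large U I fun i => ∀ k, k ∈ n → ap (ap gs k) i = ap (ap gs' k) i :=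
    large_forall_mem hU hn fun k hk => by
      rw [← cls_eq_iff hU (hgs'.ap_mem hk), ← ap_clsSeq hk, ← ap_clsSeq hk, h]
  exact this.mono hU fun i _ h => mkFun_congr h

/-- Finite sequences of classes have sequences of representatives. -/
theorem exists_clsSeq {n cs : V} (hn : n ∈ (omega : V))
    (hcs : IsFun cs n) (h : ∀ k, k ∈ n → ∃ g, g ∈ prodSet I F ∧ ap cs k = cls I U F g) :
    ∃ gs, IsMap gs n (prodSet I F) ∧ cs = clsSeq I U F n gs := by
  -- Finite choice is provable: representatives are added one by one along an induction on the
  -- length.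
  refine nat_induction (fun n => ∀ cs, IsFun cs n →
    (∀ k, k ∈ n → ∃ g, g ∈ prodSet I F ∧ ap cs k = cls I U F g) →
    ∃ gs, IsMap gs n (prodSet I F) ∧ cs = clsSeq I U F n gs) ?_ ?_ hn cs hcs h
  · exact fun cs hcs _ => ⟨emp, isMap_emp, hcs.ext isFun_clsSeq fun k hk => (notMem_emp k hk).elim⟩
  · intro n hn ih cs hcs h
    obtain ⟨gs, hgs, e⟩ := ih (mkFun n fun k => ap cs k) isFun_mkFun fun k hk => by
      rw [ap_mkFun hk]; exact h k (mem_succ.2 (.inl hk))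
    obtain ⟨g, hg, e'⟩ := h n (by simp)
    refine ⟨extend gs n g, isMap_extend hgs hg, hcs.ext isFun_clsSeq fun k hk => ?_⟩
    rw [ap_clsSeq hk]
    rcases mem_succ.1 hk with hk | rfl
    · rw [ap_extend_of_mem hgs.1 hk, ← ap_clsSeq hk, ← e, ap_mkFun hk]
    · rw [ap_extend_self hgs.1, e']

theorem ev_extend {n gs g i : V} (hgs : IsFun gs n) :
    ev (succ n) (extend gs n g) i = extend (ev n gs i) n (ap g i) :=
  eq_extend isFun_ev isFun_ev
    (fun k hk => by rw [ap_ev hk, ap_ev (mem_succ.2 (.inl hk)), ap_extend_of_mem hgs hk])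
    (by rw [ap_ev (by simp), ap_extend_self hgs])

theorem clsSeq_extend {n gs g : V} (hgs : IsFun gs n) :
    clsSeq I U F (succ n) (extend gs n g) = extend (clsSeq I U F n gs) n (cls I U F g) :=
  eq_extend isFun_clsSeq isFun_clsSeq
    (fun k hk => by rw [ap_clsSeq hk, ap_clsSeq (mem_succ.2 (.inl hk)), ap_extend_of_mem hgs hk])
    (by rw [ap_clsSeq (by simp), ap_extend_self hgs])

/-! ### Ultraproducts -/

/-- `i ↦ f^{M_i}(g_0(i), …, g_{n-1}(i))`. -/
noncomputable def ptwFn (I : V) (F : Fam V) (f n gs : V) : V :=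
  mkFun I fun i => fnv (F.str i) f (ev n gs i)

instance DFun.ptwFn (a b c : (ℕ → V) → V) [ha : DFun a] [hb : DFun b] [hc : DFun c] :
    DFun fun v => InternalZF.ptwFn I F (a v) (b v) (c v) := by
  have := ha.shift; have := hb.shift; have := hc.shift
  unfold InternalZF.ptwFn; infer_instance

theorem IsFam.ptwFn_mem (hF : IsFam L I F) {f n gs : V} (hf : App L.fnAr f n)
    (hgs : IsMap gs n (prodSet I F)) : ptwFn I F f n gs ∈ prodSet I F :=
  hF.mem_prodSet_iff.2 ⟨isFun_mkFun, fun i hi => by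
    rw [ptwFn, ap_mkFun hi]
    exact (hF.isStr_str hi).fnv_mem hf (hF.isMap_ev hgs hi)⟩

section IsUltraproduct

variable (hL : IsLang L) (hU : IsUltrafilter U I) (hF : IsFam L I F) {P : Str V}
  (hP : IsUltraproduct L I U F P)
include hL hU hF hP

theorem IsUltraproduct.mem_dom_iff {c : V} :
    c ∈ P.dom ↔ ∃ g, g ∈ prodSet I F ∧ c = cls I U F g := by
  rw [hP.dom]
  refine exists_congr fun g => ?_
  rw [← hF.mem_prodSet]
  exact and_congr_right fun hg => hF.isClassOf_iff hU hg

theorem IsUltraproduct.cls_mem {g : V} (hg : g ∈ prodSet I F) : cls I U F g ∈ P.dom :=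
  (hP.mem_dom_iff hL hU hF).2 ⟨g, hg, rfl⟩

theorem IsUltraproduct.isMap_clsSeq {n gs : V} (hgs : IsMap gs n (prodSet I F)) :
    IsMap (clsSeq I U F n gs) n P.dom :=
  InternalZF.isMap_clsSeq fun _ hk => hP.cls_mem hL hU hF (hgs.ap_mem hk)

theorem IsUltraproduct.exists_rep {n cs : V} (hn : n ∈ (omega : V)) (hcs : IsMap cs n P.dom) :
    ∃ gs, IsMap gs n (prodSet I F) ∧ cs = clsSeq I U F n gs :=
  exists_clsSeq hn hcs.1 fun _ hk => (hP.mem_dom_iff hL hU hF).1 (hcs.ap_mem hk)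

theorem IsUltraproduct.fnv_clsSeq {f n gs : V} (hf : App L.fnAr f n)
    (hgs : IsMap gs n (prodSet I F)) :
    fnv P f (clsSeq I U F n gs) = cls I U F (ptwFn I F f n gs) := by
  have hmem := hF.ptwFn_mem hf hgs
  refine ((hP.isStr.fnVal_iff hf (hP.isMap_clsSeq hL hU hF hgs)).1 (hP.fn f n gs _ _ _ hf
    ((hF.isClassSeq_iff hU).2 ⟨hgs, rfl⟩) (hF.mem_prodSet.1 hmem) (fun i hi => ?_)
    ((hF.isClassOf_iff hU hmem).2 rfl))).symm
  exact ⟨F.str i, _, _, hF.at_iff.2 ⟨hi, rfl⟩, (hF.isEvalAt_iff hgs hi).2 rfl,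
    isFun_mkFun.app hi, ((hF.isStr_str hi).fnVal_iff hf (hF.isMap_ev hgs hi)).2 (ap_mkFun hi)⟩

theorem IsUltraproduct.rel_clsSeq {R n gs : V} (hR : App L.relAr R n)
    (hgs : IsMap gs n (prodSet I F)) :
    RelHolds P R (clsSeq I U F n gs) ↔
      Large U I fun i => RelHolds (F.str i) R (ev n gs i) := by
  rw [hP.rel R n gs _ hR ((hF.isClassSeq_iff hU).2 ⟨hgs, rfl⟩)]
  refine large_congr hU fun i hi => ?_
  simp [hF.at_iff, hi, hF.isEvalAt_iff hgs hi]

/-- Terms are evaluated pointwise in an ultraproduct. -/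
theorem IsUltraproduct.tv_clsSeq {n gs t : V} (hn : n ∈ (omega : V))
    (hgs : IsMap gs n (prodSet I F)) (ht : IsTerm L n t) :
    tv L P n (clsSeq I U F n gs) t = cls I U F (mkFun I fun i => tv L (F.str i) n (ev n gs i) t) := by
  refine tv_eq_of_rec hL hP.isStr hn (hP.isMap_clsSeq hL hU hF hgs)
    (fun t => cls I U F (mkFun I fun i => tv L (F.str i) n (ev n gs i) t)) ?_ ?_ ht
  · intro k hk
    have hgk := hF.mem_prodSet_iff.1 (hgs.ap_mem hk)
    rw [ap_clsSeq hk]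
    congr 1
    refine isFun_mkFun.ext hgk.1 fun i hi => ?_
    rw [ap_mkFun hi, tv_var hL (hF.isStr_str hi) hn (hF.isMap_ev hgs hi) hk, ap_ev hk]
  · intro f m ts hf hts _
    have hts' := (isTermSeq_iff.1 hts).2
    let hs := mkFun m fun k => mkFun I fun i => tv L (F.str i) n (ev n gs i) (ap ts k)
    have hhs : IsMap hs m (prodSet I F) := isMap_mkFun fun k hk =>
      hF.mem_prodSet_iff.2 ⟨isFun_mkFun, fun i hi => by
        rw [ap_mkFun hi]
        exact tv_mem hL (hF.isStr_str hi) hn (hF.isMap_ev hgs hi) (hts' k hk)⟩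
    have e : (mkFun m fun k => cls I U F (mkFun I fun i => tv L (F.str i) n (ev n gs i) (ap ts k))) =
        clsSeq I U F m hs :=
      mkFun_congr fun k hk => by rw [ap_mkFun hk]
    rw [e, hP.fnv_clsSeq hL hU hF hf hhs]
    congr 1
    refine mkFun_congr fun i hi => ?_
    rw [tv_fn hL (hF.isStr_str hi) hn (hF.isMap_ev hgs hi) hf hts]
    congr 1
    exact mkFun_congr fun k hk => by rw [ap_mkFun hk, ap_mkFun hi]

end IsUltraproduct

/-- The ultraproduct of a family. -/
noncomputable def ultraproduct (L : Lang V) (I U : V) (F : Fam V) : Str V where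
  dom := img (prodSet I F) fun g => cls I U F g
  fn := sep (prod (prod L.fn (pow (prod omega (img (prodSet I F) fun g => cls I U F g))))
      (img (prodSet I F) fun g => cls I U F g)) fun p => ∃ f n gs, App L.fnAr f n ∧
        IsMap gs n (prodSet I F) ∧
        p = pair (pair f (clsSeq I U F n gs)) (cls I U F (ptwFn I F f n gs))
  rel := sep (prod L.rel (pow (prod omega (img (prodSet I F) fun g => cls I U F g)))) fun p =>
      ∃ R n gs, App L.relAr R n ∧ IsMap gs n (prodSet I F) ∧ p = pair R (clsSeq I U F n gs) ∧
        Large U I fun i => RelHolds (F.str i) R (ev n gs i)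

/-- The graph and the relations are defined through sequences of representatives. Independence of
the representatives comes from `clsSeq_eq_iff`, totality from `exists_clsSeq`, and the nonempty
product is needed only for a nonempty domain. -/
theorem isUltraproduct_ultraproduct (hL : IsLang L) (hU : IsUltrafilter U I) (hF : IsFam L I F)
    (hne : ∃ g, InProd I F g) : IsUltraproduct L I U F (ultraproduct L I U F) := by
  have hdom : ∀ {c}, c ∈ (ultraproduct L I U F).dom ↔
      ∃ g, g ∈ prodSet I F ∧ c = cls I U F g := mem_img
  have hmaps : ∀ {n gs}, IsMap gs n (prodSet I F) →
      IsMap (clsSeq I U F n gs) n (ultraproduct L I U F).dom := fun hgs =>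
    isMap_clsSeq fun k hk => hdom.2 ⟨_, hgs.ap_mem hk, rfl⟩
  have hfn : ∀ {f n gs c}, App L.fnAr f n → IsMap gs n (prodSet I F) →
      (FnVal (ultraproduct L I U F) f (clsSeq I U F n gs) c ↔
        c = cls I U F (ptwFn I F f n gs)) := by
    intro f n gs c hf hgs
    have : FnVal (ultraproduct L I U F) f (clsSeq I U F n gs) c ↔
        pair (pair f (clsSeq I U F n gs)) c ∈ (ultraproduct L I U F).fn := by
      simp [FnVal, isPair_iff, app_iff]
    rw [this]
    constructor
    · intro h
      obtain ⟨-, f', n', gs', hf', hgs', e⟩ := mem_sep.1 h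
      simp only [pair_inj] at e
      obtain ⟨⟨rfl, e⟩, rfl⟩ := e
      -- The two arities agree, since both are the value of the arity function at the same symbol.
      obtain rfl := hL.1.ap_eq hf ▸ hL.1.ap_eq hf'
      rw [cls_eq_iff hU (hF.ptwFn_mem hf hgs)]
      refine (clsSeq_eq_iff hU (hL.fnAr_mem hf).2 hgs' e).mono hU fun i hi he => ?_
      rw [ptwFn, ptwFn, ap_mkFun hi, ap_mkFun hi, he]
    · rintro rfl
      exact mem_sep.2 ⟨pair_mem_prod.2 ⟨pair_mem_prod.2 ⟨(hL.fnAr_mem hf).1,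
        mem_pow_of_isMap (hL.fnAr_mem hf).2 (hmaps hgs)⟩, hdom.2 ⟨_, hF.ptwFn_mem hf hgs, rfl⟩⟩,
        f, n, gs, hf, hgs, rfl⟩
  have hrep : ∀ {n cs}, n ∈ (omega : V) → IsMap cs n (ultraproduct L I U F).dom →
      ∃ gs, IsMap gs n (prodSet I F) ∧ cs = clsSeq I U F n gs := fun hn hcs =>
    exists_clsSeq hn hcs.1 fun k hk => hdom.1 (hcs.ap_mem hk)
  refine ⟨⟨?_, ?_, ?_, ?_⟩, ?_, ?_, ?_⟩
  · obtain ⟨g, hg⟩ := hne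
    exact ⟨_, hdom.2 ⟨g, hF.mem_prodSet.2 hg, rfl⟩⟩
  · intro p hp
    obtain ⟨-, f, n, gs, hf, hgs, rfl⟩ := mem_sep.1 hp
    exact ⟨f, n, _, _, _, hf, hmaps hgs, hdom.2 ⟨_, hF.ptwFn_mem hf hgs, rfl⟩, isPair_iff.2 rfl,
      isPair_iff.2 rfl⟩
  · intro f n s hf hs
    obtain ⟨gs, hgs, rfl⟩ := hrep (hL.fnAr_mem hf).2 hs
    simp [hfn hf hgs]
  · intro p hp
    obtain ⟨-, R, n, gs, hR, hgs, rfl, -⟩ := mem_sep.1 hp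
    exact ⟨R, n, _, hR, hmaps hgs, isPair_iff.2 rfl⟩
  · intro c
    rw [hdom]
    refine exists_congr fun g => ?_
    rw [← hF.mem_prodSet]
    exact and_congr_right fun hg => (hF.isClassOf_iff hU hg).symm
  · intro f n gs cs y c hf hcs hy hval hc
    obtain ⟨hgs, rfl⟩ := (hF.isClassSeq_iff hU).1 hcs
    rw [hF.isClassOf_iff hU (hF.mem_prodSet.2 hy)] at hc
    rw [hfn hf hgs, hc]
    congr 1
    refine hy.1.ext isFun_mkFun fun i hi => ?_
    obtain ⟨M, t, d, hM, ht, hd, hv⟩ := hval i hi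
    obtain ⟨-, rfl⟩ := hF.at_iff.1 hM
    rw [hF.isEvalAt_iff hgs hi] at ht
    subst ht
    rw [ptwFn, ap_mkFun hi, hy.1.ap_eq hd]
    exact ((hF.isStr_str hi).fnVal_iff hf (hF.isMap_ev hgs hi)).1 hv
  · intro R n gs cs hR hcs
    obtain ⟨hgs, rfl⟩ := (hF.isClassSeq_iff hU).1 hcs
    have : (Large U I fun i => ∃ (M : Str V) (t : V), F.At i M ∧ IsEvalAt n gs i t ∧
        RelHolds M R t) ↔ Large U I fun i => RelHolds (F.str i) R (ev n gs i) :=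
      large_congr hU fun i hi => by simp [hF.at_iff, hi, hF.isEvalAt_iff hgs hi]
    rw [this, RelHolds, app_iff]
    constructor
    · intro h
      obtain ⟨-, R', n', gs', hR', hgs', e, hlarge⟩ := mem_sep.1 h
      obtain ⟨rfl, e'⟩ := pair_inj.1 e
      obtain rfl := hL.2.2.1.ap_eq hR ▸ hL.2.2.1.ap_eq hR'
      refine ((clsSeq_eq_iff hU (hL.relAr_mem hR).2 hgs' e').and hU hlarge).mono hU ?_
      exact fun i _ ⟨h1, h2⟩ => h1 ▸ h2
    · exact fun h => mem_sep.2 ⟨pair_mem_prod.2 ⟨(hL.relAr_mem hR).1,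
        mem_pow_of_isMap (hL.relAr_mem hR).2 (hmaps hgs)⟩, R, n, gs, hR, hgs, rfl, h⟩

/-! ### Łoś's theorem -/

-- The choice principle is applied to the sets of witnesses, with the whole domain taking the place
-- of an empty set of witnesses.
open Classical in
theorem UltrafilterAC.exists_witness (hAC : UltrafilterAC U I) (hU : IsUltrafilter U I)
    (hF : IsFam L I F) (hne : ∃ g, InProd I F g) (Q : V → V → Prop)
    [dQ : Dfn fun v : ℕ → V => Q (v 0) (v 1)]
    (h : Large U I fun i => ∃ d, d ∈ (F.str i).dom ∧ Q i d) :
    ∃ g, g ∈ prodSet I F ∧ Large U I fun i => Q i (ap g i) := by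
  have := fun a b [ha : DFun a] [hb : DFun b] => dQ.comp2 (a := a) (b := b) ha hb
  obtain ⟨g₀, hg₀⟩ := hne
  rw [hF.inProd_iff] at hg₀
  let A := mkFun I fun i => sep (F.str i).dom fun d =>
    Q i d ∨ ¬ ∃ d, d ∈ (F.str i).dom ∧ Q i d
  have hA : ∀ {i a}, App A i a ↔ i ∈ I ∧ a = sep (F.str i).dom fun d =>
    Q i d ∨ ¬ ∃ d, d ∈ (F.str i).dom ∧ Q i d := app_mkFun
  obtain ⟨f, hf, hlarge⟩ := hAC A isFun_mkFun (by
    intro i a ha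
    obtain ⟨hi, rfl⟩ := hA.1 ha
    by_cases hd : ∃ d, d ∈ (F.str i).dom ∧ Q i d
    · obtain ⟨d, hd, hdQ⟩ := hd
      exact ⟨d, mem_sep.2 ⟨hd, .inl hdQ⟩⟩
    · exact ⟨_, mem_sep.2 ⟨hg₀.2 i hi, .inr hd⟩⟩)
  -- The function from the choice principle is controlled only on a set in `U`; elsewhere it may
  -- leave the structures, so there the given element `g₀` of the product is used.
  let g := mkFun I fun i => if ap f i ∈ (F.str i).dom then ap f i else ap g₀ i
  refine ⟨g, hF.mem_prodSet_iff.2 ⟨isFun_mkFun, fun i hi => ?_⟩,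
    (h.and hU hlarge).mono hU fun i hi h' => ?_⟩
  · rw [ap_mkFun hi]
    split
    · assumption
    · exact hg₀.2 i hi
  · obtain ⟨hex, a, x, ha, hx, hxa⟩ := h'
    obtain ⟨-, rfl⟩ := hA.1 ha
    obtain ⟨-, rfl⟩ := hf.app_iff.1 hx
    obtain ⟨h1, h2⟩ := mem_sep.1 hxa
    rw [ap_mkFun hi, if_pos h1]
    exact h2.resolve_right fun h => h hex

/-- Łoś's theorem for ultraproducts by an ultrafilter with the choice principle. -/
theorem UltrafilterAC.los (hAC : UltrafilterAC U I) (hL : IsLang L) (hU : IsUltrafilter U I)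
    (hF : IsFam L I F) (hne : ∃ g, InProd I F g) {P : Str V} (hP : IsUltraproduct L I U F P)
    {n φ gs : V} (hφ : IsFormula L n φ) (hgs : IsMap gs n (prodSet I F)) :
    Sat L P φ (clsSeq I U F n gs) ↔ Large U I fun i => Sat L (F.str i) φ (ev n gs i) := by
  have hT := fun i => isTruth_sat hL (F.str i)
  have hTP := isTruth_sat hL P
  refine formula_induction hL (fun n φ => ∀ gs, IsMap gs n (prodSet I F) →
    (Sat L P φ (clsSeq I U F n gs) ↔ Large U I fun i => Sat L (F.str i) φ (ev n gs i)))
    ?_ ?_ ?_ ?_ ?_ hφ gs hgs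
  · intro n φ hn hφ gs hgs
    have hcs := hP.isMap_clsSeq hL hU hF hgs
    rcases isAtomic_iff.1 hφ with ⟨t, r, ht, hr, rfl⟩ | ⟨R, m, ts, hR, hts, rfl⟩
    · rw [sat_eq hL hP.isStr hn hcs ht hr, hP.tv_clsSeq hL hU hF hn hgs ht,
        hP.tv_clsSeq hL hU hF hn hgs hr, cls_eq_iff hU]
      · refine large_congr hU fun i hi => ?_
        rw [ap_mkFun hi, ap_mkFun hi, sat_eq hL (hF.isStr_str hi) hn (hF.isMap_ev hgs hi) ht hr]
      · refine hF.mem_prodSet_iff.2 ⟨isFun_mkFun, fun i hi => ?_⟩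
        rw [ap_mkFun hi]
        exact tv_mem hL (hF.isStr_str hi) hn (hF.isMap_ev hgs hi) hr
    · have hts' := (isTermSeq_iff.1 hts).2
      let hs := mkFun m fun k => mkFun I fun i => tv L (F.str i) n (ev n gs i) (ap ts k)
      have hhs : IsMap hs m (prodSet I F) := isMap_mkFun fun k hk =>
        hF.mem_prodSet_iff.2 ⟨isFun_mkFun, fun i hi => by
          rw [ap_mkFun hi]
          exact tv_mem hL (hF.isStr_str hi) hn (hF.isMap_ev hgs hi) (hts' k hk)⟩
      have e : (mkFun m fun k => tv L P n (clsSeq I U F n gs) (ap ts k)) = clsSeq I U F m hs :=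
        mkFun_congr fun k hk => by rw [ap_mkFun hk, hP.tv_clsSeq hL hU hF hn hgs (hts' k hk)]
      rw [sat_rel hL hP.isStr hn hcs hR hts, e, hP.rel_clsSeq hL hU hF hR hhs]
      refine large_congr hU fun i hi => ?_
      rw [sat_rel hL (hF.isStr_str hi) hn (hF.isMap_ev hgs hi) hR hts]
      have e : ev m hs i = mkFun m fun k => tv L (F.str i) n (ev n gs i) (ap ts k) :=
        mkFun_congr fun k hk => by rw [ap_mkFun hk, ap_mkFun hi]
      rw [e]
  · intro n φ hn hφ ih gs hgs
    rw [hTP.not n φ _ hn (hP.isMap_clsSeq hL hU hF hgs) hφ, ih gs hgs, ← large_not hU]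
    exact large_congr hU fun i hi => ((hT i).not n φ _ hn (hF.isMap_ev hgs hi) hφ).symm
  · intro n φ ψ hn hφ hψ ih ih' gs hgs
    rw [hTP.and n φ ψ _ hn (hP.isMap_clsSeq hL hU hF hgs) hφ hψ, ih gs hgs, ih' gs hgs,
      ← large_and_iff hU]
    exact large_congr hU fun i hi => ((hT i).and n φ ψ _ hn (hF.isMap_ev hgs hi) hφ hψ).symm
  · intro n φ hn hφ ih gs hgs
    rw [hTP.ex n φ _ hn (hP.isMap_clsSeq hL hU hF hgs) hφ]
    have e : (Large U I fun i => Sat L (F.str i) (exF φ) (ev n gs i)) ↔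
        Large U I fun i => ∃ d, d ∈ (F.str i).dom ∧ Sat L (F.str i) φ (extend (ev n gs i) n d) :=
      large_congr hU fun i hi => (hT i).ex n φ _ hn (hF.isMap_ev hgs hi) hφ
    rw [e]
    constructor
    · rintro ⟨c, hc, hsat⟩
      obtain ⟨g, hg, rfl⟩ := (hP.mem_dom_iff hL hU hF).1 hc
      rw [← clsSeq_extend hgs.1, ih _ (isMap_extend hgs hg)] at hsat
      refine hsat.mono hU fun i hi h => ⟨ap g i, (hF.mem_prodSet_iff.1 hg).2 i hi, ?_⟩
      rwa [← ev_extend hgs.1]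
    · intro h
      -- Witnesses in `U`-many factors are collected into one function; with its dual below for `∀`,
      -- this is the only appeal to choice.
      obtain ⟨g, hg, h⟩ := hAC.exists_witness hU hF hne
        (fun i d => Sat L (F.str i) φ (extend (ev n gs i) n d)) h
      refine ⟨_, hP.cls_mem hL hU hF hg, ?_⟩
      rw [← clsSeq_extend hgs.1, ih _ (isMap_extend hgs hg)]
      exact h.mono hU fun i hi h => by rwa [ev_extend hgs.1]
  · intro n φ hn hφ ih gs hgs
    rw [hTP.all n φ _ hn (hP.isMap_clsSeq hL hU hF hgs) hφ]
    have e : (Large U I fun i => Sat L (F.str i) (allF φ) (ev n gs i)) ↔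
        Large U I fun i => ∀ d, d ∈ (F.str i).dom → Sat L (F.str i) φ (extend (ev n gs i) n d) :=
      large_congr hU fun i hi => (hT i).all n φ _ hn (hF.isMap_ev hgs hi) hφ
    rw [e]
    constructor
    · intro h
      by_contra hlarge
      rw [← large_not hU] at hlarge
      -- As `U` is ultra, the failure occurs on a set in `U`. The class of a function collecting
      -- counterexamples contradicts the assumption at a common index.
      obtain ⟨g, hg, h'⟩ := hAC.exists_witness hU hF hne
        (fun i d => ¬ Sat L (F.str i) φ (extend (ev n gs i) n d))
        (hlarge.mono hU fun i _ h => by push Not at h; exact h)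
      have := h _ (hP.cls_mem hL hU hF hg)
      rw [← clsSeq_extend hgs.1, ih _ (isMap_extend hgs hg)] at this
      obtain ⟨i, hi, h1, h2⟩ := (h'.and hU this).exists hU
      rw [ev_extend hgs.1] at h2
      exact h1 h2
    · intro h c hc
      obtain ⟨g, hg, rfl⟩ := (hP.mem_dom_iff hL hU hF).1 hc
      rw [← clsSeq_extend hgs.1, ih _ (isMap_extend hgs hg)]
      refine h.mono hU fun i hi h => ?_
      rw [ev_extend hgs.1]
      exact h _ ((hF.mem_prodSet_iff.1 hg).2 i hi)

theorem UltrafilterAC.los_sentence (hAC : UltrafilterAC U I) (hL : IsLang L)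
    (hU : IsUltrafilter U I) (hF : IsFam L I F) (hne : ∃ g, InProd I F g) {P : Str V}
    (hP : IsUltraproduct L I U F P) {σ : V} (hσ : IsFormula L emp σ) :
    Sat L P σ emp ↔ Large U I fun i => Sat L (F.str i) σ emp := by
  have h1 : clsSeq I U F emp emp = emp :=
    isFun_clsSeq.ext (isMap_emp (D := emp)).1 fun k hk => (notMem_emp k hk).elim
  have h2 : ∀ i, ev emp emp i = (emp : V) := fun i =>
    isFun_ev.ext (isMap_emp (D := emp)).1 fun k hk => (notMem_emp k hk).elim
  have := hAC.los hL hU hF hne hP hσ isMap_emp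
  rw [h1] at this
  simpa only [h2] using this

end Ultraproducts

end InternalZF

/-! ### From the choice principle to the variants of Łoś's theorem, and among these. -/

namespace InternalZF

section Consequences

set_option linter.unusedSectionVars false
set_option synthInstance.maxHeartbeats 400000
set_option synthInstance.maxSize 5000

variable {V : Type u} [Membership V V] [hV : ZFModel V] {L : Lang V} {I U : V}

/-! ### Consequences of the choice principle -/

/-- The constant family. -/
noncomputable def constFam (I : V) (M : Str V) : Fam V :=
  ⟨mkFun I fun _ => M.dom, mkFun I fun _ => M.fn, mkFun I fun _ => M.rel⟩

theorem constFam_at_iff {M N : Str V} {i : V} : (constFam I M).At i N ↔ i ∈ I ∧ N = M := by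
  simp only [Fam.At, constFam, app_mkFun, Str.ext_iff]
  tauto

theorem isFam_constFam {M : Str V} (hM : IsStr L M) : IsFam L I (constFam I M) :=
  ⟨isFun_mkFun, isFun_mkFun, isFun_mkFun, fun _ _ h => (constFam_at_iff.1 h).2 ▸ hM⟩

theorem exists_inProd_of_const {F : Fam V} {M : Str V} (hF : IsFam L I F) (hM : IsStr L M)
    (h : ∀ i, i ∈ I → F.At i M) : ∃ g, InProd I F g := by
  obtain ⟨x, hx⟩ := hM.nonempty
  refine ⟨mkFun I fun _ => x, hF.inProd_iff.2 ⟨isFun_mkFun, fun i hi => ?_⟩⟩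
  rw [ap_mkFun hi, ← (hF.at_iff.1 (h i hi)).2]
  exact hx

theorem large_const (hU : IsUltrafilter U I) {p : Prop} : (Large U I fun _ => p) ↔ p :=
  ⟨fun h => (h.exists hU).elim fun _ h => h.2, fun h => large_of_forall hU fun _ _ => h⟩

/-- By Łoś's theorem, as a condition not depending on the index holds on a set in `U` exactly if it
holds. -/
theorem UltrafilterAC.ultrapowerSigmaTwo (hAC : UltrafilterAC U I) (hU : IsUltrafilter U I) :
    UltrapowerSigmaTwo U I := by
  intro L M hL hM
  have hF : IsFam L I (constFam I M) := isFam_constFam hM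
  have hat : ∀ i, i ∈ I → (constFam I M).At i M := fun i hi => constFam_at_iff.2 ⟨hi, rfl⟩
  have hne := exists_inProd_of_const hF hM hat
  have hP := isUltraproduct_ultraproduct hL hU hF hne
  refine ⟨_, ⟨_, hF, hat, hP⟩, sigmaEquiv_of_sat_iff fun σ hσ => ?_⟩
  rw [hAC.los_sentence hL hU hF hne hP hσ, ← large_const hU (p := Sat L M σ emp)]
  exact large_congr hU fun i hi => by rw [← (hF.at_iff.1 (hat i hi)).2]

theorem UltrafilterAC.ultraproductSigmaOneFactor (hAC : UltrafilterAC U I)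
    (hU : IsUltrafilter U I) : UltraproductSigmaOneFactor U I := by
  intro L F hL hF hiso hne
  have hP := isUltraproduct_ultraproduct hL hU hF hne
  refine ⟨_, hP, fun i M hi hM => sigmaEquiv_of_sat_iff fun σ hσ => ?_⟩
  rw [hAC.los_sentence hL hU hF hne hP hσ, ← large_const hU (p := Sat L M σ emp)]
  refine large_congr hU fun j hj => ?_
  have hj' := hF.at_iff.2 ⟨hj, rfl⟩
  exact (hiso j i _ M hj' hM).sat_iff hL (hF.isStr j _ hj') (hF.isStr i M hM) hσ

theorem SigmaEquiv.symm {k : ℕ} {M N : Str V} (h : SigmaEquiv L k M N) : SigmaEquiv L k N M :=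
  fun z σ hz hσ => (h z σ hz hσ).symm

theorem SigmaEquiv.trans {k : ℕ} {M N K : Str V} (h : SigmaEquiv L k M N)
    (h' : SigmaEquiv L k N K) : SigmaEquiv L k M K :=
  fun z σ hz hσ => (h z σ hz hσ).trans (h' z σ hz hσ)

theorem IsElementaryEmbedding.sigmaEquiv {k : ℕ} {M N : Str V} {j : V}
    (h : IsElementaryEmbedding L M N j) : SigmaEquiv L k M N :=
  sigmaEquiv_of_sat_iff fun σ hσ => h.2 emp σ emp emp (mem_omega.1 emp_mem_omega) hσ isMap_emp
    isMap_emp ((isImageSeq_iff (isMap_emp (D := emp)).1 (isMap_emp (D := emp)).1).2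
      fun k hk => (notMem_emp k hk).elim)

/-- Chain `P ≡ M ≡ N ≡ Q` on `Σ₂` sentences, the middle step being given by an elementary embedding.
-/
theorem UltrapowerSigmaTwo.mutualEmbeddingSigmaTwo (h : UltrapowerSigmaTwo U I) :
    MutualEmbeddingSigmaTwo U I := by
  rintro L M N hL hM hN ⟨j, hj⟩ -
  obtain ⟨P, hP, hPM⟩ := h L M hL hM
  obtain ⟨Q, hQ, hQN⟩ := h L N hL hN
  exact ⟨P, Q, hP, hQ, (hPM.trans hj.sigmaEquiv).trans hQN.symm⟩

/-! ### Isomorphic factors -/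

section Transfer

open Classical

variable (L I) in
/-- Apply the isomorphisms `f(i) : M_i → N_i` pointwise to `g`, with `g₀` as default. -/
noncomputable def transfer (F G : Fam V) (f g₀ g : V) : V :=
  mkFun I fun i => if IsIso L (F.str i) (G.str i) (ap f i) then ap (ap f i) (ap g i) else ap g₀ i

instance DFun.transfer (F G : Fam V) (f g₀ : V) (a : (ℕ → V) → V) [ha : DFun a] :
    DFun fun v => InternalZF.transfer L I F G f g₀ (a v) := by
  have := ha.shift
  unfold InternalZF.transfer; infer_instance

theorem IsIso.ap_inj {M N : Str V} {h x y : V} (hh : IsIso L M N h) (hx : x ∈ M.dom)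
    (hy : y ∈ M.dom) (e : ap h x = ap h y) : x = y :=
  (hh.bijective _ (hh.map.ap_mem hx)).unique (hh.map.1.app hx) (e ▸ hh.map.1.app hy)

/-- The choice principle is applied to the nonempty sets of isomorphisms `M_i → N_i`. Applying the
chosen ones pointwise induces a map on classes, for which only the `U`-many good indices matter. -/
theorem UltrafilterAC.isomorphicFactorsIsomorphic (hAC : UltrafilterAC U I)
    (hU : IsUltrafilter U I) : IsomorphicFactorsIsomorphic U I := by
  intro L F G hL hF hG hiso hneF hneG
  have hP := isUltraproduct_ultraproduct hL hU hF hneF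
  have hQ := isUltraproduct_ultraproduct hL hU hG hneG
  refine ⟨_, _, hP, hQ, ?_⟩
  generalize ultraproduct L I U F = P at hP
  generalize ultraproduct L I U G = Q at hQ
  obtain ⟨f₀, hf₀⟩ := hneF
  obtain ⟨g₀, hg₀⟩ := hneG
  rw [hF.inProd_iff] at hf₀
  rw [hG.inProd_iff] at hg₀
  let A := mkFun I fun i => sep (maps (F.str i).dom (G.str i).dom) fun h =>
    IsIso L (F.str i) (G.str i) h
  have hA : ∀ {i a}, App A i a ↔ i ∈ I ∧ a = sep (maps (F.str i).dom (G.str i).dom) fun h =>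
    IsIso L (F.str i) (G.str i) h := app_mkFun
  obtain ⟨f, hf, hlarge⟩ := hAC A isFun_mkFun (by
    intro i a ha
    obtain ⟨hi, rfl⟩ := hA.1 ha
    obtain ⟨h, hh⟩ := hiso i _ _ hi (hF.at_iff.2 ⟨hi, rfl⟩) (hG.at_iff.2 ⟨hi, rfl⟩)
    exact ⟨h, mem_sep.2 ⟨mem_maps.2 hh.map, hh⟩⟩)
  have hlarge' : Large U I fun i => IsIso L (F.str i) (G.str i) (ap f i) := by
    refine hlarge.mono hU fun i hi ⟨a, x, ha, hx, hxa⟩ => ?_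
    obtain ⟨-, rfl⟩ := hA.1 ha
    obtain ⟨-, rfl⟩ := hf.app_iff.1 hx
    exact (mem_sep.1 hxa).2
  let T := transfer L I F G f g₀
  have hT : ∀ {g i}, i ∈ I → IsIso L (F.str i) (G.str i) (ap f i) →
      ap (T g) i = ap (ap f i) (ap g i) := fun {g i} hi h => by
    simp only [T, transfer]
    rw [ap_mkFun hi, if_pos h]
  have hTmem : ∀ {g}, g ∈ prodSet I F → T g ∈ prodSet I G := by
    intro g hg
    rw [hF.mem_prodSet_iff] at hg
    refine hG.mem_prodSet_iff.2 ⟨isFun_mkFun, fun i hi => ?_⟩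
    simp only [T, transfer]
    rw [ap_mkFun hi]
    split
    · next h => exact h.map.ap_mem (hg.2 i hi)
    · exact hg₀.2 i hi
  have hTcls : ∀ {g g'}, g ∈ prodSet I F → g' ∈ prodSet I F →
      (cls I U G (T g) = cls I U G (T g') ↔ cls I U F g = cls I U F g') := by
    intro g g' hg hg'
    rw [cls_eq_iff hU (hTmem hg'), cls_eq_iff hU hg']
    rw [hF.mem_prodSet_iff] at hg hg'
    constructor
    · refine fun h => (h.and hU hlarge').mono hU fun i hi ⟨h1, h2⟩ => ?_
      rw [hT hi h2, hT hi h2] at h1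
      exact h2.ap_inj (hg.2 i hi) (hg'.2 i hi) h1
    · refine fun h => (h.and hU hlarge').mono hU fun i hi ⟨h1, h2⟩ => ?_
      rw [hT hi h2, hT hi h2, h1]
  -- The value at a class is computed from any representative; by `hTcls` the result does not depend
  -- on it, and `H` is injective.
  let H := mkFun P.dom fun c => the fun d =>
    ∃ g, g ∈ prodSet I F ∧ c = cls I U F g ∧ d = cls I U G (transfer L I F G f g₀ g)
  have hH : ∀ {g}, g ∈ prodSet I F → ap H (cls I U F g) = cls I U G (T g) := by
    intro g hg
    rw [ap_mkFun (hP.cls_mem hL hU hF hg)]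
    refine the_eq ⟨g, hg, rfl, rfl⟩ ?_
    rintro d ⟨g', hg', e, rfl⟩
    exact (hTcls hg' hg).2 e.symm
  have hHmap : IsMap H P.dom Q.dom := by
    refine isMap_iff.2 ⟨isFun_mkFun, fun c hc => ?_⟩
    obtain ⟨g, hg, rfl⟩ := (hP.mem_dom_iff hL hU hF).1 hc
    rw [hH hg]
    exact hQ.cls_mem hL hU hG (hTmem hg)
  have himg : ∀ {n s s'}, n ∈ (omega : V) → IsMap s n P.dom → IsMap s' n Q.dom →
      IsImageSeq H n s s' → ∃ gs gs', IsMap gs n (prodSet I F) ∧ IsMap gs' n (prodSet I G) ∧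
        s = clsSeq I U F n gs ∧ s' = clsSeq I U G n gs' ∧
        ∀ i, i ∈ I → IsIso L (F.str i) (G.str i) (ap f i) →
          IsImageSeq (ap f i) n (ev n gs i) (ev n gs' i) := by
    intro n s s' hn hs hs' h
    obtain ⟨gs, hgs, rfl⟩ := hP.exists_rep hL hU hF hn hs
    -- Representatives of the image tuple are the transfers of representatives of the given tuple,
    -- so nothing has to be chosen on the side of `G`.
    have hgs' : IsMap (mkFun n fun k => transfer L I F G f g₀ (ap gs k)) n (prodSet I G) :=
      isMap_mkFun fun k hk => hTmem (hgs.ap_mem hk)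
    refine ⟨gs, _, hgs, hgs', rfl, hs'.1.ext isFun_clsSeq fun k hk => ?_, fun i hi hh => ?_⟩
    · rw [ap_clsSeq hk, ap_mkFun hk, ← hHmap.1.ap_eq ((isImageSeq_iff hs.1 hs'.1).1 h k hk),
        ap_clsSeq hk, hH (hgs.ap_mem hk)]
    · refine (isImageSeq_iff isFun_ev isFun_ev).2 fun k hk => ?_
      rw [ap_ev hk, ap_ev hk, ap_mkFun hk]
      have := hh.map.1.app ((hF.mem_prodSet_iff.1 (hgs.ap_mem hk)).2 i hi)
      rwa [← hT hi hh] at this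
  refine ⟨H, hHmap, fun d hd => ?_, fun φ n s s' x y hφ hs hs' h hx hy => ?_,
    fun R n s s' hR hs hs' h => ?_⟩
  · obtain ⟨g', hg', rfl⟩ := (hQ.mem_dom_iff hL hU hG).1 hd
    have hg'2 := (hG.mem_prodSet_iff.1 hg').2
    -- Surjectivity: pull `g'` back along the chosen isomorphisms, using `f₀` at the indices without
    -- one.
    let g := mkFun I fun i => if IsIso L (F.str i) (G.str i) (ap f i) then
      the (fun x => App (ap f i) x (ap g' i)) else ap f₀ i
    have hspec : ∀ {i}, i ∈ I → IsIso L (F.str i) (G.str i) (ap f i) →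
        App (ap f i) (ap g i) (ap g' i) := by
      intro i hi h
      simp only [g]
      rw [ap_mkFun hi, if_pos h]
      exact the_spec (h.bijective _ (hg'2 i hi))
    have hg : g ∈ prodSet I F := by
      refine hF.mem_prodSet_iff.2 ⟨isFun_mkFun, fun i hi => ?_⟩
      by_cases h : IsIso L (F.str i) (G.str i) (ap f i)
      · exact (h.map.1.app_iff.1 (hspec hi h)).1
      · simp only [g]
        rw [ap_mkFun hi, if_neg h]
        exact hf₀.2 i hi
    have hTg : cls I U G (T g) = cls I U G g' := by
      rw [cls_eq_iff hU hg']
      refine hlarge'.mono hU fun i hi h => ?_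
      rw [hT hi h, h.map.1.ap_eq (hspec hi h)]
    refine ⟨cls I U F g, ?_, fun c hc => ?_⟩
    · exact hHmap.1.app_iff.2 ⟨hP.cls_mem hL hU hF hg, by rw [hH hg, hTg]⟩
    · obtain ⟨hcP, e⟩ := hHmap.1.app_iff.1 hc
      obtain ⟨k, hk, rfl⟩ := (hP.mem_dom_iff hL hU hF).1 hcP
      rw [hH hk, ← hTg] at e
      exact ((hTcls hg hk).1 e).symm
  · have hn := (hL.fnAr_mem hφ).2
    obtain ⟨gs, gs', hgs, hgs', rfl, rfl, hi⟩ := himg hn hs hs' h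
    rw [(hP.isStr.fnVal_iff hφ hs).1 hx, (hQ.isStr.fnVal_iff hφ hs').1 hy,
      hP.fnv_clsSeq hL hU hF hφ hgs, hQ.fnv_clsSeq hL hU hG hφ hgs', hHmap.1.app_iff]
    have hm := hF.ptwFn_mem hφ hgs
    refine ⟨hP.cls_mem hL hU hF hm, ?_⟩
    rw [hH hm, eq_comm, cls_eq_iff hU (hG.ptwFn_mem hφ hgs')]
    refine hlarge'.mono hU fun i hiI hh => ?_
    have h1 := hF.isMap_ev hgs hiI
    have h2 := hG.isMap_ev hgs' hiI
    rw [hT hiI hh, ptwFn, ptwFn, ap_mkFun hiI, ap_mkFun hiI]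
    exact hh.map.1.ap_eq (hh.fn φ n _ _ _ _ hφ h1 h2 (hi i hiI hh)
      (((hF.isStr_str hiI).fnVal_iff hφ h1).2 rfl) (((hG.isStr_str hiI).fnVal_iff hφ h2).2 rfl))
  · have hn := (hL.relAr_mem hR).2
    obtain ⟨gs, gs', hgs, hgs', rfl, rfl, hi⟩ := himg hn hs hs' h
    rw [hP.rel_clsSeq hL hU hF hR hgs, hQ.rel_clsSeq hL hU hG hR hgs']
    have key : ∀ i, i ∈ I → IsIso L (F.str i) (G.str i) (ap f i) →
        (RelHolds (F.str i) R (ev n gs i) ↔ RelHolds (G.str i) R (ev n gs' i)) := fun i hiI hh =>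
      hh.rel R n _ _ hR (hF.isMap_ev hgs hiI) (hG.isMap_ev hgs' hiI) (hi i hiI hh)
    exact ⟨fun h => (h.and hU hlarge').mono hU fun i hi ⟨h1, h2⟩ => (key i hi h2).1 h1,
      fun h => (h.and hU hlarge').mono hU fun i hi ⟨h1, h2⟩ => (key i hi h2).2 h1⟩

end Transfer

theorem IsomorphicFactorsIsomorphic.isomorphicFactorsSigmaOne
    (h : IsomorphicFactorsIsomorphic U I) : IsomorphicFactorsSigmaOne U I := by
  intro L F G hL hF hG hiso hneF hneG
  obtain ⟨P, Q, hP, hQ, hPQ⟩ := h L F G hL hF hG hiso hneF hneG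
  exact ⟨P, Q, hP, hQ, sigmaEquiv_of_sat_iff fun σ hσ => hPQ.sat_iff hL hP.isStr hQ.isStr hσ⟩

end Consequences

end InternalZF

/-! ### Sequences and Hilbert's hotel. -/

namespace InternalZF

section Sequences

set_option linter.unusedSectionVars false
set_option synthInstance.maxHeartbeats 400000
set_option synthInstance.maxSize 5000

variable {V : Type u} [Membership V V] [hV : ZFModel V]

open Classical

/-! ### Sequences whose first entry lies in a given set -/

/-- The sequence `s` with `a` prepended. -/
noncomputable def cons (a s : V) : V :=
  mkFun omega fun n => if n = emp then a else ap s (the fun m => n = succ m)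

/-- The sequence `s` without its first entry. -/
noncomputable def shift (s : V) : V := mkFun omega fun n => ap s (succ n)

/-- The first entry of the sequence `s` that differs from `a` exists and is outside of `A`
(for `a ∈ A`). -/
def LeavesFrom (A a s : V) : Prop :=
  ∃ k, k ∈ (omega : V) ∧ (∀ j, j ∈ k → ap s j = a) ∧ ¬ ap s k ∈ A

instance DFun.cons (a b : (ℕ → V) → V) [ha : DFun a] [hb : DFun b] :
    DFun fun v => InternalZF.cons (a v) (b v) := by
  have := ha.shift; have := hb.shift
  unfold InternalZF.cons; infer_instance

instance Dfn.leavesFrom (a b c : (ℕ → V) → V) [ha : DFun a] [hb : DFun b] [hc : DFun c] :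
    Dfn fun v => LeavesFrom (a v) (b v) (c v) := by
  have := ha.shift; have := hb.shift; have := hc.shift
  unfold LeavesFrom; infer_instance

theorem succ_ne_emp (n : V) : succ n ≠ emp := fun h =>
  notMem_emp n (h ▸ mem_succ.2 (Or.inr rfl))

theorem ap_cons_emp {a s : V} : ap (cons a s) emp = a := by
  rw [cons, ap_mkFun emp_mem_omega, if_pos rfl]

theorem ap_cons_succ {a s n : V} (hn : n ∈ (omega : V)) : ap (cons a s) (succ n) = ap s n := by
  rw [cons, ap_mkFun (succ_mem_omega hn), if_neg (succ_ne_emp n),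
    the_eq (P := fun m => succ n = succ m) rfl fun _ h => (succ_inj h).symm]

theorem ap_shift {s n : V} (hn : n ∈ (omega : V)) : ap (shift s) n = ap s (succ n) := ap_mkFun hn

theorem isMap_cons {Z a s : V} (ha : a ∈ Z) (hs : IsMap s omega Z) :
    IsMap (cons a s) omega Z := by
  refine isMap_iff.2 ⟨isFun_mkFun, fun n hn => ?_⟩
  obtain rfl | ⟨m, hm, rfl⟩ := nat_cases hn
  · rwa [ap_cons_emp]
  · rw [ap_cons_succ hm]
    exact hs.ap_mem hm

theorem isMap_shift {Z s : V} (hs : IsMap s omega Z) : IsMap (shift s) omega Z :=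
  isMap_mkFun fun _ hn => hs.ap_mem (succ_mem_omega hn)

theorem cons_inj {a s t : V} (hs : IsFun s omega) (ht : IsFun t omega)
    (h : cons a s = cons a t) : s = t :=
  hs.ext ht fun n hn => by rw [← ap_cons_succ (a := a) hn, h, ap_cons_succ hn]

theorem cons_shift {s : V} (hs : IsFun s omega) : cons (ap s emp) (shift s) = s := by
  refine (isFun_mkFun : IsFun (cons _ _) omega).ext hs fun n hn => ?_
  obtain rfl | ⟨m, hm, rfl⟩ := nat_cases hn
  · exact ap_cons_emp
  · exact (ap_cons_succ hm).trans (ap_shift hm)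

/-- The exit position moves from `k` to `k + 1`. -/
theorem LeavesFrom.cons {A a s : V} (h : LeavesFrom A a s) :
    LeavesFrom A a (InternalZF.cons a s) := by
  obtain ⟨k, hk, hj, hkA⟩ := h
  refine ⟨succ k, succ_mem_omega hk, fun j hjk => ?_, by rwa [ap_cons_succ hk]⟩
  obtain rfl | ⟨m, hm, rfl⟩ := nat_cases (mem_omega_of_mem (succ_mem_omega hk) hjk)
  · exact ap_cons_emp
  · rw [ap_cons_succ hm]
    refine hj m ?_
    obtain h | h := mem_succ.1 hjk
    · exact nat_mem_trans hk (mem_succ.2 (Or.inr rfl)) h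
    · exact h ▸ mem_succ.2 (Or.inr rfl)

/-- A first entry in `A` rules out the exit position `0`. With the preceding lemma, prepending `a`
maps the leaving sequences bijectively onto the leaving sequences that start in `A`. -/
theorem LeavesFrom.shift {A a s : V} (h : LeavesFrom A a s) (hs : ap s emp ∈ A) :
    ap s emp = a ∧ LeavesFrom A a (InternalZF.shift s) := by
  obtain ⟨k, hk, hj, hkA⟩ := h
  obtain rfl | ⟨m, hm, rfl⟩ := nat_cases hk
  · exact (hkA hs).elim
  · refine ⟨hj _ (emp_mem_succ hm), m, hm, fun j hjm => ?_, by rwa [ap_shift hm]⟩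
    rw [ap_shift (mem_omega_of_mem hm hjm)]
    exact hj _ (succ_mem_succ hm hjm)

/-- The sequences in `Z` with first entry in `A`, together with one additional point. -/
noncomputable def pointedSeq (Z A : V) : V :=
  union (sep (maps omega Z) fun s => ap s emp ∈ A) (upair (maps omega Z) (maps omega Z))

theorem mem_pointedSeq {Z A s : V} :
    s ∈ pointedSeq Z A ↔ (IsMap s omega Z ∧ ap s emp ∈ A) ∨ s = maps omega Z := by
  simp only [pointedSeq, mem_union, mem_sep, mem_maps, mem_upair, or_self]

instance DFun.pointedSeq (a b : (ℕ → V) → V) [ha : DFun a] [hb : DFun b] :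
    DFun fun v => InternalZF.pointedSeq (a v) (b v) := by
  have := ha.shift; have := hb.shift
  unfold InternalZF.pointedSeq; infer_instance

/-- The additional point `maps omega Z` differs from every sequence, by foundation. -/
theorem not_isMap_maps {Z : V} : ¬ IsMap (maps omega Z) omega Z := fun h =>
  mem_irrefl _ (mem_maps.2 h)

/-- Shifting the sequences that leave `{a}` to a point outside of `A` is a bijection. -/
theorem exists_bijection_pointedSeq {Z A a : V} (hA : ∀ x, x ∈ A → x ∈ Z) (ha : a ∈ A) :
    ∃ h, IsMap h (pointedSeq Z Z) (pointedSeq Z A) ∧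
      ∀ y, y ∈ pointedSeq Z A → ∃! x, App h x y := by
  -- Leaving sequences receive another `a` in front; all other sequences, and the additional point,
  -- stay fixed. The point is excluded explicitly because it is no sequence and `LeavesFrom` says
  -- nothing useful about it.
  let h := mkFun (pointedSeq Z Z) fun s => if LeavesFrom A a s ∧ ¬ s = maps omega Z
    then cons a s else s
  have hfun : IsFun h (pointedSeq Z Z) := isFun_mkFun
  have hpos : ∀ {s}, IsMap s omega Z → LeavesFrom A a s → ap h s = cons a s := fun {s} hs hl => by
    have hne : s ≠ maps omega Z := fun e => not_isMap_maps (e ▸ hs)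
    simp only [h]
    rw [ap_mkFun (mem_pointedSeq.2 (Or.inl ⟨hs, hs.ap_mem emp_mem_omega⟩)), if_pos ⟨hl, hne⟩]
  have hneg : ∀ {s}, IsMap s omega Z → ¬ LeavesFrom A a s → ap h s = s := fun {s} hs hl => by
    simp only [h]
    rw [ap_mkFun (mem_pointedSeq.2 (Or.inl ⟨hs, hs.ap_mem emp_mem_omega⟩)),
      if_neg fun h => hl h.1]
  have hpt : ap h (maps omega Z) = maps omega Z := by
    simp only [h]
    rw [ap_mkFun (mem_pointedSeq.2 (Or.inr rfl)), if_neg fun h => h.2 rfl]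
  have hmem : ∀ {s}, IsMap s omega Z → IsMap (ap h s) omega Z ∧ ap (ap h s) emp ∈ A := by
    intro s hs
    by_cases hl : LeavesFrom A a s
    · rw [hpos hs hl, ap_cons_emp]
      exact ⟨isMap_cons (hA a ha) hs, ha⟩
    · rw [hneg hs hl]
      -- A sequence that starts outside of `A` leaves at position `0`; hence one that does not leave
      -- already starts in `A`.
      refine ⟨hs, by_contra fun h => hl ⟨emp, emp_mem_omega, fun j hj => ?_, h⟩⟩
      exact (notMem_emp j hj).elim
  refine ⟨h, isMap_iff.2 ⟨hfun, fun s hs => mem_pointedSeq.2 ?_⟩, fun y hy => ?_⟩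
  · obtain ⟨hs, -⟩ | rfl := mem_pointedSeq.1 hs
    · exact Or.inl (hmem hs)
    · exact Or.inr hpt
  · obtain ⟨hy, hyA⟩ | rfl := mem_pointedSeq.1 hy
    · have hx : ∀ {x}, App h x y → IsMap x omega Z ∧ y = ap h x := fun {x} hx => by
        obtain ⟨hxm, e⟩ := hfun.app_iff.1 hx
        obtain ⟨hxm, -⟩ | rfl := mem_pointedSeq.1 hxm
        · exact ⟨hxm, e⟩
        · exact (not_isMap_maps (hpt ▸ e ▸ hy)).elim
      have happ : ∀ {x}, IsMap x omega Z → ap h x = y → App h x y := fun {x} hx e =>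
        hfun.app_iff.2 ⟨mem_pointedSeq.2 (Or.inl ⟨hx, hx.ap_mem emp_mem_omega⟩), e.symm⟩
      -- The preimage is the shift of `y` if `y` leaves, and `y` itself otherwise. The cases do not
      -- mix, since `h` maps leaving sequences to leaving ones.
      by_cases hl : LeavesFrom A a y
      · obtain ⟨e, hl'⟩ := hl.shift hyA
        have hsh := isMap_shift hy
        have hcons : cons a (shift y) = y := e ▸ cons_shift hy.1
        refine ⟨shift y, happ hsh ((hpos hsh hl').trans hcons), fun x hxy => ?_⟩
        obtain ⟨hxm, e'⟩ := hx hxy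
        by_cases hlx : LeavesFrom A a x
        · exact cons_inj (a := a) hxm.1 hsh.1 (by rw [hcons, ← hpos hxm hlx, e'])
        · rw [hneg hxm hlx] at e'
          exact (hlx (e' ▸ hl)).elim
      · refine ⟨y, happ hy (hneg hy hl), fun x hxy => ?_⟩
        obtain ⟨hxm, e'⟩ := hx hxy
        by_cases hlx : LeavesFrom A a x
        · rw [hpos hxm hlx] at e'
          exact (hl (e' ▸ hlx.cons)).elim
        · rw [hneg hxm hlx] at e'
          exact e'.symm
    · refine ⟨_, hfun.app_iff.2 ⟨mem_pointedSeq.2 (Or.inr rfl), hpt.symm⟩, fun x hx => ?_⟩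
      obtain ⟨hxm, e⟩ := hfun.app_iff.1 hx
      obtain ⟨hxm, -⟩ | rfl := mem_pointedSeq.1 hxm
      · exact (not_isMap_maps (e ▸ (hmem hxm).1)).elim
      · rfl

end Sequences

/-! ### Pure sets: from the `Σ₁` statements back to the choice principle. -/

section EmptyLanguage

set_option linter.unusedSectionVars false
set_option synthInstance.maxHeartbeats 400000
set_option synthInstance.maxSize 5000

variable {V : Type u} [Membership V V] [hV : ZFModel V] {L : Lang V} {I U : V}

open Classical

/-! ### The sentence "there are two elements" -/

/-- `∃ v₀ ∃ v₁ ¬ v₀ = v₁`. -/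
noncomputable def twoElements : V := exF (exF (notF (eqF (var emp) (var (succ emp)))))

theorem one_mem_omega : (succ emp : V) ∈ (omega : V) := succ_mem_omega emp_mem_omega

theorem two_mem_omega : (succ (succ emp) : V) ∈ (omega : V) := succ_mem_omega one_mem_omega

theorem emp_mem_two : (emp : V) ∈ (succ (succ emp) : V) := emp_mem_succ one_mem_omega

theorem one_mem_two : (succ emp : V) ∈ (succ (succ emp) : V) := mem_succ.2 (Or.inr rfl)

theorem isAtomic_var_eq_var :
    IsAtomic L (succ (succ emp)) (eqF (var emp) (var (succ emp))) :=
  isAtomic_iff.2 (Or.inl ⟨_, _, isTerm_var emp_mem_two, isTerm_var one_mem_two, rfl⟩)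

theorem isSigma_twoElements : IsSigma L 1 emp twoElements := by
  intro Z hZ hex
  refine hex emp (succ emp) _ _ (mem_omega.1 emp_mem_omega) (isSucc_iff.2 rfl) ?_ (isEx_iff.2 rfl)
  refine hex (succ emp) _ _ _ (mem_omega.1 one_mem_omega) (isSucc_iff.2 rfl) ?_ (isEx_iff.2 rfl)
  refine hZ _ _ (mem_omega.1 two_mem_omega) fun X hX => ?_
  exact hX.not _ _ (hX.atomic _ isAtomic_var_eq_var) (isNot_iff.2 rfl)

/-- The assignment `v₀ ↦ x, v₁ ↦ y`. -/
noncomputable def assign₂ (x y : V) : V := extend (extend emp emp x) (succ emp) y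

instance DFun.assign₂ (a b : (ℕ → V) → V) [ha : DFun a] [hb : DFun b] :
    DFun fun v => InternalZF.assign₂ (a v) (b v) := by
  unfold InternalZF.assign₂; infer_instance

theorem isMap_assign₁ {D x : V} (hx : x ∈ D) : IsMap (extend emp emp x) (succ emp) D :=
  isMap_extend isMap_emp hx

theorem isMap_assign₂ {D x y : V} (hx : x ∈ D) (hy : y ∈ D) :
    IsMap (assign₂ x y) (succ (succ emp)) D := isMap_extend (isMap_assign₁ hx) hy

theorem ap_assign₂_emp {x y : V} : ap (assign₂ x y) emp = x := by
  have h1 : IsFun (extend emp emp x) (succ emp) :=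
    isFun_extend (isMap_emp (D := emp)).1
  rw [assign₂, ap_extend_of_mem h1 (mem_succ.2 (Or.inr rfl)),
    ap_extend_self (isMap_emp (D := emp)).1]

theorem ap_assign₂_one {x y : V} : ap (assign₂ x y) (succ emp) = y :=
  ap_extend_self (isFun_extend (isMap_emp (D := emp)).1)

theorem models_twoElements (hL : IsLang L) {M : Str V} (hM : IsStr L M) :
    Models L M twoElements ↔ ∃ x y, x ∈ M.dom ∧ y ∈ M.dom ∧ x ≠ y := by
  have hT := isTruth_sat hL M
  have hat := isFormula_atomic (L := L) two_mem_omega isAtomic_var_eq_var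
  have hnot := isFormula_not two_mem_omega hat
  rw [models_iff, twoElements, hT.ex _ _ _ emp_mem_omega isMap_emp
    (isFormula_ex one_mem_omega hnot)]
  have key : ∀ x y, x ∈ M.dom → y ∈ M.dom →
      (Sat L M (notF (eqF (var emp) (var (succ emp)))) (assign₂ x y) ↔ x ≠ y) := by
    intro x y hx hy
    have hs := isMap_assign₂ hx hy
    rw [hT.not _ _ _ two_mem_omega hs hat, sat_eq hL hM two_mem_omega hs
      (isTerm_var emp_mem_two) (isTerm_var one_mem_two), tv_var hL hM two_mem_omega hs emp_mem_two,
      tv_var hL hM two_mem_omega hs one_mem_two, ap_assign₂_emp, ap_assign₂_one]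
  constructor
  · rintro ⟨x, hx, h⟩
    rw [hT.ex _ _ _ one_mem_omega (isMap_assign₁ hx) hnot] at h
    obtain ⟨y, hy, h⟩ := h
    exact ⟨x, y, hx, hy, (key x y hx hy).1 h⟩
  · rintro ⟨x, y, hx, hy, h⟩
    refine ⟨x, hx, ?_⟩
    rw [hT.ex _ _ _ one_mem_omega (isMap_assign₁ hx) hnot]
    exact ⟨y, hy, (key x y hx hy).2 h⟩

/-! ### Structures for the empty language -/

/-- The language without symbols. -/
noncomputable def emptyLang : Lang V := ⟨emp, emp, emp, emp⟩

theorem not_app_emp {x y : V} : ¬ App emp x y := fun h => notMem_emp _ (app_iff.1 h)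

theorem isLang_emptyLang : IsLang (emptyLang : Lang V) :=
  ⟨(isMap_emp (D := emp)).1, fun _ _ h => (not_app_emp h).elim, (isMap_emp (D := emp)).1,
    fun _ _ h => (not_app_emp h).elim⟩

/-- The set `D` as a structure for the empty language. -/
noncomputable def setStr (D : V) : Str V := ⟨D, emp, emp⟩

theorem isStr_setStr {D : V} (hD : ∃ x, x ∈ D) : IsStr emptyLang (setStr D) :=
  ⟨hD, fun p h => (notMem_emp p h).elim, fun _ _ _ h => (not_app_emp h).elim,
    fun p h => (notMem_emp p h).elim⟩

theorem isIso_setStr {D E h : V} (hh : IsMap h D E) (hb : ∀ y, y ∈ E → ∃! x, App h x y) :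
    IsIso emptyLang (setStr D) (setStr E) h :=
  ⟨hh, hb, fun _ _ _ _ _ _ h => (not_app_emp h).elim, fun _ _ _ _ h => (not_app_emp h).elim⟩

/-- The family of the sets `D(i)`. -/
noncomputable def setFam (D : V) : Fam V :=
  ⟨D, mkFun I fun _ => emp, mkFun I fun _ => emp⟩

variable {D : V}

theorem setFam_at_iff (hD : IsFun D I) {i : V} {M : Str V} :
    (setFam (I := I) D).At i M ↔ i ∈ I ∧ M = setStr (ap D i) := by
  simp only [Fam.At, setFam, hD.app_iff, app_mkFun, Str.ext_iff, setStr]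
  tauto

theorem isFam_setFam (hD : IsFun D I) (hne : ∀ i, i ∈ I → ∃ x, x ∈ ap D i) :
    IsFam emptyLang I (setFam (I := I) D) :=
  ⟨hD, isFun_mkFun, isFun_mkFun, fun i M h => by
    obtain ⟨hi, rfl⟩ := (setFam_at_iff hD).1 h
    exact isStr_setStr (hne i hi)⟩

/-- Sets in bijection with a common set are isomorphic. -/
theorem isomorphic_setStr_of_common {N D E h k : V} (hh : IsMap h N D)
    (hhb : ∀ y, y ∈ D → ∃! x, App h x y) (hk : IsMap k N E)
    (hkb : ∀ y, y ∈ E → ∃! x, App k x y) :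
    Isomorphic emptyLang (setStr D) (setStr E) := by
  -- The inverse of `h`; the isomorphism is `k ∘ h⁻¹`.
  let inv : V → V := fun y => the fun x => App h x y
  have hinv : ∀ {y}, y ∈ D → inv y ∈ N ∧ ap h (inv y) = y := fun {y} hy => by
    have := hh.1.app_iff.1 (the_spec (P := fun x => App h x y) (hhb y hy))
    exact ⟨this.1, this.2.symm⟩
  have hinv' : ∀ {x}, x ∈ N → inv (ap h x) = x := fun {x} hx =>
    (hhb _ (hh.ap_mem hx)).unique (the_spec (P := fun z => App h z (ap h x)) (hhb _ (hh.ap_mem hx))) (hh.1.app hx)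
  have hfun : IsFun (mkFun D fun y => ap k (the fun x => App h x y)) D := isFun_mkFun
  have hap : ∀ {y}, y ∈ D → ap (mkFun D fun y => ap k (the fun x => App h x y)) y = ap k (inv y) :=
    fun hy => ap_mkFun hy
  refine ⟨_, isIso_setStr (isMap_iff.2 ⟨hfun, fun y hy => ?_⟩) fun z hz => ?_⟩
  · rw [hap hy]
    exact hk.ap_mem (hinv hy).1
  · obtain ⟨x, hx, hu⟩ := hkb z hz
    obtain ⟨hxN, rfl⟩ := hk.1.app_iff.1 hx
    refine ⟨ap h x, hfun.app_iff.2 ⟨hh.ap_mem hxN, by rw [hap (hh.ap_mem hxN), hinv' hxN]⟩,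
      fun y hy => ?_⟩
    obtain ⟨hyD, e⟩ := hfun.app_iff.1 hy
    rw [hap hyD] at e
    rw [← hu (inv y) (hk.1.app_iff.2 ⟨(hinv hyD).1, e⟩), (hinv hyD).2]

/-! ### The family of pointed sets of sequences -/

section PointedFamily

variable {A : V}

/-- The union of the `A(i)`. -/
noncomputable def rangeUnion (I A : V) : V := sUnion (img I (ap A))

theorem mem_rangeUnion {i x : V} (hi : i ∈ I) (hx : x ∈ ap A i) : x ∈ rangeUnion I A :=
  mem_sUnion.2 ⟨_, mem_img.2 ⟨i, hi, rfl⟩, hx⟩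

variable (I A) in
/-- The sets of sequences with first entry in `A(i)`, together with one additional point. -/
noncomputable def pointedFam : V := mkFun I fun i => pointedSeq (rangeUnion I A) (ap A i)

theorem isFun_pointedFam : IsFun (pointedFam I A) I := isFun_mkFun

theorem ap_pointedFam {i : V} (hi : i ∈ I) :
    ap (pointedFam I A) i = pointedSeq (rangeUnion I A) (ap A i) := ap_mkFun hi

theorem isFam_pointedFam : IsFam emptyLang I (setFam (I := I) (pointedFam I A)) :=
  isFam_setFam isFun_pointedFam fun i hi => by
    rw [ap_pointedFam hi]
    exact ⟨_, mem_pointedSeq.2 (Or.inr rfl)⟩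

/-- The additional point is the same in all members of the family: this is what keeps the product
nonempty without choice. -/
theorem exists_inProd_pointedFam : ∃ g, InProd I (setFam (I := I) (pointedFam I A)) g := by
  obtain ⟨c, hc⟩ : ∃ c, c = maps omega (rangeUnion I A) := ⟨_, rfl⟩
  refine ⟨mkFun I fun _ => c, isFam_pointedFam.inProd_iff.2 ⟨isFun_mkFun, fun i hi => ?_⟩⟩
  change _ ∈ ap (pointedFam I A) i
  rw [ap_mkFun hi, ap_pointedFam hi]
  exact mem_pointedSeq.2 (Or.inr hc)

/-- The additional point and a constant sequence. -/
theorem exists_ne_mem_pointedSeq {Z B : V} (hB : ∃ a, a ∈ B) (hBZ : ∀ a, a ∈ B → a ∈ Z) :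
    ∃ x y, x ∈ pointedSeq Z B ∧ y ∈ pointedSeq Z B ∧ x ≠ y := by
  obtain ⟨a, ha⟩ := hB
  have hs : IsMap (mkFun omega fun _ => a) omega Z := isMap_mkFun fun _ _ => hBZ a ha
  refine ⟨_, _, mem_pointedSeq.2 (Or.inr rfl), mem_pointedSeq.2 (Or.inl ⟨hs, ?_⟩), ?_⟩
  · rwa [ap_mkFun emp_mem_omega]
  · exact fun e => not_isMap_maps (e ▸ hs)

/-- Two distinct elements of the ultraproduct choose from the `A(i)`. -/
theorem exists_choice_of_ultraproduct (hU : IsUltrafilter U I) (hA : IsFun A I) {P : Str V}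
    (hP : IsUltraproduct emptyLang I U (setFam (I := I) (pointedFam I A)) P)
    (h : ∃ x y, x ∈ P.dom ∧ y ∈ P.dom ∧ x ≠ y) :
    ∃ f, IsFun f I ∧ Large U I fun i => ∃ a x, App A i a ∧ App f i x ∧ x ∈ a := by
  obtain ⟨x, y, hx, hy, hxy⟩ := h
  have hF := isFam_pointedFam (I := I) (A := A)
  obtain ⟨g, hg, rfl⟩ := (hP.mem_dom_iff isLang_emptyLang hU hF).1 hx
  obtain ⟨k, hk, rfl⟩ := (hP.mem_dom_iff isLang_emptyLang hU hF).1 hy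
  rw [Ne, cls_eq_iff hU hk, ← large_not hU] at hxy
  have hg' := (hF.mem_prodSet_iff.1 hg).2
  have hk' := (hF.mem_prodSet_iff.1 hk).2
  -- Where the two representatives differ, at most one of them is the additional point. Take the
  -- first entry of `k(i)` if `g(i)` is that point, and of `g(i)` otherwise.
  have hfun : IsFun (mkFun I fun i => if ap g i = maps omega (rangeUnion I A)
    then ap (ap k i) emp else ap (ap g i) emp) I := isFun_mkFun
  refine ⟨_, hfun, hxy.mono hU fun i hi hne => ⟨_, _, hA.app hi, hfun.app hi, ?_⟩⟩
  have h1 : ap g i ∈ pointedSeq (rangeUnion I A) (ap A i) := by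
    rw [← ap_pointedFam hi]
    exact hg' i hi
  have h2 : ap k i ∈ pointedSeq (rangeUnion I A) (ap A i) := by
    rw [← ap_pointedFam hi]
    exact hk' i hi
  rw [ap_mkFun hi]
  rw [mem_pointedSeq] at h1 h2
  split
  · next e =>
    obtain h2 | h2 := h2
    · exact h2.2
    · exact (hne (e.trans h2.symm)).elim
  · next e => exact (h1.resolve_right e).2

end PointedFamily

/-- The members of `pointedFam` are pairwise isomorphic, both being in bijection with all sequences
plus the point. Each has two elements; so, by `Σ₁`-equivalence, has the ultraproduct. -/
theorem UltraproductSigmaOneFactor.ultrafilterAC (h : UltraproductSigmaOneFactor U I)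
    (hU : IsUltrafilter U I) : UltrafilterAC U I := by
  intro A hA hne
  have hne' : ∀ i, i ∈ I → ∃ x, x ∈ ap A i := fun i hi => hne i _ (hA.app hi)
  have hbij := fun i (hi : i ∈ I) => (hne' i hi).elim fun a ha =>
    exists_bijection_pointedSeq (fun x => mem_rangeUnion (A := A) hi) ha
  obtain ⟨P, hP, hPM⟩ := h emptyLang _ isLang_emptyLang (isFam_pointedFam (I := I) (A := A))
    (fun i j M N hM hN => by
      obtain ⟨hi, rfl⟩ := (setFam_at_iff isFun_pointedFam).1 hM
      obtain ⟨hj, rfl⟩ := (setFam_at_iff isFun_pointedFam).1 hN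
      rw [ap_pointedFam hi, ap_pointedFam hj]
      obtain ⟨h₁, h₁m, h₁b⟩ := hbij i hi
      obtain ⟨h₂, h₂m, h₂b⟩ := hbij j hj
      exact isomorphic_setStr_of_common h₁m h₁b h₂m h₂b) exists_inProd_pointedFam
  -- `I` is nonempty because `I ∈ U`.
  obtain ⟨i, hi, -⟩ := (large_of_forall hU (Q := fun _ => True) fun _ _ => trivial).exists hU
  have hat := (setFam_at_iff (isFun_pointedFam (A := A))).2 ⟨hi, rfl⟩
  refine exists_choice_of_ultraproduct hU hA hP ((models_twoElements isLang_emptyLang hP.isStr).1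
    ((hPM i _ hi hat _ _ (isEmptySet_iff.2 rfl) isSigma_twoElements).2
      ((models_twoElements isLang_emptyLang (isFam_pointedFam.isStr i _ hat)).2 ?_)))
  change ∃ x y, x ∈ ap (pointedFam I A) i ∧ y ∈ ap (pointedFam I A) i ∧ x ≠ y
  rw [ap_pointedFam hi]
  exact exists_ne_mem_pointedSeq (hne' i hi) fun x => mem_rangeUnion hi

/-- The comparison is with the constant family of all sequences plus the point, whose ultrapower has
two elements for trivial reasons. -/
theorem IsomorphicFactorsSigmaOne.ultrafilterAC (h : IsomorphicFactorsSigmaOne U I)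
    (hU : IsUltrafilter U I) : UltrafilterAC U I := by
  intro A hA hne
  have hne' : ∀ i, i ∈ I → ∃ x, x ∈ ap A i := fun i hi => hne i _ (hA.app hi)
  let Z := rangeUnion I A
  obtain ⟨i, hi, -⟩ := (large_of_forall hU (Q := fun _ => True) fun _ _ => trivial).exists hU
  obtain ⟨x, y, hx, hy, hxy⟩ := exists_ne_mem_pointedSeq (Z := Z) (B := Z)
    ((hne' i hi).elim fun a ha => ⟨a, mem_rangeUnion hi ha⟩) fun _ => id
  have hN : IsStr emptyLang (setStr (pointedSeq Z Z)) := isStr_setStr ⟨x, hx⟩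
  have hG := isFam_constFam (I := I) hN
  have hat : ∀ j, j ∈ I → (constFam I (setStr (pointedSeq Z Z))).At j (setStr (pointedSeq Z Z)) :=
    fun j hj => constFam_at_iff.2 ⟨hj, rfl⟩
  obtain ⟨P, Q, hP, hQ, hPQ⟩ := h emptyLang _ _ isLang_emptyLang hG
    (isFam_pointedFam (I := I) (A := A)) (fun i M N hi hM hN => by
      obtain ⟨-, rfl⟩ := constFam_at_iff.1 hM
      obtain ⟨-, rfl⟩ := (setFam_at_iff isFun_pointedFam).1 hN
      obtain ⟨a, ha⟩ := hne' i hi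
      rw [ap_pointedFam hi]
      obtain ⟨h, hm, hb⟩ := exists_bijection_pointedSeq (fun x => mem_rangeUnion (A := A) hi) ha
      exact ⟨h, isIso_setStr hm hb⟩)
    (exists_inProd_of_const hG hN hat) exists_inProd_pointedFam
  refine exists_choice_of_ultraproduct hU hA hQ ((models_twoElements isLang_emptyLang hQ.isStr).1
    ((hPQ _ _ (isEmptySet_iff.2 rfl) isSigma_twoElements).1
      ((models_twoElements isLang_emptyLang hP.isStr).2 ?_)))
  -- Two distinct elements of the common structure give constant functions that differ everywhere,
  -- hence distinct classes.
  have hmem : ∀ {w}, w ∈ pointedSeq Z Z →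
      mkFun I (fun _ => w) ∈ prodSet I (constFam I (setStr (pointedSeq Z Z))) := fun {w} hw => by
    refine hG.mem_prodSet_iff.2 ⟨isFun_mkFun, fun j hj => ?_⟩
    rw [ap_mkFun hj, ← (hG.at_iff.1 (hat j hj)).2]
    exact hw
  refine ⟨_, _, hP.cls_mem isLang_emptyLang hU hG (hmem hx),
    hP.cls_mem isLang_emptyLang hU hG (hmem hy), fun e => ?_⟩
  rw [cls_eq_iff hU (hmem hy)] at e
  obtain ⟨j, hj, e⟩ := e.exists hU
  rw [ap_mkFun hj, ap_mkFun hj] at e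
  exact hxy e

end EmptyLanguage

end InternalZF

/-! ### Block structures: from mutual elementary embeddability back to the choice principle. -/

namespace InternalZF

section BlockStructures

set_option linter.unusedSectionVars false
set_option synthInstance.maxHeartbeats 400000
set_option synthInstance.maxSize 5000

variable {V : Type u} [Membership V V] [hV : ZFModel V] {L : Lang V} {I U : V}

open Classical

/-! ### Avoiding finitely many values -/

/-- An injective sequence is not exhausted by finitely many values, with finiteness in the sense of
`V`. It provides fresh elements and fresh blocks. -/
theorem exists_finite_avoid (F e : V → V) [dF : DFun fun v : ℕ → V => F (v 0)]
    [de : DFun fun v : ℕ → V => e (v 0)]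
    (he : ∀ K K', K ∈ (omega : V) → K' ∈ (omega : V) → e K = e K' → K = K') {n : V}
    (hn : n ∈ (omega : V)) : ∃ K, K ∈ (omega : V) ∧ ∀ k, k ∈ n → F k ≠ e K := by
  have := fun a [ha : DFun a] => dF.comp1 (a := a) ha
  have := fun a [ha : DFun a] => de.comp1 (a := a) ha
  -- Strengthened for the induction: all indices beyond some bound `B` work.
  have key : ∃ B, B ∈ (omega : V) ∧ ∀ K, K ∈ (omega : V) → B ∈ K → ∀ k, k ∈ n → F k ≠ e K := by
    refine nat_induction (fun n => ∃ B, B ∈ (omega : V) ∧ ∀ K, K ∈ (omega : V) → B ∈ K →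
      ∀ k, k ∈ n → F k ≠ e K) ?_ ?_ hn
    · exact ⟨emp, emp_mem_omega, fun _ _ _ k hk => (notMem_emp k hk).elim⟩
    · rintro n - ⟨B, hB, h⟩
      by_cases hex : ∃ K, K ∈ (omega : V) ∧ F n = e K
      · obtain ⟨J, hJ, hFJ⟩ := hex
        -- `C` is the maximum of `B` and `J`; beyond it, injectivity of `e` excludes the value `e
        -- J`.
        obtain ⟨C, hC, hBC, hJC⟩ : ∃ C, C ∈ (omega : V) ∧ (∀ K, K ∈ (omega : V) → C ∈ K → B ∈ K) ∧
            ∀ K, K ∈ (omega : V) → C ∈ K → J ∈ K := by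
          obtain h | rfl | h := nat_trichotomy hB hJ
          · exact ⟨J, hJ, fun K hK hJK => nat_mem_trans hK h hJK, fun _ _ => id⟩
          · exact ⟨_, hJ, fun _ _ => id, fun _ _ => id⟩
          · exact ⟨B, hB, fun _ _ => id, fun K hK hBK => nat_mem_trans hK h hBK⟩
        refine ⟨C, hC, fun K hK hCK k hk => ?_⟩
        obtain hk | rfl := mem_succ.1 hk
        · exact h K hK (hBC K hK hCK) k hk
        · intro e'
          have := he J K hJ hK (hFJ.symm.trans e')
          exact mem_irrefl K (this ▸ hJC K hK hCK)
      · refine ⟨B, hB, fun K hK hBK k hk => ?_⟩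
        obtain hk | rfl := mem_succ.1 hk
        · exact h K hK hBK k hk
        · exact fun e' => hex ⟨K, hK, e'⟩
  obtain ⟨B, hB, h⟩ := key
  exact ⟨succ B, succ_mem_omega hB, h _ (succ_mem_omega hB) (mem_succ.2 (Or.inr rfl))⟩

/-! ### Structures with one binary relation symbol -/

/-- The first component of a pair. -/
noncomputable def fst (p : V) : V := the fun x => ∃ y, p = pair x y

/-- The second component of a pair. -/
noncomputable def snd (p : V) : V := the fun y => ∃ x, p = pair x y

instance DFun.fst (a : (ℕ → V) → V) [ha : DFun a] : DFun fun v => InternalZF.fst (a v) := by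
  have := ha.shift
  unfold InternalZF.fst; infer_instance

instance DFun.snd (a : (ℕ → V) → V) [ha : DFun a] : DFun fun v => InternalZF.snd (a v) := by
  have := ha.shift
  unfold InternalZF.snd; infer_instance

theorem fst_pair (x y : V) : fst (pair x y) = x :=
  the_eq ⟨y, rfl⟩ fun _ ⟨_, h⟩ => (pair_inj.1 h).1.symm

theorem snd_pair (x y : V) : snd (pair x y) = y :=
  the_eq ⟨x, rfl⟩ fun _ ⟨_, h⟩ => (pair_inj.1 h).2.symm

/-- The language with one binary relation symbol. -/
noncomputable def binLang : Lang V :=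
  ⟨emp, emp, upair emp emp, mkFun (upair emp emp) fun _ => succ (succ emp)⟩

theorem binLang_relAr_iff {R n : V} :
    App binLang.relAr R n ↔ R = emp ∧ n = succ (succ emp) := by
  simp only [binLang, app_mkFun, mem_upair, or_self]

theorem isLang_binLang : IsLang (binLang : Lang V) :=
  ⟨(isMap_emp (D := emp)).1, fun _ _ h => (not_app_emp h).elim, isFun_mkFun,
    fun _ _ h => mem_omega.1 ((binLang_relAr_iff.1 h).2 ▸ two_mem_omega)⟩

theorem mem_two {k : V} : k ∈ (succ (succ emp) : V) ↔ k = emp ∨ k = succ emp := by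
  simp only [mem_succ, notMem_emp, false_or]

theorem eq_assign₂ {s : V} (hs : IsFun s (succ (succ emp))) :
    s = assign₂ (ap s emp) (ap s (succ emp)) := by
  refine hs.ext (isFun_extend (isFun_extend (isMap_emp (D := emp)).1)) fun k hk => ?_
  obtain rfl | rfl := mem_two.1 hk
  · exact ap_assign₂_emp.symm
  · exact ap_assign₂_one.symm

/-- `∃ v₀ ∀ v₁ ¬ R(v₀, v₁)`. -/
noncomputable def existsIsolated : V :=
  exF (allF (notF (relF emp (mkFun (succ (succ emp)) InternalZF.var))))

theorem isTermSeq_var : IsTermSeq L (succ (succ emp)) (succ (succ emp))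
    (mkFun (succ (succ emp)) InternalZF.var) :=
  isTermSeq_iff.2 ⟨isFun_mkFun, fun k hk => by
    rw [ap_mkFun hk]
    exact isTerm_var hk⟩

theorem isAtomic_rel_var : IsAtomic binLang (succ (succ emp))
    (relF emp (mkFun (succ (succ emp)) InternalZF.var) : V) :=
  isAtomic_iff.2 (Or.inr ⟨_, _, _, binLang_relAr_iff.2 ⟨rfl, rfl⟩, isTermSeq_var, rfl⟩)

theorem isSigma_existsIsolated : IsSigma (binLang : Lang V) 2 emp existsIsolated := by
  intro Z hZ hex
  refine hex emp (succ emp) _ _ (mem_omega.1 emp_mem_omega) (isSucc_iff.2 rfl) ?_ (isEx_iff.2 rfl)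
  refine hZ _ _ (mem_omega.1 one_mem_omega) fun Z' hZ' hall => ?_
  refine hall (succ emp) _ _ _ (mem_omega.1 one_mem_omega) (isSucc_iff.2 rfl) ?_ (isAll_iff.2 rfl)
  refine hZ' _ _ (mem_omega.1 two_mem_omega) fun X hX => ?_
  exact hX.not _ _ (hX.atomic _ isAtomic_rel_var) (isNot_iff.2 rfl)

theorem models_existsIsolated {M : Str V} (hM : IsStr binLang M) :
    Models binLang M existsIsolated ↔
      ∃ x, x ∈ M.dom ∧ ∀ y, y ∈ M.dom → ¬ RelHolds M emp (assign₂ x y) := by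
  have hL : IsLang (binLang : Lang V) := isLang_binLang
  have hT := isTruth_sat hL M
  have hat := isFormula_atomic (L := binLang) (V := V) two_mem_omega isAtomic_rel_var
  have hnot := isFormula_not two_mem_omega hat
  rw [models_iff, existsIsolated, hT.ex _ _ _ emp_mem_omega isMap_emp
    (isFormula_all one_mem_omega hnot)]
  refine exists_congr fun x => and_congr_right fun hx => ?_
  rw [hT.all _ _ _ one_mem_omega (isMap_assign₁ hx) hnot]
  refine forall_congr' fun y => imp_congr_right fun hy => ?_
  have hs := isMap_assign₂ hx hy
  change Sat binLang M _ (assign₂ x y) ↔ _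
  rw [hT.not _ _ _ two_mem_omega hs hat, sat_rel hL hM two_mem_omega hs
    (binLang_relAr_iff.2 ⟨rfl, rfl⟩) isTermSeq_var]
  rw [isFun_mkFun.ext hs.1 fun k hk => ?_]
  rw [ap_mkFun hk, ap_mkFun hk, tv_var hL hM two_mem_omega hs hk]

/-- The relation clause of an ultraproduct for two elements in place of a tuple. -/
theorem IsUltraproduct.rel_assign₂ (hU : IsUltrafilter U I) {F : Fam V} (hF : IsFam binLang I F)
    {P : Str V} (hP : IsUltraproduct binLang I U F P) {f g : V} (hf : f ∈ prodSet I F)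
    (hg : g ∈ prodSet I F) : RelHolds P emp (assign₂ (cls I U F f) (cls I U F g)) ↔
      Large U I fun i => RelHolds (F.str i) emp (assign₂ (ap f i) (ap g i)) := by
  have h := hP.rel_clsSeq isLang_binLang hU hF (R := emp) (binLang_relAr_iff.2 ⟨rfl, rfl⟩)
    (isMap_assign₂ hf hg)
  rw [eq_assign₂ isFun_clsSeq, ap_clsSeq emp_mem_two, ap_clsSeq one_mem_two, ap_assign₂_emp,
    ap_assign₂_one] at h
  refine h.trans (large_congr hU fun i _ => ?_)
  rw [eq_assign₂ isFun_ev, ap_ev emp_mem_two, ap_ev one_mem_two, ap_assign₂_emp, ap_assign₂_one]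

/-! ### Block structures -/

/-- The set `D` of pairs with the relation between distinct pairs with the same first component. -/
noncomputable def blockStr (D : V) : Str V :=
  ⟨D, emp, sep (prod (upair emp emp) (maps (succ (succ emp)) D)) fun p =>
    fst (ap (snd p) emp) = fst (ap (snd p) (succ emp)) ∧ ap (snd p) emp ≠ ap (snd p) (succ emp)⟩

theorem relHolds_blockStr {D R s : V} : RelHolds (blockStr D) R s ↔
    R = emp ∧ IsMap s (succ (succ emp)) D ∧ fst (ap s emp) = fst (ap s (succ emp)) ∧
      ap s emp ≠ ap s (succ emp) := by
  rw [RelHolds, app_iff, blockStr, mem_sep, snd_pair, mem_prod]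
  constructor
  · rintro ⟨⟨x, y, hx, hy, e⟩, h⟩
    obtain ⟨rfl, rfl⟩ := pair_inj.1 e
    rw [mem_upair, or_self] at hx
    exact ⟨hx, mem_maps.1 hy, h⟩
  · rintro ⟨rfl, hs, h⟩
    exact ⟨⟨_, _, mem_upair.2 (Or.inl rfl), mem_maps.2 hs, rfl⟩, h⟩

theorem relHolds_blockStr_assign₂ {D x y : V} (hx : x ∈ D) (hy : y ∈ D) :
    RelHolds (blockStr D) emp (assign₂ x y) ↔ fst x = fst y ∧ x ≠ y := by
  rw [relHolds_blockStr, ap_assign₂_emp, ap_assign₂_one]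
  exact ⟨fun h => h.2.2, fun h => ⟨rfl, isMap_assign₂ hx hy, h⟩⟩

theorem isStr_blockStr {D : V} (hD : ∃ x, x ∈ D) : IsStr binLang (blockStr D) := by
  refine ⟨hD, fun p h => (notMem_emp p h).elim, fun _ _ _ h => (not_app_emp h).elim, fun p h => ?_⟩
  obtain ⟨R, s, hR, hs, rfl⟩ := mem_prod.1 (mem_sep.1 h).1
  rw [mem_upair, or_self] at hR
  exact ⟨R, _, s, binLang_relAr_iff.2 ⟨hR, rfl⟩, mem_maps.1 hs, isPair_iff.2 rfl⟩

/-- The tuples `s` and `s'` of pairs have the same coincidences of entries and of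
first components. -/
def Similar (n s s' : V) : Prop := ∀ k l, k ∈ n → l ∈ n → (ap s k = ap s l ↔ ap s' k = ap s' l) ∧
  (fst (ap s k) = fst (ap s l) ↔ fst (ap s' k) = fst (ap s' l))

instance Dfn.similar (a b c : (ℕ → V) → V) [ha : DFun a] [hb : DFun b] [hc : DFun c] :
    Dfn fun v => Similar (a v) (b v) (c v) := by
  have := ha.shift; have := hb.shift; have := hc.shift
  unfold Similar; infer_instance

theorem Similar.symm {n s s' : V} (h : Similar n s s') : Similar n s' s :=
  fun k l hk hl => ⟨(h k l hk hl).1.symm, (h k l hk hl).2.symm⟩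

theorem Similar.extend {n s s' d d' : V} (hs : IsFun s n) (hs' : IsFun s' n) (h : Similar n s s')
    (hd : ∀ k, k ∈ n → (ap s k = d ↔ ap s' k = d') ∧ (fst (ap s k) = fst d ↔ fst (ap s' k) = fst d')) :
    Similar (succ n) (InternalZF.extend s n d) (InternalZF.extend s' n d') := by
  intro k l hk hl
  obtain hk | rfl := mem_succ.1 hk <;> obtain hl | rfl := mem_succ.1 hl
  · rw [ap_extend_of_mem hs hk, ap_extend_of_mem hs' hk, ap_extend_of_mem hs hl,
      ap_extend_of_mem hs' hl]
    exact h k l hk hl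
  · rw [ap_extend_of_mem hs hk, ap_extend_of_mem hs' hk, ap_extend_self hs, ap_extend_self hs']
    exact hd k hk
  · rw [ap_extend_of_mem hs hl, ap_extend_of_mem hs' hl, ap_extend_self hs, ap_extend_self hs',
      eq_comm, eq_comm (a := d'), eq_comm (a := fst d), eq_comm (a := fst d')]
    exact hd l hl
  · simp only [iff_self, and_self]

/-- The first components of elements of `D` are infinitely many, each for infinitely many
elements of `D`. -/
structure IsRich (D : V) : Prop where
  old : ∀ n s x, n ∈ (omega : V) → IsMap s n D → x ∈ D →
    ∃ d, d ∈ D ∧ fst d = fst x ∧ ∀ k, k ∈ n → ap s k ≠ d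
  new : ∀ n s, n ∈ (omega : V) → IsMap s n D → ∃ d, d ∈ D ∧ ∀ k, k ∈ n → fst (ap s k) ≠ fst d

/-- The counter `K` inside a block makes each block infinite, and the counter `K` in the names of
the blocks makes the blocks infinitely many. -/
theorem isRich_of_exists {D : V}
    (h : ∀ x, x ∈ D → ∃ z, ∀ K, K ∈ (omega : V) → pair (fst x) (pair z K) ∈ D)
    (h' : ∃ i w, ∀ K, K ∈ (omega : V) → pair (pair K i) w ∈ D) : IsRich D := by
  refine ⟨fun n s x hn _ hx => ?_, fun n s hn _ => ?_⟩
  · obtain ⟨z, hz⟩ := h x hx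
    generalize fst x = p at hz
    obtain ⟨K, hK, hne⟩ := exists_finite_avoid (ap s) (fun K => pair p (pair z K))
      (fun K K' _ _ e => (pair_inj.1 (pair_inj.1 e).2).2) hn
    exact ⟨_, hz K hK, fst_pair _ _, hne⟩
  · obtain ⟨i, w, hiw⟩ := h'
    obtain ⟨K, hK, hne⟩ := exists_finite_avoid (fun k => fst (ap s k)) (fun K => pair K i)
      (fun K K' _ _ e => (pair_inj.1 e).1) hn
    refine ⟨_, hiw K hK, ?_⟩
    rwa [fst_pair]

/-- Three cases for the new entry `d`: it repeats an earlier entry; it is new but in the block of an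
earlier entry; its block is new. Richness of `E` provides an answer in the last two. -/
theorem Similar.exists_extend {E n s s' d : V} (hE : IsRich E) (hn : n ∈ (omega : V))
    (hs : IsFun s n) (hs' : IsMap s' n E) (h : Similar n s s') :
    ∃ d', d' ∈ E ∧ Similar (succ n) (InternalZF.extend s n d) (InternalZF.extend s' n d') := by
  by_cases h1 : ∃ k, k ∈ n ∧ ap s k = d
  · obtain ⟨k, hk, rfl⟩ := h1
    exact ⟨_, hs'.ap_mem hk, h.extend hs hs'.1 fun l hl => h l k hl hk⟩
  · have hne : ∀ k, k ∈ n → ap s k ≠ d := fun k hk e => h1 ⟨k, hk, e⟩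
    by_cases h2 : ∃ k, k ∈ n ∧ fst (ap s k) = fst d
    · obtain ⟨k, hk, e⟩ := h2
      obtain ⟨d', hd', e', hne'⟩ := hE.old n s' _ hn hs' (hs'.ap_mem hk)
      refine ⟨d', hd', h.extend hs hs'.1 fun l hl => ⟨iff_of_false (hne l hl) (hne' l hl), ?_⟩⟩
      rw [← e, e']
      exact (h l k hl hk).2
    · obtain ⟨d', hd', hne'⟩ := hE.new n s' hn hs'
      exact ⟨d', hd', h.extend hs hs'.1 fun l hl => ⟨iff_of_false (hne l hl)
        fun e => hne' l hl (e ▸ rfl), iff_of_false (fun e => h2 ⟨l, hl, e⟩) (hne' l hl)⟩⟩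

theorem isTerm_binLang_iff {n t : V} (hn : n ∈ (omega : V)) (h : IsTerm binLang n t) :
    ∃ k, k ∈ n ∧ t = InternalZF.var k :=
  (h.cases isLang_binLang hn).elim id fun ⟨_, _, _, h, _⟩ => (not_app_emp h).elim

/-- Similarity is a back-and-forth system by `Similar.exists_extend`. There are no function symbols,
so all terms are variables and atomic formulas only speak of coincidences of entries and of first
components. -/
theorem Similar.sat_iff {D E : V} (hD : IsRich D) (hE : IsRich E) (hDne : ∃ x, x ∈ D)
    (hEne : ∃ x, x ∈ E) {n φ s s' : V} (hφ : IsFormula binLang n φ) (hs : IsMap s n D)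
    (hs' : IsMap s' n E) (h : Similar n s s') :
    Sat binLang (blockStr D) φ s ↔ Sat binLang (blockStr E) φ s' := by
  have hL : IsLang (binLang : Lang V) := isLang_binLang
  have hM := isStr_blockStr hDne
  have hN := isStr_blockStr hEne
  refine sat_iff_of_backAndForth hL
    (fun n s s' => IsMap s n D ∧ IsMap s' n E ∧ Similar n s s')
    (fun n s s' h => ⟨h.1, h.2.1⟩) ?_ ?_ ?_ hφ ⟨hs, hs', h⟩
  · rintro n φ s s' hn hφ ⟨hs, hs', h⟩
    obtain ⟨t, r, ht, hr, rfl⟩ | ⟨R, m, ts, hR, hts, rfl⟩ := isAtomic_iff.1 hφ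
    · rw [sat_eq hL hM hn hs ht hr, sat_eq hL hN hn hs' ht hr]
      obtain ⟨k, hk, rfl⟩ := isTerm_binLang_iff hn ht
      obtain ⟨l, hl, rfl⟩ := isTerm_binLang_iff hn hr
      rw [tv_var hL hM hn hs hk, tv_var hL hM hn hs hl, tv_var hL hN hn hs' hk,
        tv_var hL hN hn hs' hl]
      exact (h k l hk hl).1
    · rw [sat_rel hL hM hn hs hR hts, sat_rel hL hN hn hs' hR hts, relHolds_blockStr,
        relHolds_blockStr]
      obtain ⟨rfl, rfl⟩ := binLang_relAr_iff.1 hR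
      have h0 := isMap_tv hL hM hn hs hts
      have h1 := isMap_tv hL hN hn hs' hts
      refine and_congr_right fun _ => (and_iff_right h0).trans (Iff.trans ?_ (and_iff_right h1).symm)
      obtain ⟨k, hk, ek⟩ := isTerm_binLang_iff hn ((isTermSeq_iff.1 hts).2 _ emp_mem_two)
      obtain ⟨l, hl, el⟩ := isTerm_binLang_iff hn ((isTermSeq_iff.1 hts).2 _ one_mem_two)
      rw [ap_mkFun emp_mem_two, ap_mkFun one_mem_two, ap_mkFun emp_mem_two, ap_mkFun one_mem_two,
        ek, el, tv_var hL hM hn hs hk, tv_var hL hM hn hs hl, tv_var hL hN hn hs' hk,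
        tv_var hL hN hn hs' hl]
      exact and_congr (h k l hk hl).2 (not_congr (h k l hk hl).1)
  · rintro n s s' d hn ⟨hs, hs', h⟩ hd
    obtain ⟨d', hd', h'⟩ := h.exists_extend (d := d) hE hn hs.1 hs'
    exact ⟨d', hd', isMap_extend hs hd, isMap_extend hs' hd', h'⟩
  · rintro n s s' d' hn ⟨hs, hs', h⟩ hd'
    obtain ⟨d, hd, h'⟩ := h.symm.exists_extend (d := d') hD hn hs'.1 hs
    exact ⟨d, hd, isMap_extend hs hd, isMap_extend hs' hd', h'.symm⟩

/-- A map that preserves and reflects equality and blocks sends each tuple to a similar one. No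
choice is needed to verify elementarity. -/
theorem isElementaryEmbedding_blockStr {D E j : V} (hD : IsRich D) (hE : IsRich E)
    (hDne : ∃ x, x ∈ D) (hj : IsMap j D E)
    (hinj : ∀ x y, x ∈ D → y ∈ D → (ap j x = ap j y ↔ x = y) ∧
      (fst (ap j x) = fst (ap j y) ↔ fst x = fst y)) :
    IsElementaryEmbedding binLang (blockStr D) (blockStr E) j := by
  refine ⟨hj, fun n φ s s' hn hφ hs hs' h => ?_⟩
  have hEne : ∃ x, x ∈ E := hDne.elim fun x hx => ⟨_, hj.ap_mem hx⟩
  refine Similar.sat_iff hD hE hDne hEne hφ hs hs' fun k l hk hl => ?_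
  have h' := (isImageSeq_iff hs.1 hs'.1).1 h
  rw [← hj.1.ap_eq (h' k hk), ← hj.1.ap_eq (h' l hl)]
  have := hinj _ _ (hs.ap_mem hk) (hs.ap_mem hl)
  exact ⟨this.1.symm, this.2.symm⟩

/-! ### Mutually embeddable block structures that code a family of sets -/

section Coding

variable {A Z : V}

/-- The index set of a block: `Z × ω` with one additional point `Z × ω`. -/
noncomputable def pointedBlock (Z : V) : V :=
  union (prod Z omega) (upair (prod Z omega) (prod Z omega))

theorem mem_pointedBlock {w : V} :
    w ∈ pointedBlock Z ↔ (∃ z k, z ∈ Z ∧ k ∈ (omega : V) ∧ w = pair z k) ∨ w = prod Z omega := by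
  simp only [pointedBlock, mem_union, mem_upair, or_self, mem_prod]

theorem pair_ne_prod {z k : V} (hz : z ∈ Z) (hk : k ∈ (omega : V)) : pair z k ≠ prod Z omega :=
  fun e => mem_irrefl _ (e ▸ mem_prod.2 ⟨z, k, hz, hk, rfl⟩)

variable (I Z) in
/-- All blocks `(n, i)` with `n ∈ ω` and `i ∈ I` are full. -/
noncomputable def fullBlocks : V := prod (prod omega I) (pointedBlock Z)

variable (I A Z) in
/-- The block `(0, i)` is restricted to `A(i)`. -/
noncomputable def restrictedBlocks : V :=
  sep (fullBlocks I Z) fun x => ∃ n i w, x = pair (pair n i) w ∧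
    (n = emp → w = prod Z omega ∨ ∃ z k, w = pair z k ∧ z ∈ ap A i)

theorem mem_fullBlocks {x : V} : x ∈ fullBlocks I Z ↔
    ∃ n i w, n ∈ (omega : V) ∧ i ∈ I ∧ w ∈ pointedBlock Z ∧ x = pair (pair n i) w := by
  rw [fullBlocks, mem_prod]
  constructor
  · rintro ⟨p, w, hp, hw, rfl⟩
    obtain ⟨n, i, hn, hi, rfl⟩ := mem_prod.1 hp
    exact ⟨n, i, w, hn, hi, hw, rfl⟩
  · rintro ⟨n, i, w, hn, hi, hw, rfl⟩
    exact ⟨_, w, mem_prod.2 ⟨n, i, hn, hi, rfl⟩, hw, rfl⟩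

theorem mem_restrictedBlocks {x : V} : x ∈ restrictedBlocks I A Z ↔
    ∃ n i w, n ∈ (omega : V) ∧ i ∈ I ∧ w ∈ pointedBlock Z ∧ x = pair (pair n i) w ∧
      (n = emp → w = prod Z omega ∨ ∃ z k, w = pair z k ∧ z ∈ ap A i) := by
  rw [restrictedBlocks, mem_sep, mem_fullBlocks]
  constructor
  · rintro ⟨⟨n, i, w, hn, hi, hw, rfl⟩, n', i', w', e, h⟩
    obtain ⟨e', rfl⟩ := pair_inj.1 e
    obtain ⟨rfl, rfl⟩ := pair_inj.1 e'
    exact ⟨_, _, _, hn, hi, hw, rfl, h⟩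
  · rintro ⟨n, i, w, hn, hi, hw, rfl, h⟩
    exact ⟨⟨n, i, w, hn, hi, hw, rfl⟩, n, i, w, rfl, h⟩

/-- Fresh elements of a block are the pairs `(z, K)` for a fixed `z`; fresh blocks are the `(K, i)`
for a fixed `i`. For the restricted blocks below, `z` is taken from `A(i)`. -/
theorem isRich_fullBlocks (hI : ∃ i, i ∈ I) (hZ : ∃ z, z ∈ Z) : IsRich (fullBlocks I Z) := by
  refine isRich_of_exists (fun x hx => ?_) ?_
  · obtain ⟨n, i, w, hn, hi, hw, rfl⟩ := mem_fullBlocks.1 hx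
    obtain ⟨z, hz⟩ := hZ
    refine ⟨z, fun K hK => ?_⟩
    rw [fst_pair]
    exact mem_fullBlocks.2 ⟨n, i, _, hn, hi, mem_pointedBlock.2 (Or.inl ⟨z, K, hz, hK, rfl⟩), rfl⟩
  · obtain ⟨i, hi⟩ := hI
    exact ⟨i, prod Z omega, fun K hK => mem_fullBlocks.2 ⟨K, i, _, hK, hi,
      mem_pointedBlock.2 (Or.inr rfl), rfl⟩⟩

theorem isRich_restrictedBlocks (hI : ∃ i, i ∈ I) (hA : ∀ i, i ∈ I → ∃ z, z ∈ ap A i)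
    (hAZ : ∀ i z, i ∈ I → z ∈ ap A i → z ∈ Z) : IsRich (restrictedBlocks I A Z) := by
  refine isRich_of_exists (fun x hx => ?_) ?_
  · obtain ⟨n, i, w, hn, hi, hw, rfl, -⟩ := mem_restrictedBlocks.1 hx
    obtain ⟨z, hz⟩ := hA i hi
    refine ⟨z, fun K hK => ?_⟩
    rw [fst_pair]
    exact mem_restrictedBlocks.2 ⟨n, i, _, hn, hi,
      mem_pointedBlock.2 (Or.inl ⟨z, K, hAZ i z hi hz, hK, rfl⟩), rfl,
      fun _ => Or.inr ⟨z, K, rfl, hz⟩⟩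
  · obtain ⟨i, hi⟩ := hI
    exact ⟨i, prod Z omega, fun K hK => mem_restrictedBlocks.2 ⟨K, i, _, hK, hi,
      mem_pointedBlock.2 (Or.inr rfl), rfl, fun _ => Or.inl rfl⟩⟩

theorem base_mem_restrictedBlocks {i : V} (hi : i ∈ I) :
    pair (pair emp i) (prod Z omega) ∈ restrictedBlocks I A Z :=
  mem_restrictedBlocks.2 ⟨_, i, _, emp_mem_omega, hi, mem_pointedBlock.2 (Or.inr rfl), rfl,
    fun _ => Or.inl rfl⟩

/-- The inclusion. -/
theorem exists_embedding_restricted_full (hI : ∃ i, i ∈ I) (hA : ∀ i, i ∈ I → ∃ z, z ∈ ap A i)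
    (hAZ : ∀ i z, i ∈ I → z ∈ ap A i → z ∈ Z) :
    ∃ j, IsElementaryEmbedding binLang (blockStr (restrictedBlocks I A Z))
      (blockStr (fullBlocks I Z)) j := by
  have hZ : ∃ z, z ∈ Z := hI.elim fun i hi => (hA i hi).elim fun z hz => ⟨z, hAZ i z hi hz⟩
  refine ⟨mkFun (restrictedBlocks I A Z) fun x => x, isElementaryEmbedding_blockStr
    (isRich_restrictedBlocks hI hA hAZ) (isRich_fullBlocks hI hZ)
    (hI.elim fun i hi => ⟨_, base_mem_restrictedBlocks hi⟩)
    (isMap_mkFun fun x hx => (mem_sep.1 hx).1) fun x y hx hy => ?_⟩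
  rw [ap_mkFun hx, ap_mkFun hy]
  exact ⟨Iff.rfl, Iff.rfl⟩

/-- Block `(n, i)` is moved to `(n + 1, i)`. This avoids the blocks `(0, i)`, the only ones that are
restricted. -/
theorem exists_embedding_full_restricted (hI : ∃ i, i ∈ I) (hA : ∀ i, i ∈ I → ∃ z, z ∈ ap A i)
    (hAZ : ∀ i z, i ∈ I → z ∈ ap A i → z ∈ Z) :
    ∃ j, IsElementaryEmbedding binLang (blockStr (fullBlocks I Z))
      (blockStr (restrictedBlocks I A Z)) j := by
  have hZ : ∃ z, z ∈ Z := hI.elim fun i hi => (hA i hi).elim fun z hz => ⟨z, hAZ i z hi hz⟩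
  let e : V → V := fun x => pair (pair (succ (fst (fst x))) (snd (fst x))) (snd x)
  have he : ∀ n i w, e (pair (pair n i) w) = pair (pair (succ n) i) w := fun n i w => by
    simp only [e, fst_pair, snd_pair]
  have hap : ∀ {x}, x ∈ fullBlocks I Z → ap (mkFun (fullBlocks I Z) fun x =>
      pair (pair (succ (fst (fst x))) (snd (fst x))) (snd x)) x = e x := fun hx => ap_mkFun hx
  refine ⟨mkFun (fullBlocks I Z) fun x =>
      pair (pair (succ (fst (fst x))) (snd (fst x))) (snd x),
    isElementaryEmbedding_blockStr (isRich_fullBlocks hI hZ)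
    (isRich_restrictedBlocks hI hA hAZ)
    (hI.elim fun i hi => ⟨_, (mem_sep.1 (base_mem_restrictedBlocks (A := A) hi)).1⟩)
    (isMap_iff.2 ⟨isFun_mkFun, fun x hx => ?_⟩) fun x y hx hy => ?_⟩
  · rw [hap hx]
    obtain ⟨n, i, w, hn, hi, hw, rfl⟩ := mem_fullBlocks.1 hx
    rw [he]
    exact mem_restrictedBlocks.2 ⟨_, i, w, succ_mem_omega hn, hi, hw, rfl,
      fun h => (succ_ne_emp _ h).elim⟩
  · rw [hap hx, hap hy]
    obtain ⟨n, i, w, hn, hi, hw, rfl⟩ := mem_fullBlocks.1 hx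
    obtain ⟨n', i', w', hn', hi', hw', rfl⟩ := mem_fullBlocks.1 hy
    have hsucc : succ n = succ n' ↔ n = n' := ⟨succ_inj, fun h => h ▸ rfl⟩
    simp only [he, fst_pair, pair_inj, hsucc, iff_self, and_self]

/-- In an ultrapower of the full blocks no element is isolated. -/
theorem not_models_of_fullBlocks (hU : IsUltrafilter U I) (hZ : ∃ z, z ∈ Z)
    {Q : Str V} (hQ : IsUltrapower binLang I U (blockStr (fullBlocks I Z)) Q) :
    ¬ Models binLang Q existsIsolated := by
  obtain ⟨F, hF, hat, hQ⟩ := hQ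
  have hstr : ∀ i, i ∈ I → F.str i = blockStr (fullBlocks I Z) :=
    fun i hi => (hF.at_iff.1 (hat i hi)).2.symm
  have hmem : ∀ {g}, g ∈ prodSet I F ↔ IsFun g I ∧ ∀ i, i ∈ I → ap g i ∈ fullBlocks I Z := by
    intro g
    rw [hF.mem_prodSet_iff]
    refine and_congr_right fun _ => forall_congr' fun i => imp_congr_right fun hi => ?_
    rw [hstr i hi]
    rfl
  rw [models_existsIsolated hQ.isStr]
  rintro ⟨c, hc, h⟩
  obtain ⟨f, hf, rfl⟩ := (hQ.mem_dom_iff isLang_binLang hU hF).1 hc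
  obtain ⟨z, hz⟩ := hZ
  obtain ⟨star, hstar⟩ : ∃ star, star = prod Z omega := ⟨_, rfl⟩
  have hw : ∀ w, w = pair z emp ∨ w = star → w ∈ pointedBlock Z := by
    rintro w (rfl | rfl)
    · exact mem_pointedBlock.2 (Or.inl ⟨z, emp, hz, emp_mem_omega, rfl⟩)
    · exact mem_pointedBlock.2 (Or.inr hstar)
  -- A partner of `f(i)` in its own block, found uniformly: the additional point, or the fixed pair
  -- `(z, 0)` if `f(i)` is already at the additional point.
  let g := mkFun I fun i => pair (fst (ap f i)) (if snd (ap f i) = star then pair z emp else star)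
  have hg : ∀ i, i ∈ I →
      ap g i ∈ fullBlocks I Z ∧ fst (ap f i) = fst (ap g i) ∧ ap f i ≠ ap g i := by
    intro i hi
    obtain ⟨n, j, w, hn, hj, -, e⟩ := mem_fullBlocks.1 ((hmem.1 hf).2 i hi)
    simp only [g]
    rw [ap_mkFun hi, e, fst_pair, fst_pair, snd_pair]
    refine ⟨mem_fullBlocks.2 ⟨n, j, _, hn, hj, hw _ ?_, rfl⟩, rfl, fun e' => ?_⟩
    · split
      · exact Or.inl rfl
      · exact Or.inr rfl
    · have e' := (pair_inj.1 e').2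
      split at e'
      · next h => exact pair_ne_prod hz emp_mem_omega (e'.symm.trans (h.trans hstar))
      · next h => exact h e'
  have hgP : g ∈ prodSet I F := hmem.2 ⟨isFun_mkFun, fun i hi => (hg i hi).1⟩
  refine h _ (hQ.cls_mem isLang_binLang hU hF hgP) ((hQ.rel_assign₂ hU hF hf hgP).2
    (large_of_forall hU fun i hi => ?_))
  rw [hstr i hi]
  exact (relHolds_blockStr_assign₂ ((hmem.1 hf).2 i hi) (hg i hi).1).2 (hg i hi).2

/-- An ultrapower of the restricted blocks without isolated elements chooses from the `A(i)`. -/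
theorem exists_choice_of_restrictedBlocks (hU : IsUltrafilter U I) (hA : IsFun A I) {P : Str V}
    (hP : IsUltrapower binLang I U (blockStr (restrictedBlocks I A Z)) P)
    (h : ¬ Models binLang P existsIsolated) :
    ∃ f, IsFun f I ∧ Large U I fun i => ∃ a x, App A i a ∧ App f i x ∧ x ∈ a := by
  obtain ⟨F, hF, hat, hP⟩ := hP
  have hstr : ∀ i, i ∈ I → F.str i = blockStr (restrictedBlocks I A Z) :=
    fun i hi => (hF.at_iff.1 (hat i hi)).2.symm
  have hmem : ∀ {g}, g ∈ prodSet I F ↔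
      IsFun g I ∧ ∀ i, i ∈ I → ap g i ∈ restrictedBlocks I A Z := by
    intro g
    rw [hF.mem_prodSet_iff]
    refine and_congr_right fun _ => forall_congr' fun i => imp_congr_right fun hi => ?_
    rw [hstr i hi]
    rfl
  obtain ⟨star, hstar⟩ : ∃ star, star = prod Z omega := ⟨_, rfl⟩
  -- The additional point of the restricted block `(0, i)`, which is available without choice.
  let f := mkFun I fun i => pair (pair emp i) star
  have hf : ∀ i, i ∈ I → ap f i = pair (pair emp i) (prod Z omega) := fun i hi => by
    simp only [f]
    rw [ap_mkFun hi, hstar]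
  have hfP : f ∈ prodSet I F := hmem.2 ⟨isFun_mkFun, fun i hi => by
    rw [hf i hi]
    exact base_mem_restrictedBlocks hi⟩
  rw [models_existsIsolated hP.isStr] at h
  -- The class of `f` is not isolated, so it has a partner in the ultrapower.
  obtain ⟨c, hc, hrel⟩ : ∃ c, c ∈ P.dom ∧ RelHolds P emp (assign₂ (cls I U F f) c) := by
    by_contra hcon
    exact h ⟨_, hP.cls_mem isLang_binLang hU hF hfP, fun c hc hr => hcon ⟨c, hc, hr⟩⟩
  obtain ⟨g, hg, rfl⟩ := (hP.mem_dom_iff isLang_binLang hU hF).1 hc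
  rw [hP.rel_assign₂ hU hF hfP hg] at hrel
  -- For `U`-many `i` the partner has the form `((0, i), (z, k))` with `z ∈ A(i)`; the function
  -- extracts `z`.
  have hfun : IsFun (mkFun I fun i => fst (snd (ap g i))) I := isFun_mkFun
  refine ⟨_, hfun, hrel.mono hU fun i hi hr => ⟨_, _, hA.app hi, hfun.app hi, ?_⟩⟩
  have hgi := (hmem.1 hg).2 i hi
  rw [hstr i hi, relHolds_blockStr_assign₂ ((hmem.1 hfP).2 i hi) hgi, hf i hi] at hr
  rw [ap_mkFun hi]
  obtain ⟨n, j, w, hn, hj, hw, e, hA'⟩ := mem_restrictedBlocks.1 hgi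
  rw [e, fst_pair, fst_pair, pair_inj] at hr
  obtain ⟨⟨rfl, rfl⟩, hne⟩ := hr
  -- The additional point is excluded, since related elements are distinct.
  obtain rfl | ⟨z, k, rfl, hz⟩ := hA' rfl
  · exact (hne rfl).elim
  · rwa [e, snd_pair, fst_pair]

end Coding

/-- `existsIsolated` fails in the ultrapower of the full blocks, so by `Σ₂`-equivalence it fails in
that of the restricted blocks, where its failure yields a choice. -/
theorem MutualEmbeddingSigmaTwo.ultrafilterAC (h : MutualEmbeddingSigmaTwo U I)
    (hU : IsUltrafilter U I) : UltrafilterAC U I := by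
  intro A hA hne
  have hne' : ∀ i, i ∈ I → ∃ x, x ∈ ap A i := fun i hi => hne i _ (hA.app hi)
  have hI : ∃ i, i ∈ I :=
    ((large_of_forall hU (Q := fun _ => True) fun _ _ => trivial).exists hU).imp fun _ h => h.1
  have hAZ : ∀ i z, i ∈ I → z ∈ ap A i → z ∈ rangeUnion I A := fun i z => mem_rangeUnion
  have hZ : ∃ z, z ∈ rangeUnion I A :=
    hI.elim fun i hi => (hne' i hi).elim fun z hz => ⟨z, hAZ i z hi hz⟩
  have hbase : ∃ x, x ∈ restrictedBlocks I A (rangeUnion I A) :=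
    hI.elim fun i hi => ⟨_, base_mem_restrictedBlocks hi⟩
  obtain ⟨P, Q, hP, hQ, hPQ⟩ := h binLang _ _ isLang_binLang (isStr_blockStr hbase)
    (isStr_blockStr (hbase.imp fun x hx => (mem_sep.1 hx).1))
    (exists_embedding_restricted_full hI hne' hAZ) (exists_embedding_full_restricted hI hne' hAZ)
  exact exists_choice_of_restrictedBlocks hU hA hP fun hmod =>
    not_models_of_fullBlocks hU hZ hQ
      ((hPQ _ _ (isEmptySet_iff.2 rfl) isSigma_existsIsolated).1 hmod)

end BlockStructures

end InternalZF

theorem theorem1p4 {V : Type u} [Membership V V] (hV : InternalZF.IsModelOfZF V)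
    (I U : V) (hU : InternalZF.IsUltrafilter U I) :
    List.TFAE
      [InternalZF.UltrafilterAC U I,
       InternalZF.UltrapowerSigmaTwo U I,
       InternalZF.UltraproductSigmaOneFactor U I,
       InternalZF.MutualEmbeddingSigmaTwo U I,
       InternalZF.IsomorphicFactorsSigmaOne U I,
       InternalZF.IsomorphicFactorsIsomorphic U I] := by
  have : InternalZF.ZFModel V := ⟨hV⟩
  tfae_have 1 → 2 := fun h => h.ultrapowerSigmaTwo hU
  tfae_have 2 → 4 := fun h => h.mutualEmbeddingSigmaTwo
  tfae_have 4 → 1 := fun h => h.ultrafilterAC hU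
  tfae_have 1 → 3 := fun h => h.ultraproductSigmaOneFactor hU
  tfae_have 3 → 1 := fun h => h.ultrafilterAC hU
  tfae_have 1 → 6 := fun h => h.isomorphicFactorsIsomorphic hU
  tfae_have 6 → 5 := fun h => h.isomorphicFactorsSigmaOne
  tfae_have 5 → 1 := fun h => h.ultrafilterAC hU
  tfae_finish
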